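/- Let $G=(V,E)$ be a finite simple graph. For $\lambda>0$ let $\mu_{G,\lambda}$ be the arboreal gas measure, i.e. the probability measure on subsets of $E$ supported on the forests $F\subseteq E$ of $G$ (acyclic edge sets, viewed as spanning subgraphs $(V,F)$ with any number of components) with $\mu_{G,\lambda}(F)\propto\lambda^{|F|}$. For vertices, write $\mu(x\cdots,\,y\cdots,\,\dots)$ for the $\mu_{G,\lambda}$-probability that the vertices listed in each block lie in a common component of $(V,F)$ while vertices in different blocks lie in different components (with no restriction on the total number of components); for instance $\mu(a,bc,d)$ is the probability that $a$ is in one component, $b,c$ are in a second one and $d$ is in a third one, and $\mu(abcd)$ is the probability that $a,b,c,d$ are all in the same component. **Theorem.** Let $G=(V,E)$ be a finite simple graph and let $a,b,c,d\in V$ (not necessarily distinct). Then there is $\lambda_0=\lambda_0(G,a,b,c,d)$ such that for all real $\lambda\ge\lambda_0$, $$ \begin{aligned} &\big(\mu(a,bcd)+\mu(acd,b)+\mu(ac,bd)+\mu(ad,bc)\big)\,\big(\mu(c,abd)+\mu(abc,d)+\mu(ac,bd)+\mu(ad,bc)\big)\\ &\qquad\le \big(\mu(a,bc,d)+\mu(a,bd,c)+\mu(b,ac,d)+\mu(b,ad,c)\big)\,\mu(abcd)+\big(\mu(ac,bd)-\mu(ad,bc)\big)^2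 . \end{aligned} $$ -/

import Mathlib

namespace ArborealGas

variable {V : Type*}

/-- The spanning subgraph `(V, S)` with edge set `S`. -/
def spanningGraph (S : Finset (Sym2 V)) : SimpleGraph V :=
  SimpleGraph.fromEdgeSet (S : Set (Sym2 V))

open Classical in
/-- The forests of `G`: the subsets of the edge set of `G` that contain no cycle. Isolated vertices
are allowed, and a forest may have any number of components. -/
noncomputable def forests [Fintype V] (G : SimpleGraph V) : Finset (Finset (Sym2 V)) :=
  G.edgeFinset.powerset.filter fun S => (spanningGraph S).IsAcyclic

/-- The partition function `∑_F lam ^ |F|`, summed over the forests `F` of `G`. -/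
noncomputable def partitionFunction [Fintype V] (G : SimpleGraph V) (lam : ℝ) : ℝ :=
  ∑ F ∈ forests G, lam ^ F.card

open Classical in
/-- The mass that the arboreal gas measure with parameter `lam` gives to a set `S` of edges:
it is proportional to `lam ^ |S|` if `S` is a forest of `G`, and zero otherwise. -/
noncomputable def mass [Fintype V] (G : SimpleGraph V) (lam : ℝ) (S : Finset (Sym2 V)) : ℝ :=
  if S ∈ forests G then lam ^ S.card / partitionFunction G lam else 0

open Classical in
/-- The probability of an event under the arboreal gas measure on the subsets of the edge set. -/
noncomputable def prob [Fintype V] (G : SimpleGraph V) (lam : ℝ)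
    (A : Finset (Sym2 V) → Prop) : ℝ :=
  ∑ S ∈ G.edgeFinset.powerset.filter A, mass G lam S

/-- The event that the vertices listed in one block lie in a common component of `(V, S)`, and that
vertices listed in distinct blocks lie in different components. Nothing is required of the
components that meet no block. -/
def Blocks (B : List (List V)) (S : Finset (Sym2 V)) : Prop :=
  (∀ s ∈ B, ∀ x ∈ s, ∀ y ∈ s, (spanningGraph S).Reachable x y) ∧
    B.Pairwise fun s t => ∀ x ∈ s, ∀ y ∈ t, ¬ (spanningGraph S).Reachable x y

/-- The probability that the blocks of `B` lie in distinct components; for example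
`μ G lam [[a], [b, c], [d]]` is the probability that `a` is in one component, `b` and `c` are in
a second one, and `d` is in a third one. -/
noncomputable def μ [Fintype V] (G : SimpleGraph V) (lam : ℝ) (B : List (List V)) : ℝ :=
  prob G lam (Blocks B)

theorem mem_forests [Fintype V] (G : SimpleGraph V) (S : Finset (Sym2 V)) :
    S ∈ forests G ↔ (S : Set (Sym2 V)) ⊆ G.edgeSet ∧ (spanningGraph S).IsAcyclic := by
  unfold forests
  simp only [Finset.mem_filter, Finset.mem_powerset, ← Finset.coe_subset,
    SimpleGraph.coe_edgeFinset]

theorem empty_mem_forests [Fintype V] (G : SimpleGraph V) : ∅ ∈ forests G := by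
  rw [mem_forests]
  simp [spanningGraph]

theorem partitionFunction_pos [Fintype V] (G : SimpleGraph V) {lam : ℝ} (h : 0 ≤ lam) :
    0 < partitionFunction G lam := by
  refine Finset.sum_pos' (fun F _ => by positivity) ⟨∅, empty_mem_forests G, by simp⟩

theorem mass_nonneg [Fintype V] (G : SimpleGraph V) {lam : ℝ} (h : 0 ≤ lam)
    (S : Finset (Sym2 V)) : 0 ≤ mass G lam S := by
  have := partitionFunction_pos G h
  unfold mass
  split_ifs <;> positivity

/-- The arboreal gas measure has total mass one. -/
theorem prob_true [Fintype V] (G : SimpleGraph V) {lam : ℝ} (h : 0 ≤ lam) :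
    prob G lam (fun _ => True) = 1 := by
  classical
  have hZ := partitionFunction_pos G h
  have hsub : forests G ⊆ G.edgeFinset.powerset := by
    intro S hS
    simp only [forests, Finset.mem_filter] at hS
    convert hS.1
  have h1 : prob G lam (fun _ => True) = ∑ S ∈ G.edgeFinset.powerset, mass G lam S := by
    unfold prob
    refine Finset.sum_congr ?_ fun _ _ => rfl
    ext S
    simp
  rw [h1, ← Finset.sum_subset hsub (fun S _ hS => by simp [mass, hS])]
  rw [Finset.sum_congr rfl (fun S hS => by rw [mass, if_pos hS]), ← Finset.sum_div]
  exact div_self hZ.ne'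

end ArborealGas

/-!
Let `Θ(w)` be the sum, over the forests that join all four terminals `a, b, c, d`, of the products
of edge weights (`weightSum (JoinForest a b c d)`). It is affine in the weight of each edge, and
its increment along an edge `xy` is the weight of the forests that join all terminals once `xy` is
added. The partition weights in the inequality are therefore finite differences of `Θ` along the
edges between terminals (`response_joinForest`), and the right side minus the left side is, up to
normalization, `pair X X`, where `X` is the vector of these differences (`response`) and `pair` is
a symmetric bilinear form of signature `(3, 2)` on `ℝ⁵` (`nonneg_pair_iff`, `prob_eq_weightSum`).

For large `λ` expand `X` in powers of `1 / λ`, according to the number of components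
(`deficitSum`). The leading order sees only spanning trees. By the matrix-tree theorem, which
follows from the Cauchy–Binet formula (`det_gram`, `det_gram_eq_weightSum`), the response of the
tree sum of a vertex set `A` is a multiple of
`(det K, K 1 1, K 0 0, K 0 1, 1)` (`response_treeOn`, `minors_det`). Here `K` is the `2 × 2` matrix
of the least energy of a potential on `A` in terms of the differences `φ a - φ b` and
`φ c - φ d`, a Schur complement of the Laplacian. On two such vectors `pair` is, up to the factors,
`det (K - K')` (`pair_treeOn_eq`). So the leading order of `pair X X` vanishes
(`pair_treeOn_self`). In the next order the forests with two components appear; if `S` is the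
component without terminals, they contribute the trees on `S` times the trees on the complement
of `S` (`weightSum_two_components`). Deleting `S` can only lower the energy, so the difference of
the two matrices is positive semidefinite and its determinant is nonnegative
(`schur_sub_schur_ge`, `pair_treeOn_nonneg`). It is positive unless the potential of some nonzero
current, entering and leaving at the terminals in the pairs `ab` and `cd`, carries no current on
the edges meeting `S` (`pair_treeOn_pos`).

This second order is not always positive, but when it vanishes so does the whole form. If a
vertex separates `{a, b}` from `{c, d}`, then `Θ` is a product and `pair X X = 0`
(`pair_response_eq_zero_of_cut`). If every component of the graph without the terminals touches at
most two of them, then each of them acts like an edge between these two; after this replacement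
(`exists_response_eq_detach`) only spanning trees on the terminals are left, and again
`pair X X = 0` (`pair_response_eq_zero_of_contacts`). In the remaining case consider a component
that touches three terminals, and in it a largest connected set `S` whose removal leaves a path
from `{a, b}` to `{c, d}`. The maximality of `S` and the maximum principle force every potential
that carries no current near `S` to be constant on both pairs (`exists_isRigid`), so the next order
is strictly positive (`IsRigid.eventually_pair_pos`).

Components of the graph without terminals only contribute a factor
(`eventually_pair_nonneg_of_reachable`), and the inequality is elementary if terminals of the same
pair coincide, if the two pairs coincide, or if the terminals are not all connected
(`pair_response_nonneg_of_degenerate`).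
-/

namespace ArborealGas

open Classical

/-! ### Reachability and acyclicity of spanning subgraphs -/

section Reachability

variable {V : Type*}

theorem spanningGraph_adj {S : Finset (Sym2 V)} {u v : V} :
    (spanningGraph S).Adj u v ↔ s(u, v) ∈ S ∧ u ≠ v := by
  simp [spanningGraph]

theorem spanningGraph_mono {S T : Finset (Sym2 V)} (h : S ⊆ T) :
    spanningGraph S ≤ spanningGraph T :=
  SimpleGraph.fromEdgeSet_mono (by exact_mod_cast h)

theorem spanningGraph_union (S T : Finset (Sym2 V)) :
    spanningGraph (S ∪ T) = spanningGraph S ⊔ spanningGraph T := by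
  simp [spanningGraph, SimpleGraph.fromEdgeSet_union]

theorem spanningGraph_insert (S : Finset (Sym2 V)) (x y : V) :
    spanningGraph (insert s(x, y) S) = spanningGraph S ⊔ SimpleGraph.edge x y := by
  ext u v
  simp only [spanningGraph_adj, Finset.mem_insert, SimpleGraph.sup_adj, SimpleGraph.edge_adj,
    Sym2.eq_iff]
  tauto

/-- A property that holds at the start of a walk and passes along edges holds at its end. -/
theorem reachable_induction {G : SimpleGraph V} {P : V → Prop} {p r : V} (h : G.Reachable p r)
    (h0 : P p) (hs : ∀ u v, P u → G.Adj u v → P v) : P r := by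
  obtain ⟨w⟩ := h
  induction w with
  | nil => exact h0
  | cons hadj _ ih => exact ih (hs _ _ h0 hadj)

theorem reachable_sup_edge {G : SimpleGraph V} {x y p r : V} :
    (G ⊔ SimpleGraph.edge x y).Reachable p r ↔
      G.Reachable p r ∨ (G.Reachable p x ∧ G.Reachable y r) ∨
        (G.Reachable p y ∧ G.Reachable x r) := by
  constructor
  · intro h
    refine reachable_induction (P := fun r => G.Reachable p r ∨ (G.Reachable p x ∧ G.Reachable y r) ∨
        (G.Reachable p y ∧ G.Reachable x r)) h (Or.inl (SimpleGraph.Reachable.refl _)) ?_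
    intro u v hu huv
    rcases (SimpleGraph.sup_adj _ _ _ _).1 huv with h1 | h1
    · have := h1.reachable
      rcases hu with h | ⟨h, h'⟩ | ⟨h, h'⟩
      · exact Or.inl (h.trans this)
      · exact Or.inr (Or.inl ⟨h, h'.trans this⟩)
      · exact Or.inr (Or.inr ⟨h, h'.trans this⟩)
    · rw [SimpleGraph.edge_adj] at h1
      obtain ⟨⟨rfl, rfl⟩ | ⟨rfl, rfl⟩, _⟩ := h1
      · rcases hu with h | ⟨h, h'⟩ | ⟨h, h'⟩
        · exact Or.inr (Or.inl ⟨h, SimpleGraph.Reachable.refl _⟩)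
        · exact Or.inr (Or.inl ⟨h, SimpleGraph.Reachable.refl _⟩)
        · exact Or.inl h
      · rcases hu with h | ⟨h, h'⟩ | ⟨h, h'⟩
        · exact Or.inr (Or.inr ⟨h, SimpleGraph.Reachable.refl _⟩)
        · exact Or.inl h
        · exact Or.inr (Or.inr ⟨h, SimpleGraph.Reachable.refl _⟩)
  · have hle : G ≤ G ⊔ SimpleGraph.edge x y := le_sup_left
    have hxy : (G ⊔ SimpleGraph.edge x y).Reachable x y := by
      by_cases h : x = y
      · rw [h]
      · exact SimpleGraph.Adj.reachable (Or.inr (by simp [SimpleGraph.edge_adj, h]))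
    rintro (h | ⟨h, h'⟩ | ⟨h, h'⟩)
    · exact h.mono hle
    · exact ((h.mono hle).trans hxy).trans (h'.mono hle)
    · exact ((h.mono hle).trans hxy.symm).trans (h'.mono hle)

/-- Acyclic edge sets, loops being excluded explicitly because `spanningGraph` ignores them. -/
def IsForest (F : Finset (Sym2 V)) : Prop :=
  (∀ e ∈ F, ¬ e.IsDiag) ∧ (spanningGraph F).IsAcyclic

theorem IsForest.subset {F F' : Finset (Sym2 V)} (h : IsForest F) (hs : F' ⊆ F) : IsForest F' :=
  ⟨fun e he => h.1 e (hs he), h.2.anti (spanningGraph_mono hs)⟩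

theorem isForest_insert {F : Finset (Sym2 V)} {x y : V} (h : s(x, y) ∉ F) :
    IsForest (insert s(x, y) F) ↔ IsForest F ∧ ¬ (spanningGraph F).Reachable x y := by
  unfold IsForest
  rw [spanningGraph_insert, SimpleGraph.isAcyclic_sup_fromEdgeSet_iff, spanningGraph_adj]
  simp only [Finset.mem_insert, forall_eq_or_imp, Sym2.mk_isDiag_iff, h, false_and, or_false]
  constructor
  · rintro ⟨⟨h1, h2⟩, h3, h4⟩
    exact ⟨⟨h2, h3⟩, fun h5 => h1 (h4 h5)⟩
  · rintro ⟨⟨h2, h3⟩, h4⟩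
    refine ⟨⟨?_, h2⟩, h3, fun h5 => absurd h5 h4⟩
    rintro rfl
    exact h4 (SimpleGraph.Reachable.refl _)

end Reachability

/-! ### Gluing two graphs along two vertices -/

section Glue

variable {V : Type*} {H₁ H₂ : SimpleGraph V} {A₁ A₂ : Set V} {x y : V}

/-- Reachability in `H₂` when `x` and `y` are joined by an additional edge in case they are
connected in `H₁`. -/
def ReachVia (H₁ H₂ : SimpleGraph V) (x y p r : V) : Prop :=
  H₂.Reachable p r ∨ (H₁.Reachable x y ∧
    ((H₂.Reachable p x ∧ H₂.Reachable y r) ∨ (H₂.Reachable p y ∧ H₂.Reachable x r)))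

/-- If `H₁` and `H₂` live on vertex sets meeting only in `x` and `y`, then a walk of `H₁ ⊔ H₂`
that starts on the side of `H₂` sees `H₁` only through the question whether `H₁` joins `x`
to `y`. -/
theorem reachable_sup_of_inter_subset (h₁ : ∀ u v, H₁.Adj u v → u ∈ A₁)
    (h₂ : ∀ u v, H₂.Adj u v → u ∈ A₂) (hA : ∀ v ∈ A₁, v ∈ A₂ → v = x ∨ v = y)
    {p r : V} (hp : p ∈ A₂) (h : (H₁ ⊔ H₂).Reachable p r) :
    (r ∈ A₂ → ReachVia H₁ H₂ x y p r) ∧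
      (r ∈ A₁ → ∃ z, (z = x ∨ z = y) ∧ ReachVia H₁ H₂ x y p z ∧ H₁.Reachable z r) := by
  have refl₁ : ∀ v, H₁.Reachable v v := fun v => SimpleGraph.Reachable.refl _
  have refl₂ : ∀ v, H₂.Reachable v v := fun v => SimpleGraph.Reachable.refl _
  refine reachable_induction (P := fun r => (r ∈ A₂ → ReachVia H₁ H₂ x y p r) ∧
      (r ∈ A₁ → ∃ z, (z = x ∨ z = y) ∧ ReachVia H₁ H₂ x y p z ∧ H₁.Reachable z r)) h
    ⟨fun _ => Or.inl (refl₂ p),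
    fun hp1 => ⟨p, hA p hp1 hp, Or.inl (refl₂ p), refl₁ p⟩⟩ ?_
  rintro u v ⟨hu2, hu1⟩ huv
  rcases (SimpleGraph.sup_adj _ _ _ _).1 huv with huv | huv
  · obtain ⟨z, hz, hJ, hzu⟩ := hu1 (h₁ _ _ huv)
    have hzv := hzu.trans huv.reachable
    refine ⟨fun hv2 => ?_, fun _ => ⟨z, hz, hJ, hzv⟩⟩
    have hv := hA v (h₁ _ _ huv.symm) hv2
    by_cases hzv' : z = v
    · exact hzv' ▸ hJ
    have hxy : H₁.Reachable x y := by
      rcases hz with rfl | rfl <;> rcases hv with rfl | rfl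
      · exact absurd rfl hzv'
      · exact hzv
      · exact hzv.symm
      · exact absurd rfl hzv'
    rcases hz with rfl | rfl <;> rcases hv with rfl | rfl
    · exact hJ
    · rcases hJ with hJ | ⟨_, hJ | hJ⟩
      · exact Or.inr ⟨hxy, Or.inl ⟨hJ, refl₂ _⟩⟩
      · exact Or.inr ⟨hxy, Or.inl ⟨hJ.1, refl₂ _⟩⟩
      · exact Or.inl hJ.1
    · rcases hJ with hJ | ⟨_, hJ | hJ⟩
      · exact Or.inr ⟨hxy, Or.inr ⟨hJ, refl₂ _⟩⟩
      · exact Or.inl hJ.1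
      · exact Or.inr ⟨hxy, Or.inr ⟨hJ.1, refl₂ _⟩⟩
    · exact hJ
  · have huv' := huv.reachable
    have hJ : ReachVia H₁ H₂ x y p v := by
      rcases hu2 (h₂ _ _ huv) with hJ | ⟨hxy, hJ | hJ⟩
      · exact Or.inl (hJ.trans huv')
      · exact Or.inr ⟨hxy, Or.inl ⟨hJ.1, hJ.2.trans huv'⟩⟩
      · exact Or.inr ⟨hxy, Or.inr ⟨hJ.1, hJ.2.trans huv'⟩⟩
    exact ⟨fun _ => hJ, fun hv1 => ⟨v, hA v hv1 (h₂ _ _ huv.symm), hJ, refl₁ v⟩⟩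

theorem ReachVia.reachable_sup {p r : V} (h : ReachVia H₁ H₂ x y p r) :
    (H₁ ⊔ H₂).Reachable p r := by
  have l₁ : H₁ ≤ H₁ ⊔ H₂ := le_sup_left
  have l₂ : H₂ ≤ H₁ ⊔ H₂ := le_sup_right
  rcases h with h | ⟨hxy, ⟨h, h'⟩ | ⟨h, h'⟩⟩
  · exact h.mono l₂
  · exact ((h.mono l₂).trans (hxy.mono l₁)).trans (h'.mono l₂)
  · exact ((h.mono l₂).trans (hxy.symm.mono l₁)).trans (h'.mono l₂)

theorem reachable_sup_iff_reachVia (h₁ : ∀ u v, H₁.Adj u v → u ∈ A₁)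
    (h₂ : ∀ u v, H₂.Adj u v → u ∈ A₂) (hA : ∀ v ∈ A₁, v ∈ A₂ → v = x ∨ v = y)
    {p r : V} (hp : p ∈ A₂) (hr : r ∈ A₂) :
    (H₁ ⊔ H₂).Reachable p r ↔ ReachVia H₁ H₂ x y p r :=
  ⟨fun h => (reachable_sup_of_inter_subset h₁ h₂ hA hp h).1 hr, fun h => h.reachable_sup⟩

/-- No edge of `H₁` closes a cycle in `H₁ ⊔ H₂`, unless both graphs join `x` to `y`. -/
theorem not_reachable_deleteEdges_sup (h₁ : ∀ u v, H₁.Adj u v → u ∈ A₁)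
    (h₂ : ∀ u v, H₂.Adj u v → u ∈ A₂) (hA : ∀ v ∈ A₂, v ∈ A₁ → v = x ∨ v = y)
    (a₁ : H₁.IsAcyclic)
    (hxy : ¬ (H₁.Reachable x y ∧ H₂.Reachable x y)) {u v : V} (huv : H₁.Adj u v) :
    ¬ ((H₁ ⊔ H₂).deleteEdges {s(u, v)}).Reachable u v := by
  intro h
  have hle : (H₁ ⊔ H₂).deleteEdges {s(u, v)} ≤ H₂ ⊔ H₁.deleteEdges {s(u, v)} := by
    intro p q hpq
    rw [SimpleGraph.deleteEdges_adj] at hpq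
    rcases hpq with ⟨hpq | hpq, hne⟩
    · exact Or.inr (by rw [SimpleGraph.deleteEdges_adj]; exact ⟨hpq, hne⟩)
    · exact Or.inl hpq
  have hbr : ¬ (H₁.deleteEdges {s(u, v)}).Reachable u v :=
    SimpleGraph.isAcyclic_iff_forall_adj_isBridge.1 a₁ huv
  have hmono : H₁.deleteEdges {s(u, v)} ≤ H₁ := SimpleGraph.deleteEdges_le _
  rcases (reachable_sup_of_inter_subset (H₁ := H₂) (H₂ := H₁.deleteEdges {s(u, v)}) h₂
    (fun p q hpq => h₁ p q (hmono hpq)) hA (h₁ _ _ huv) (h.mono hle)).1 (h₁ _ _ huv.symm) with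
    h' | ⟨hxy2, ⟨h', h''⟩ | ⟨h', h''⟩⟩
  · exact hbr h'
  · exact hxy ⟨((h'.mono hmono).symm.trans huv.reachable).trans (h''.mono hmono).symm, hxy2⟩
  · exact hxy ⟨((h''.mono hmono).trans huv.reachable.symm).trans (h'.mono hmono), hxy2⟩

/-- Two graphs whose vertex sets meet only in `x` and `y` form a cycle across both exactly when each
of them joins `x` to `y`. -/
theorem isAcyclic_sup_iff (h₁ : ∀ u v, H₁.Adj u v → u ∈ A₁)
    (h₂ : ∀ u v, H₂.Adj u v → u ∈ A₂) (hA : ∀ v ∈ A₁, v ∈ A₂ → v = x ∨ v = y)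
    (hd : ∀ u v, H₁.Adj u v → ¬ H₂.Adj u v) (hne : x ≠ y) :
    (H₁ ⊔ H₂).IsAcyclic ↔
      H₁.IsAcyclic ∧ H₂.IsAcyclic ∧ ¬ (H₁.Reachable x y ∧ H₂.Reachable x y) := by
  constructor
  · intro h
    refine ⟨h.anti le_sup_left, h.anti le_sup_right, ?_⟩
    rintro ⟨r₁, r₂⟩
    obtain ⟨p, hp⟩ := r₁.exists_isPath
    obtain ⟨q, hq⟩ := r₂.exists_isPath
    have he := congrArg SimpleGraph.Walk.edges (congrArg Subtype.val ((h.subsingleton_path x y).elim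
      ⟨p.mapLe (le_sup_left : H₁ ≤ H₁ ⊔ H₂), hp.mapLe _⟩
      ⟨q.mapLe (le_sup_right : H₂ ≤ H₁ ⊔ H₂), hq.mapLe _⟩))
    simp only [SimpleGraph.Walk.edges_mapLe_eq_edges] at he
    cases p with
    | nil => exact hne rfl
    | cons hadj p' =>
      rename_i v
      have hm : s(x, v) ∈ q.edges := by rw [← he]; exact List.mem_cons_self
      exact hd _ _ hadj (q.adj_of_mem_edges hm)
  · rintro ⟨a₁, a₂, hxy⟩
    rw [SimpleGraph.isAcyclic_iff_forall_adj_isBridge]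
    intro u v huv
    rcases (SimpleGraph.sup_adj _ _ _ _).1 huv with h | h
    · exact not_reachable_deleteEdges_sup h₁ h₂ (fun v h2 h1 => hA v h1 h2) a₁ hxy h
    · rw [sup_comm]
      exact not_reachable_deleteEdges_sup h₂ h₁ hA a₂
        (fun hh => hxy ⟨hh.2, hh.1⟩) h

end Glue

/-! ### Weighted sums over edge sets -/

section Sums

variable {V : Type*} [Fintype V]

/-- The sum of the weights `∏ e ∈ F, w e` of the edge sets `F` with property `P`. -/
noncomputable def weightSum (P : Finset (Sym2 V) → Prop) (w : Sym2 V → ℝ) : ℝ :=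
  ∑ F with P F, ∏ e ∈ F, w e

/-- The edge sets without `e` that acquire the property `P` when `e` is added. -/
def Link (e : Sym2 V) (P : Finset (Sym2 V) → Prop) (F : Finset (Sym2 V)) : Prop :=
  e ∉ F ∧ P (insert e F)

theorem weightSum_congr {P Q : Finset (Sym2 V) → Prop} {w w' : Sym2 V → ℝ}
    (h : ∀ F, (P F ∧ ∏ e ∈ F, w e ≠ 0) ∨ (Q F ∧ ∏ e ∈ F, w' e ≠ 0) →
      (P F ∧ Q F ∧ ∏ e ∈ F, w e = ∏ e ∈ F, w' e)) :
    weightSum P w = weightSum Q w' := by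
  unfold weightSum
  rw [Finset.sum_filter, Finset.sum_filter]
  refine Finset.sum_congr rfl fun F _ => ?_
  have hF := h F
  by_cases h1 : P F ∧ ∏ e ∈ F, w e ≠ 0
  · obtain ⟨hp, hq, he⟩ := hF (Or.inl h1)
    rw [if_pos hp, if_pos hq, he]
  by_cases h2 : Q F ∧ ∏ e ∈ F, w' e ≠ 0
  · obtain ⟨hp, hq, he⟩ := hF (Or.inr h2)
    rw [if_pos hp, if_pos hq, he]
  · have e1 : (if P F then ∏ e ∈ F, w e else 0) = 0 := by
      split_ifs with hp
      · by_contra hne; exact h1 ⟨hp, hne⟩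
      · rfl
    have e2 : (if Q F then ∏ e ∈ F, w' e else 0) = 0 := by
      split_ifs with hp
      · by_contra hne; exact h2 ⟨hp, hne⟩
      · rfl
    rw [e1, e2]

/-- A weighted sum is affine in the weight of each edge; the slope is the weighted sum over the
link of the edge. -/
theorem weightSum_add_single (P : Finset (Sym2 V) → Prop) (w : Sym2 V → ℝ) (e : Sym2 V) (t : ℝ) :
    weightSum P (w + Pi.single e t : Sym2 V → ℝ) = weightSum P w + t * weightSum (Link e P) w := by
  have key : ∀ F : Finset (Sym2 V), ∏ i ∈ F, (w + Pi.single e t : Sym2 V → ℝ) i =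
      ∏ i ∈ F, w i + if e ∈ F then t * ∏ i ∈ F.erase e, w i else 0 := by
    intro F
    split_ifs with he
    · rw [← Finset.mul_prod_erase F _ he, ← Finset.mul_prod_erase F w he]
      have : ∏ i ∈ F.erase e, (w + Pi.single e t : Sym2 V → ℝ) i = ∏ i ∈ F.erase e, w i :=
        Finset.prod_congr rfl fun i hi => by simp [Finset.ne_of_mem_erase hi]
      rw [this]
      simp only [Pi.add_apply, Pi.single_eq_same]
      ring
    · rw [add_zero]
      exact Finset.prod_congr rfl fun i hi => by
        simp [show i ≠ e from fun h => he (h ▸ hi)]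
  unfold weightSum
  simp only [key]
  rw [Finset.sum_add_distrib]
  congr 1
  rw [← Finset.sum_filter, Finset.filter_filter, Finset.mul_sum]
  refine Finset.sum_bij' (fun F _ => F.erase e) (fun F _ => insert e F) ?_ ?_ ?_ ?_ ?_
  · intro F hF
    simp only [Finset.mem_filter, Finset.mem_univ, true_and] at hF ⊢
    exact ⟨Finset.notMem_erase _ _, by rw [Finset.insert_erase hF.2]; exact hF.1⟩
  · intro F hF
    simp only [Finset.mem_filter, Finset.mem_univ, true_and] at hF ⊢
    exact ⟨hF.2, Finset.mem_insert_self _ _⟩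
  · intro F hF
    simp only [Finset.mem_filter, Finset.mem_univ, true_and] at hF
    exact Finset.insert_erase hF.2
  · intro F hF
    simp only [Finset.mem_filter, Finset.mem_univ, true_and] at hF
    exact Finset.erase_insert hF.1
  · intro F hF
    rfl

/-- Edge sets that split into a part of touched edges and a part of untouched edges. -/
theorem weightSum_split (t : Sym2 V → Prop) (P : Finset (Sym2 V) → Prop) (w : Sym2 V → ℝ) :
    weightSum P w = ∑ F₁ with ∀ e ∈ F₁, t e, ∑ F₂ with ∀ e ∈ F₂, ¬ t e,
      if P (F₁ ∪ F₂) then (∏ e ∈ F₁, w e) * ∏ e ∈ F₂, w e else 0 := by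
  unfold weightSum
  rw [Finset.sum_filter, ← Finset.sum_product']
  refine Finset.sum_bij' (fun F _ => (F.filter t, F.filter fun e => ¬ t e))
    (fun F _ => F.1 ∪ F.2) ?_ ?_ ?_ ?_ ?_
  · intro F _
    simp
  · intro F _
    simp
  · intro F _
    exact Finset.filter_union_filter_not_eq t F
  · rintro ⟨F₁, F₂⟩ hF
    simp only [Finset.mem_product, Finset.mem_filter, Finset.mem_univ, true_and] at hF
    ext e
    · simp only [Finset.mem_filter, Finset.mem_union]
      exact ⟨fun h => h.1.resolve_right fun h2 => hF.2 _ h2 h.2, fun h => ⟨Or.inl h, hF.1 _ h⟩⟩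
    · simp only [Finset.mem_filter, Finset.mem_union]
      exact ⟨fun h => h.1.resolve_left fun h2 => h.2 (hF.1 _ h2), fun h => ⟨Or.inr h, hF.2 _ h⟩⟩
  · intro F _
    simp only [Finset.filter_union_filter_not_eq]
    congr 1
    exact (Finset.prod_filter_mul_prod_filter_not F t w).symm

end Sums

/-! ### The Cauchy–Binet formula for weighted Gram matrices -/

section CauchyBinet

variable {I ι : Type*} [Fintype ι]

/-- The matrix `∑ e, w e • q e (q e)ᵀ`. -/
noncomputable def gram (q : ι → I → ℝ) (w : ι → ℝ) : Matrix I I ℝ :=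
  Matrix.of fun i j => ∑ e, w e * q e i * q e j

theorem gram_add (q : ι → I → ℝ) (w w' : ι → ℝ) : gram q (w + w') = gram q w + gram q w' := by
  ext i j
  simp [gram, add_mul, Finset.sum_add_distrib]

theorem gram_transpose (q : ι → I → ℝ) (w : ι → ℝ) : (gram q w).transpose = gram q w := by
  ext i j
  simp only [gram, Matrix.transpose_apply, Matrix.of_apply]
  exact Finset.sum_congr rfl fun e _ => by ring

section

variable [DecidableEq ι]

theorem gram_single (q : ι → I → ℝ) (e : ι) (t : ℝ) :
    gram q (Pi.single e t : ι → ℝ) = t • Matrix.vecMulVec (q e) (q e) := by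
  ext i j
  simp only [gram, Matrix.of_apply, Matrix.smul_apply, Matrix.vecMulVec_apply, smul_eq_mul]
  rw [Finset.sum_eq_single e]
  · simp [mul_assoc]
  · intro b _ hb
    simp [hb]
  · simp

end

variable [Fintype I]

theorem gram_mulVec (q : ι → I → ℝ) (w : ι → ℝ) (y : I → ℝ) (i : I) :
    (gram q w).mulVec y i = ∑ e, w e * q e i * (q e ⬝ᵥ y) := by
  simp only [Matrix.mulVec, dotProduct, gram, Matrix.of_apply, Finset.sum_mul, Finset.mul_sum]
  rw [Finset.sum_comm]
  exact Finset.sum_congr rfl fun e _ => Finset.sum_congr rfl fun j _ => by ring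

theorem dotProduct_gram_mulVec (q : ι → I → ℝ) (w : ι → ℝ) (y z : I → ℝ) :
    z ⬝ᵥ (gram q w).mulVec y = ∑ e, w e * (q e ⬝ᵥ z) * (q e ⬝ᵥ y) := by
  simp only [dotProduct, gram_mulVec, Finset.mul_sum, Finset.sum_mul]
  rw [Finset.sum_comm]
  refine Finset.sum_congr rfl fun e _ => ?_
  rw [Finset.sum_comm]
  exact Finset.sum_congr rfl fun j _ => Finset.sum_congr rfl fun i _ => by ring

variable [DecidableEq I] [DecidableEq ι]

/-- The Cauchy–Binet formula. The contribution of the index set `F` is expressed by the Gram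
matrix with weights `1` on `F` and `0` elsewhere. -/
theorem det_gram (q : ι → I → ℝ) (w : ι → ℝ) :
    (gram q w).det = ∑ F with F.card = Fintype.card I,
      (∏ e ∈ F, w e) * (gram q fun e => if e ∈ F then 1 else 0).det := by
  set c : (I → ι) → ℝ := fun f =>
    (∏ i, q (f i) i) * (Matrix.of fun i j => q (f j) i).det with hc
  have expand : ∀ w : ι → ℝ, (gram q w).det = ∑ f : I → ι, (∏ i, w (f i)) * c f := by
    intro w
    rw [Matrix.det_apply']
    simp only [gram, Matrix.of_apply, Finset.prod_univ_sum, Fintype.piFinset_univ, hc,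
      Matrix.det_apply', Finset.mul_sum]
    rw [Finset.sum_comm]
    refine Finset.sum_congr rfl fun f _ => Finset.sum_congr rfl fun σ _ => ?_
    simp only [Finset.prod_mul_distrib]
    ring
  have c_zero : ∀ f : I → ι, ¬ Function.Injective f → c f = 0 := by
    intro f hf
    simp only [Function.Injective, not_forall] at hf
    obtain ⟨i, j, hij, hne⟩ := hf
    rw [hc]
    simp only
    rw [Matrix.det_zero_of_column_eq hne (fun k => by simp [hij]), mul_zero]
  set C : Finset ι → ℝ := fun F =>
    ∑ f : I → ι with Function.Injective f ∧ Finset.univ.image f = F, c f with hC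
  have collect : ∀ w : ι → ℝ, (gram q w).det =
      ∑ F with F.card = Fintype.card I, (∏ e ∈ F, w e) * C F := by
    intro w
    rw [expand, ← Finset.sum_filter_of_ne (p := Function.Injective)
      (fun f _ h => by by_contra h'; exact h (by rw [c_zero f h', mul_zero]))]
    rw [← Finset.sum_fiberwise_of_maps_to (g := fun f : I → ι => Finset.univ.image f)
      (t := Finset.univ.filter fun F : Finset ι => F.card = Fintype.card I)]
    · refine Finset.sum_congr rfl fun F _ => ?_
      rw [hC, Finset.mul_sum, Finset.filter_filter]
      refine Finset.sum_congr rfl fun f hf => ?_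
      simp only [Finset.mem_filter, Finset.mem_univ, true_and] at hf
      rw [← hf.2, Finset.prod_image (fun i _ j _ h => hf.1 h)]
    · intro f hf
      simp only [Finset.mem_filter, Finset.mem_univ, true_and] at hf ⊢
      rw [Finset.card_image_of_injective _ hf, Finset.card_univ]
  rw [collect w]
  refine Finset.sum_congr rfl fun F hF => ?_
  simp only [Finset.mem_filter, Finset.mem_univ, true_and] at hF
  congr 1
  rw [collect, Finset.sum_eq_single F]
  · rw [Finset.prod_congr rfl (fun e he => if_pos he)]
    simp
  · intro F' hF' hne
    simp only [Finset.mem_filter, Finset.mem_univ, true_and] at hF'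
    have : ¬ F' ⊆ F := fun h => hne (Finset.eq_of_subset_of_card_le h (by omega))
    obtain ⟨e, he, he'⟩ := Finset.not_subset.1 this
    rw [Finset.prod_eq_zero he (if_neg he'), zero_mul]
  · simp [hF]

end CauchyBinet

/-! ### The matrix-tree theorem in adapted coordinates -/

section Coordinates

variable {V : Type*}

/-- `F` is a spanning tree of the vertex set `A`; acyclicity is encoded by the number of edges. -/
def TreeOn (A : Finset V) (F : Finset (Sym2 V)) : Prop :=
  (∀ e ∈ F, ∀ v ∈ e, v ∈ A) ∧ F.card + 1 = A.card ∧
    ∀ u ∈ A, ∀ v ∈ A, (spanningGraph F).Reachable u v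

/-- Index set for the potentials on `A` that vanish at `d`. The two distinguished coordinates are
`φ a - φ b` and `φ c`, the others are the values at the remaining vertices. -/
abbrev Coord (A : Finset V) (a c d : V) : Type _ :=
  Fin 2 ⊕ {v : V // v ∈ A ∧ v ≠ a ∧ v ≠ c ∧ v ≠ d}

/-- The evaluation functional at a vertex other than `a`, in the coordinates `Coord`; it is zero
at `d` and outside `A`. -/
noncomputable def baseVec (A : Finset V) (a c d v : V) : Coord A a c d → ℤ :=
  if h : v ∈ A ∧ v ≠ a ∧ v ≠ c ∧ v ≠ d then Pi.single (Sum.inr ⟨v, h⟩) 1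
  else if v = c then Pi.single (Sum.inl 1) 1 else 0

/-- The evaluation functional at a vertex in the coordinates `Coord`. -/
noncomputable def coordVec (A : Finset V) (a b c d v : V) : Coord A a c d → ℤ :=
  if v = a then Pi.single (Sum.inl 0) 1 + baseVec A a c d b else baseVec A a c d v

/-- The difference functional along an edge, for an arbitrarily chosen orientation. -/
noncomputable def edgeVec (A : Finset V) (a b c d : V) (e : Sym2 V) : Coord A a c d → ℤ :=
  coordVec A a b c d (Quot.out e).1 - coordVec A a b c d (Quot.out e).2

/-- The difference of a function along an edge, for the same orientation as `edgeVec`. -/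
noncomputable def edgeDiff (φ : V → ℝ) (e : Sym2 V) : ℝ := φ (Quot.out e).1 - φ (Quot.out e).2

theorem mk_out (e : Sym2 V) : s((Quot.out e).1, (Quot.out e).2) = e := Quot.out_eq e

theorem out_mk (x y : V) : ((Quot.out s(x, y)).1 = x ∧ (Quot.out s(x, y)).2 = y) ∨
    ((Quot.out s(x, y)).1 = y ∧ (Quot.out s(x, y)).2 = x) :=
  Sym2.eq_iff.1 (mk_out s(x, y))

theorem edgeDiff_eq_zero {φ : V → ℝ} {e : Sym2 V} :
    edgeDiff φ e = 0 ↔ ∀ u ∈ e, ∀ v ∈ e, φ u = φ v := by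
  have h : e = s((Quot.out e).1, (Quot.out e).2) := (mk_out e).symm
  constructor
  · intro h0 u hu v hv
    rw [h] at hu hv
    have h0 : φ (Quot.out e).1 = φ (Quot.out e).2 := sub_eq_zero.1 h0
    rcases Sym2.mem_iff.1 hu with rfl | rfl <;> rcases Sym2.mem_iff.1 hv with rfl | rfl <;>
      first | rfl | exact h0 | exact h0.symm
  · intro h0
    refine sub_eq_zero.2 (h0 _ ?_ _ ?_)
    · exact Sym2.out_fst_mem e
    · exact Sym2.out_snd_mem e

variable {A : Finset V} {a b c d : V} [Fintype V]

/-- The potential with given coordinates. -/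
noncomputable def pot (A : Finset V) (a b c d : V) (y : Coord A a c d → ℝ) (v : V) : ℝ :=
  ∑ i, (coordVec A a b c d v i : ℝ) * y i

/-- The coordinates of a function, after subtraction of its value at `d`. -/
def ofPot (A : Finset V) (a b c d : V) (φ : V → ℝ) : Coord A a c d → ℝ :=
  Sum.elim ![φ a - φ b, φ c - φ d] fun v => φ v - φ d

/-- The edge functionals with real entries. -/
noncomputable def edgeVecR (A : Finset V) (a b c d : V) (e : Sym2 V) : Coord A a c d → ℝ :=
  fun i => (edgeVec A a b c d e i : ℝ)

theorem edgeVecR_dotProduct (e : Sym2 V) (y : Coord A a c d → ℝ) :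
    edgeVecR A a b c d e ⬝ᵥ y = edgeDiff (pot A a b c d y) e := by
  simp only [dotProduct, edgeVecR, edgeVec, edgeDiff, pot, Pi.sub_apply, Int.cast_sub, sub_mul,
    Finset.sum_sub_distrib]

theorem pot_d (had : a ≠ d) (hcd : c ≠ d) (y : Coord A a c d → ℝ) : pot A a b c d y d = 0 := by
  simp [pot, coordVec, had.symm, baseVec, hcd.symm]

theorem pot_c (hac : a ≠ c) (y : Coord A a c d → ℝ) : pot A a b c d y c = y (Sum.inl 1) := by
  simp [pot, coordVec, hac.symm, baseVec, Pi.single_apply]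

theorem pot_a (hab : a ≠ b) (y : Coord A a c d → ℝ) :
    pot A a b c d y a = y (Sum.inl 0) + pot A a b c d y b := by
  simp [pot, coordVec, hab.symm, Pi.single_apply, add_mul, Finset.sum_add_distrib]

theorem pot_inner (y : Coord A a c d → ℝ) {v : V} (hv : v ∈ A ∧ v ≠ a ∧ v ≠ c ∧ v ≠ d) :
    pot A a b c d y v = y (Sum.inr ⟨v, hv⟩) := by
  have := hv.2.1
  simp [pot, coordVec, this, baseVec, hv, Pi.single_apply]

theorem pot_ofPot (hab : a ≠ b) (hac : a ≠ c) (had : a ≠ d) (hcd : c ≠ d) (hb : b ∈ A) (φ : V → ℝ)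
    {v : V} (hv : v ∈ A) : pot A a b c d (ofPot A a b c d φ) v = φ v - φ d := by
  have main : ∀ v ∈ A, v ≠ a → pot A a b c d (ofPot A a b c d φ) v = φ v - φ d := by
    intro v hv hva
    by_cases hvc : v = c
    · subst hvc; rw [pot_c hac]; simp [ofPot]
    by_cases hvd : v = d
    · subst hvd; rw [pot_d had hcd]; simp
    · rw [pot_inner _ ⟨hv, hva, hvc, hvd⟩]; simp [ofPot]
  by_cases hva : v = a
  · subst hva
    rw [pot_a hab, main b hb hab.symm]
    simp [ofPot]
  · exact main v hv hva

theorem card_coord (ha : a ∈ A) (hc : c ∈ A) (hd : d ∈ A) (hac : a ≠ c) (had : a ≠ d)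
    (hcd : c ≠ d) : Fintype.card (Coord A a c d) + 1 = A.card := by
  rw [Fintype.card_sum, Fintype.card_fin, Fintype.card_subtype]
  have : (Finset.univ.filter fun v => v ∈ A ∧ v ≠ a ∧ v ≠ c ∧ v ≠ d) =
      ((A.erase a).erase c).erase d := by
    ext v; simp; tauto
  rw [this, Finset.card_erase_of_mem (by simp [hcd.symm, had.symm, hd]),
    Finset.card_erase_of_mem (by simp [hac.symm, hc]), Finset.card_erase_of_mem ha]
  have : 3 ≤ A.card := by
    have : ({a, c, d} : Finset V) ⊆ A := by
      intro v; simp; rintro (rfl | rfl | rfl) <;> assumption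
    have h := Finset.card_le_card this
    rwa [Finset.card_eq_three.2 ⟨a, c, d, hac, had, hcd, rfl⟩] at h
  omega

/-- A spanning tree of `A` has Gram determinant one: its edge functionals generate the lattice of
all integral functionals. -/
theorem det_gram_of_treeOn (hac : a ≠ c) (had : a ≠ d) (hcd : c ≠ d) (hab : a ≠ b)
    (ha : a ∈ A) (hb : b ∈ A) (hc : c ∈ A) (hd : d ∈ A) {F : Finset (Sym2 V)} (hF : TreeOn A F) :
    (gram (edgeVecR A a b c d) fun e => if e ∈ F then 1 else 0).det = 1 := by
  have hcard : Fintype.card (Coord A a c d) = Fintype.card F := by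
    have := card_coord ha hc hd hac had hcd
    have := hF.2.1
    rw [Fintype.card_coe]; omega
  let f := Fintype.equivOfCardEq hcard
  let M : Matrix (Coord A a c d) (Coord A a c d) ℤ := Matrix.of fun i k => edgeVec A a b c d (f k) i
  have hgram : (gram (edgeVecR A a b c d) fun e => if e ∈ F then 1 else 0) =
      (M * M.transpose).map (Int.cast : ℤ → ℝ) := by
    ext i j
    simp only [gram, Matrix.of_apply, Matrix.map_apply, Matrix.mul_apply, Matrix.transpose_apply,
      Int.cast_sum, Int.cast_mul, M, edgeVecR, ite_mul, one_mul, zero_mul, Finset.sum_ite_mem,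
      Finset.univ_inter]
    rw [← Finset.sum_coe_sort F]
    exact (f.sum_comp fun e : F => (edgeVec A a b c d e i : ℝ) * (edgeVec A a b c d e j : ℝ)).symm
  have hdet : (gram (edgeVecR A a b c d) fun e => if e ∈ F then 1 else 0).det =
      ((M.det * M.det : ℤ) : ℝ) := by
    rw [hgram]
    have := (Int.cast_det (R := ℝ) (M * M.transpose)).symm
    rw [Matrix.det_mul, Matrix.det_transpose] at this
    exact this
  let N := LinearMap.range M.mulVecLin
  have hedge : ∀ e ∈ F, edgeVec A a b c d e ∈ N := by
    intro e he
    refine ⟨Pi.single (f.symm ⟨e, he⟩) 1, ?_⟩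
    ext i
    simp [M, Matrix.mulVec_single]
  have hstep : ∀ v ∈ A, coordVec A a b c d v ∈ N := by
    intro v hv
    have hzero : coordVec A a b c d d = 0 := by
      simp [coordVec, had.symm, baseVec, hcd.symm]
    refine reachable_induction (P := fun v => coordVec A a b c d v ∈ N) (hF.2.2 d hd v hv)
      (by rw [hzero]; exact N.zero_mem) ?_
    intro u v hu huv
    have hm := hedge _ (spanningGraph_adj.1 huv).1
    rw [edgeVec] at hm
    rcases out_mk u v with ⟨h1, h2⟩ | ⟨h1, h2⟩ <;> rw [h1, h2] at hm
    · have := N.sub_mem hu hm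
      rwa [sub_sub_cancel] at this
    · have := N.add_mem hm hu
      rwa [sub_add_cancel] at this
  have hsingle : ∀ i, (Pi.single i 1 : Coord A a c d → ℤ) ∈ N := by
    rintro (i | ⟨v, hv⟩)
    · fin_cases i
      · have := N.sub_mem (hstep a ha) (hstep b hb)
        simpa [coordVec, hab.symm] using this
      · have := hstep c hc
        simpa [coordVec, hac.symm, baseVec] using this
    · have := hstep v hv.1
      simpa [coordVec, hv.2.1, baseVec, hv] using this
  have hsurj : Function.Surjective M.mulVec := by
    intro y
    have : y ∈ N := by
      have hy : y = ∑ i, y i • (Pi.single i 1 : Coord A a c d → ℤ) := by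
        ext j; simp [Finset.sum_apply, Pi.single_apply]
      rw [hy]
      exact N.sum_mem fun i _ => N.smul_mem _ (hsingle i)
    obtain ⟨x, hx⟩ := this
    exact ⟨x, by simpa using hx⟩
  have hunit : IsUnit M.det := (Matrix.isUnit_iff_isUnit_det M).1
    (Matrix.mulVec_surjective_iff_isUnit.1 hsurj)
  rw [hdet]
  rcases Int.isUnit_iff.1 hunit with h | h <;> simp [h]

/-- The indicator function of the vertices that are not connected to `d` lies in the kernel. -/
theorem det_gram_of_not_reachable (hac : a ≠ c) (had : a ≠ d) (hcd : c ≠ d) (hab : a ≠ b)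
    (hb : b ∈ A) {F : Finset (Sym2 V)} (hF : ∀ e ∈ F, ∀ v ∈ e, v ∈ A) {v : V}
    (hv : v ∈ A) (hvd : ¬ (spanningGraph F).Reachable d v) :
    (gram (edgeVecR A a b c d) fun e => if e ∈ F then 1 else 0).det = 0 := by
  set φ : V → ℝ := fun u => if (spanningGraph F).Reachable d u then 0 else 1 with hφ
  have hφd : φ d = 0 := by simp [hφ]
  rw [← Matrix.exists_mulVec_eq_zero_iff]
  refine ⟨ofPot A a b c d φ, ?_, ?_⟩
  · intro h0
    have := pot_ofPot hab hac had hcd hb φ hv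
    rw [h0, hφd] at this
    simp [pot, hφ, hvd] at this
  · ext i
    rw [gram_mulVec]
    refine Finset.sum_eq_zero fun e _ => ?_
    by_cases he : e ∈ F
    · rw [edgeVecR_dotProduct]
      have : edgeDiff (pot A a b c d (ofPot A a b c d φ)) e = 0 := by
        rw [edgeDiff_eq_zero]
        intro x hx y hy
        rw [pot_ofPot hab hac had hcd hb φ (hF e he x hx),
          pot_ofPot hab hac had hcd hb φ (hF e he y hy)]
        by_cases hxy : x = y
        · rw [hxy]
        have hadj : (spanningGraph F).Adj x y := by
          rw [spanningGraph_adj]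
          refine ⟨?_, hxy⟩
          rwa [← (Sym2.mem_and_mem_iff hxy).1 ⟨hx, hy⟩]
        have : (spanningGraph F).Reachable d x ↔ (spanningGraph F).Reachable d y :=
          ⟨fun h => h.trans hadj.reachable, fun h => h.trans hadj.reachable.symm⟩
        simp only [hφ, this]
      rw [this, mul_zero]
    · simp [he]

/-- The matrix-tree theorem: the spanning trees of `A` are counted by the determinant of the
Laplacian in the coordinates `Coord`. -/
theorem det_gram_eq_weightSum (hac : a ≠ c) (had : a ≠ d) (hcd : c ≠ d) (hab : a ≠ b)
    (ha : a ∈ A) (hb : b ∈ A) (hc : c ∈ A) (hd : d ∈ A) {w : Sym2 V → ℝ}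
    (hw : ∀ e, w e ≠ 0 → ∀ v ∈ e, v ∈ A) :
    (gram (edgeVecR A a b c d) w).det = weightSum (TreeOn A) w := by
  rw [det_gram, weightSum, Finset.sum_filter, Finset.sum_filter]
  refine Finset.sum_congr rfl fun F _ => ?_
  have hcard := card_coord ha hc hd hac had hcd
  by_cases hin : ∀ e ∈ F, ∀ v ∈ e, v ∈ A
  · by_cases hT : TreeOn A F
    · have := hT.2.1
      rw [if_pos hT, if_pos (by omega), det_gram_of_treeOn hac had hcd hab ha hb hc hd hT, mul_one]
    · rw [if_neg hT]
      split_ifs with h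
      · have : ∃ v ∈ A, ¬ (spanningGraph F).Reachable d v := by
          by_contra! hcon
          exact hT ⟨hin, by omega, fun u hu v hv => (hcon u hu).symm.trans (hcon v hv)⟩
        obtain ⟨v, hv, hvd⟩ := this
        rw [det_gram_of_not_reachable hac had hcd hab hb hin hv hvd, mul_zero]
      · rfl
  · push Not at hin
    obtain ⟨e, he, v, hv, hvA⟩ := hin
    have hw0 : w e = 0 := by
      by_contra h
      exact hvA (hw e h v hv)
    rw [Finset.prod_eq_zero he hw0, if_neg (fun hT : TreeOn A F => hvA (hT.1 e he v hv)), zero_mul,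
      ite_self]

end Coordinates

/-! ### Rank-one updates and Schur complements -/

section LinearAlgebra

open Matrix

/-- The matrix determinant lemma, without an invertibility assumption. It follows from the
invertible case because `L + t` is invertible for all but finitely many `t`. -/
theorem det_add_vecMulVec {I : Type*} [Fintype I] [DecidableEq I] (L : Matrix I I ℝ) (v : I → ℝ) :
    (L + vecMulVec v v).det = L.det + v ⬝ᵥ L.adjugate *ᵥ v := by
  have hunit : ∀ M : Matrix I I ℝ, M.det ≠ 0 →
      (M + vecMulVec v v).det = M.det + v ⬝ᵥ M.adjugate *ᵥ v := by
    intro M hM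
    have h := det_add_replicateCol_mul_replicateRow (ι := Unit) (A := M)
      (isUnit_iff_ne_zero.2 hM) v v
    rw [← vecMulVec_eq] at h
    rw [h, det_unique (1 + _), inv_def, Ring.inverse_eq_inv', Matrix.mul_smul,
      Matrix.smul_mul, Matrix.add_apply, one_apply_eq,
      Matrix.smul_apply, smul_eq_mul, mul_add, mul_one, ← mul_assoc, mul_inv_cancel₀ hM, one_mul,
      Matrix.mul_assoc]
    rfl
  have hd : Dense {t : ℝ | (t • (1 : Matrix I I ℝ) + L).det ≠ 0} := by
    have hfin : {t : ℝ | (t • (1 : Matrix I I ℝ) + L).det = 0}.Finite := by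
      refine ((-L).charpoly.rootSet_finite ℝ).subset fun t ht => ?_
      rw [Polynomial.mem_rootSet]
      refine ⟨(charpoly_monic _).ne_zero, ?_⟩
      rw [Polynomial.coe_aeval_eq_eval, eval_charpoly, sub_neg_eq_add, scalar_apply,
        ← smul_one_eq_diagonal]
      exact ht
    exact hfin.countable.dense_compl ℝ
  have hc : Continuous fun t : ℝ => t • (1 : Matrix I I ℝ) + L := by fun_prop
  have hext := Continuous.ext_on hd
    (f := fun t => (t • (1 : Matrix I I ℝ) + L + vecMulVec v v).det)
    (g := fun t => (t • (1 : Matrix I I ℝ) + L).det +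
      v ⬝ᵥ (t • (1 : Matrix I I ℝ) + L).adjugate *ᵥ v)
    (hc.add continuous_const).matrix_det
    (hc.matrix_det.add (continuous_const.dotProduct (hc.matrix_adjugate.matrix_mulVec
      continuous_const))) (fun t ht => hunit _ ht)
  simpa using congrFun hext 0

variable {J : Type*} [Fintype J] [DecidableEq J]

/-- The Schur complement with respect to the coordinates in `J`. -/
noncomputable def schur (L : Matrix (Fin 2 ⊕ J) (Fin 2 ⊕ J) ℝ) : Matrix (Fin 2) (Fin 2) ℝ :=
  L.toBlocks₁₁ - L.toBlocks₁₂ * L.toBlocks₂₂⁻¹ * L.toBlocks₂₁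

theorem det_add_fromBlocks {L : Matrix (Fin 2 ⊕ J) (Fin 2 ⊕ J) ℝ} (hZ : L.toBlocks₂₂.det ≠ 0)
    (T : Matrix (Fin 2) (Fin 2) ℝ) :
    (L + fromBlocks T 0 0 0).det = L.toBlocks₂₂.det * (schur L + T).det := by
  let := L.toBlocks₂₂.invertibleOfIsUnitDet (isUnit_iff_ne_zero.2 hZ)
  conv_lhs => rw [← fromBlocks_toBlocks L, fromBlocks_add]
  simp only [add_zero]
  rw [det_fromBlocks₂₂, invOf_eq_nonsing_inv, schur]
  congr 2
  abel

/-- Five finite differences of a function of symmetric `2 × 2` matrices; for the determinant of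
`L + fromBlocks T 0 0 0` they are the minors of `L` that involve the first two coordinates. -/
noncomputable def minors (t : Matrix (Fin 2) (Fin 2) ℝ → ℝ) : Fin 5 → ℝ :=
  ![t 0, t !![1, 0; 0, 0] - t 0, t !![0, 0; 0, 1] - t 0,
    (t !![1, 0; 0, 0] + t !![0, 0; 0, 1] - t !![1, 1; 1, 1] - t 0) / 2,
    t !![1, 0; 0, 1] - t !![1, 0; 0, 0] - t !![0, 0; 0, 1] + t 0]

theorem schur_symm {L : Matrix (Fin 2 ⊕ J) (Fin 2 ⊕ J) ℝ} (hL : Lᵀ = L) :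
    (schur L)ᵀ = schur L := by
  have h12 : L.toBlocks₁₂ᵀ = L.toBlocks₂₁ := by
    ext i j; exact congrFun (congrFun hL (Sum.inr i)) (Sum.inl j)
  have h21 : L.toBlocks₂₁ᵀ = L.toBlocks₁₂ := by
    ext i j; exact congrFun (congrFun hL (Sum.inl i)) (Sum.inr j)
  have h11 : L.toBlocks₁₁ᵀ = L.toBlocks₁₁ := by
    ext i j; exact congrFun (congrFun hL (Sum.inl i)) (Sum.inl j)
  have h22 : L.toBlocks₂₂ᵀ = L.toBlocks₂₂ := by
    ext i j; exact congrFun (congrFun hL (Sum.inr i)) (Sum.inr j)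
  rw [schur, transpose_sub, transpose_mul, transpose_mul, transpose_nonsing_inv, h12, h21, h11, h22,
    Matrix.mul_assoc]

theorem minors_det {L : Matrix (Fin 2 ⊕ J) (Fin 2 ⊕ J) ℝ} (hL : Lᵀ = L)
    (hZ : L.toBlocks₂₂.det ≠ 0) :
    minors (fun T => (L + fromBlocks T 0 0 0).det) = L.toBlocks₂₂.det •
      ![(schur L).det, schur L 1 1, schur L 0 0, schur L 0 1, 1] := by
  have hs : schur L 1 0 = schur L 0 1 := congrFun (congrFun (schur_symm hL) 0) 1
  simp only [minors, det_add_fromBlocks hZ]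
  ext i
  fin_cases i <;> simp [det_fin_two, hs] <;> ring

/-- The quadratic form `2 * (x 0 * x 4 + x 3 ^ 2 - x 1 * x 2)` in polarized form. -/
def pair (x y : Fin 5 → ℝ) : ℝ :=
  x 0 * y 4 + y 0 * x 4 + 2 * (x 3 * y 3) - x 1 * y 2 - y 1 * x 2

/-- Symmetric matrices parametrize a part of the null cone of `pair` by their minors; on two such
vectors `pair` is the determinant of the difference. -/
theorem pair_smul_smul {K K' : Matrix (Fin 2) (Fin 2) ℝ} (hK : Kᵀ = K) (hK' : K'ᵀ = K')
    (s s' : ℝ) :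
    pair (s • ![K.det, K 1 1, K 0 0, K 0 1, 1]) (s' • ![K'.det, K' 1 1, K' 0 0, K' 0 1, 1]) =
      s * s' * (K - K').det := by
  have hs : K 1 0 = K 0 1 := congrFun (congrFun hK 0) 1
  have hs' : K' 1 0 = K' 0 1 := congrFun (congrFun hK' 0) 1
  simp [pair, det_fin_two, hs, hs']
  ring

/-- The vector that extends `ξ` and minimizes the quadratic form of `L`. -/
noncomputable def minimizer (L : Matrix (Fin 2 ⊕ J) (Fin 2 ⊕ J) ℝ) (ξ : Fin 2 → ℝ) :
    Fin 2 ⊕ J → ℝ :=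
  Sum.elim ξ (-(L.toBlocks₂₂⁻¹ *ᵥ (L.toBlocks₂₁ *ᵥ ξ)))

theorem mulVec_minimizer {L : Matrix (Fin 2 ⊕ J) (Fin 2 ⊕ J) ℝ} (hZ : L.toBlocks₂₂.det ≠ 0)
    (ξ : Fin 2 → ℝ) : L *ᵥ minimizer L ξ = Sum.elim (schur L *ᵥ ξ) 0 := by
  conv_lhs => rw [← fromBlocks_toBlocks L]
  rw [fromBlocks_mulVec, minimizer]
  congr 1
  · simp only [Sum.elim_comp_inl, Sum.elim_comp_inr, schur, sub_mulVec, mulVec_neg, mulVec_mulVec,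
      Matrix.mul_assoc, fromBlocks_toBlocks]
    rw [sub_eq_add_neg]
  · simp only [Sum.elim_comp_inl, Sum.elim_comp_inr, mulVec_neg, fromBlocks_toBlocks]
    rw [mulVec_mulVec, mul_nonsing_inv _ (isUnit_iff_ne_zero.2 hZ), one_mulVec, add_neg_cancel]

theorem minimizer_dotProduct {L : Matrix (Fin 2 ⊕ J) (Fin 2 ⊕ J) ℝ} (hZ : L.toBlocks₂₂.det ≠ 0)
    (ξ : Fin 2 → ℝ) : minimizer L ξ ⬝ᵥ L *ᵥ minimizer L ξ = ξ ⬝ᵥ schur L *ᵥ ξ := by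
  rw [mulVec_minimizer hZ, minimizer, sumElim_dotProduct_sumElim, dotProduct_zero, add_zero]

/-- The Schur complement is the least energy among the extensions of a vector on the first block. -/
theorem schur_le {L : Matrix (Fin 2 ⊕ J) (Fin 2 ⊕ J) ℝ} (hZ : L.toBlocks₂₂.det ≠ 0) (hL : Lᵀ = L)
    (hpos : ∀ y, 0 ≤ y ⬝ᵥ L *ᵥ y) (y : Fin 2 ⊕ J → ℝ) :
    (y ∘ Sum.inl) ⬝ᵥ schur L *ᵥ (y ∘ Sum.inl) ≤ y ⬝ᵥ L *ᵥ y := by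
  set m := minimizer L (y ∘ Sum.inl) with hm
  have hinl : (y - m) ∘ Sum.inl = 0 := by
    ext i; simp [hm, minimizer]
  have hcross : (y - m) ⬝ᵥ L *ᵥ m = 0 := by
    rw [hm, mulVec_minimizer hZ, ← hm]
    have : (y - m) = Sum.elim ((y - m) ∘ Sum.inl) ((y - m) ∘ Sum.inr) := by simp
    rw [this, sumElim_dotProduct_sumElim, hinl, zero_dotProduct, dotProduct_zero, add_zero]
  have hcross' : m ⬝ᵥ L *ᵥ (y - m) = 0 := by
    rw [dotProduct_mulVec, ← mulVec_transpose, hL, dotProduct_comm, hcross]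
  have key : y ⬝ᵥ L *ᵥ y = m ⬝ᵥ L *ᵥ m + (y - m) ⬝ᵥ L *ᵥ (y - m) := by
    have hy : y = m + (y - m) := by abel
    conv_lhs => rw [hy]
    rw [mulVec_add, dotProduct_add, add_dotProduct, add_dotProduct, hcross, hcross']
    ring
  rw [key, hm, minimizer_dotProduct hZ]
  have := hpos (y - m)
  linarith

end LinearAlgebra

/-! ### Responses of tree sums -/

section Response

variable {V : Type*} {A : Finset V} {a b c d : V}

/-- The evaluation functional with real entries. -/
noncomputable def coordVecR (A : Finset V) (a b c d v : V) : Coord A a c d → ℝ :=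
  fun i => (coordVec A a b c d v i : ℝ)

theorem coordVecR_sub_ab (hab : a ≠ b) :
    coordVecR A a b c d a - coordVecR A a b c d b = Pi.single (Sum.inl 0) 1 := by
  ext i
  simp only [coordVecR, coordVec, Pi.sub_apply, if_neg hab.symm, if_true, Pi.add_apply,
    Int.cast_add, add_sub_cancel_right]
  simp [Pi.single_apply]

theorem coordVecR_sub_cd (hac : a ≠ c) (had : a ≠ d) (hcd : c ≠ d) :
    coordVecR A a b c d c - coordVecR A a b c d d = Pi.single (Sum.inl 1) 1 := by
  ext i
  simp [coordVecR, coordVec, hac.symm, had.symm, baseVec, hcd.symm, Pi.single_apply]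

/-- The unit weight on the edge joining `x` and `y`. -/
noncomputable def bond (x y : V) : Sym2 V → ℝ := Pi.single s(x, y) 1

/-- The finite differences of a functional of the edge weights that enter the inequality: its
value, the increments along `ab` and `cd`, half the combination of increments that isolates the
difference of the two crossing pairings, and the second difference along `ab` and `cd`. -/
noncomputable def response (f : (Sym2 V → ℝ) → ℝ) (a b c d : V) (w : Sym2 V → ℝ) : Fin 5 → ℝ :=
  ![f w, f (w + bond a b) - f w, f (w + bond c d) - f w,
    (f (w + bond a c) + f (w + bond b d) - f (w + bond a d) - f (w + bond b c)) / 2,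
    f (w + bond a b + bond c d) - f (w + bond a b) - f (w + bond c d) + f w]

/-- The weight of the edges with both ends in `A`. -/
noncomputable def inside (A : Finset V) (w : Sym2 V → ℝ) (e : Sym2 V) : ℝ :=
  if ∀ v ∈ e, v ∈ A then w e else 0

theorem inside_add_bond {x y : V} (hx : x ∈ A) (hy : y ∈ A) (w : Sym2 V → ℝ) :
    inside A (w + bond x y) = inside A w + bond x y := by
  ext e
  simp only [inside, Pi.add_apply, bond, Pi.single_apply]
  by_cases he : e = s(x, y)
  · subst he
    have h : ∀ v ∈ s(x, y), v ∈ A := by simp [hx, hy]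
    rw [if_pos h, if_pos h]
  · simp [he]

theorem inside_nonneg {w : Sym2 V → ℝ} (hw : ∀ e, 0 ≤ w e) (e : Sym2 V) : 0 ≤ inside A w e := by
  unfold inside
  split_ifs
  · exact hw e
  · exact le_rfl

variable [Fintype V]

theorem weightSum_treeOn_inside (A : Finset V) (w : Sym2 V → ℝ) :
    weightSum (TreeOn A) (inside A w) = weightSum (TreeOn A) w := by
  unfold weightSum
  refine Finset.sum_congr rfl fun F hF => Finset.prod_congr rfl fun e he => ?_
  simp only [Finset.mem_filter, Finset.mem_univ, true_and] at hF
  exact if_pos (hF.1 e he)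

/-- The Laplacian of the edges inside `A` in the coordinates `Coord`. -/
noncomputable def lap (A : Finset V) (a b c d : V) (w : Sym2 V → ℝ) :
    Matrix (Coord A a c d) (Coord A a c d) ℝ :=
  gram (edgeVecR A a b c d) (inside A w)

theorem dotProduct_lap_mulVec (w : Sym2 V → ℝ) (y z : Coord A a c d → ℝ) :
    z ⬝ᵥ (lap A a b c d w).mulVec y = ∑ e, inside A w e *
      edgeDiff (pot A a b c d z) e * edgeDiff (pot A a b c d y) e := by
  simp only [lap, dotProduct_gram_mulVec, edgeVecR_dotProduct]

theorem lap_transpose (w : Sym2 V → ℝ) :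
    (lap A a b c d w).transpose = lap A a b c d w := gram_transpose _ _

theorem lap_nonneg {w : Sym2 V → ℝ} (hw : ∀ e, 0 ≤ w e) (y : Coord A a c d → ℝ) :
    0 ≤ y ⬝ᵥ (lap A a b c d w).mulVec y := by
  rw [dotProduct_lap_mulVec]
  refine Finset.sum_nonneg fun e _ => ?_
  rw [mul_assoc]
  exact mul_nonneg (inside_nonneg hw e) (mul_self_nonneg _)

theorem lap_add_bond {x y : V} (hx : x ∈ A) (hy : y ∈ A) (w : Sym2 V → ℝ) :
    lap A a b c d (w + bond x y) = lap A a b c d w +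
      Matrix.vecMulVec (coordVecR A a b c d x - coordVecR A a b c d y)
        (coordVecR A a b c d x - coordVecR A a b c d y) := by
  rw [lap, inside_add_bond hx hy, gram_add, bond, gram_single, one_smul]
  have : edgeVecR A a b c d s(x, y) = coordVecR A a b c d x - coordVecR A a b c d y ∨
      edgeVecR A a b c d s(x, y) = -(coordVecR A a b c d x - coordVecR A a b c d y) := by
    rcases out_mk x y with ⟨h1, h2⟩ | ⟨h1, h2⟩
    · left; ext i; simp [edgeVecR, edgeVec, coordVecR, h1, h2]
    · right; ext i; simp [edgeVecR, edgeVec, coordVecR, h1, h2]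
  rcases this with h | h <;> rw [h]
  · rfl
  · rw [Matrix.neg_vecMulVec, Matrix.vecMulVec_neg, neg_neg]; rfl

/-- The responses of the tree sum are minors of the Laplacian. -/
theorem response_treeOn (hac : a ≠ c) (had : a ≠ d) (hcd : c ≠ d) (hab : a ≠ b)
    (ha : a ∈ A) (hb : b ∈ A) (hc : c ∈ A) (hd : d ∈ A) (w : Sym2 V → ℝ) :
    response (weightSum (TreeOn A)) a b c d w =
      minors fun T => (lap A a b c d w + Matrix.fromBlocks T 0 0 0).det := by
  have hdet : ∀ w, weightSum (TreeOn A) w = (lap A a b c d w).det := by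
    intro w
    rw [lap, det_gram_eq_weightSum hac had hcd hab ha hb hc hd, weightSum_treeOn_inside]
    intro e he
    by_contra h
    exact he (if_neg h)
  set L := lap A a b c d w with hL
  set e₀ : Coord A a c d → ℝ := Pi.single (Sum.inl 0) 1 with he₀
  set e₁ : Coord A a c d → ℝ := Pi.single (Sum.inl 1) 1 with he₁
  have h0 : Matrix.vecMulVec e₀ e₀ = Matrix.fromBlocks !![1, 0; 0, 0] 0 0 0 := by
    ext (i | i) (j | j) <;> simp [he₀, Matrix.vecMulVec_apply]
    fin_cases i <;> fin_cases j <;> simp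
  have h1 : Matrix.vecMulVec e₁ e₁ = Matrix.fromBlocks !![0, 0; 0, 1] 0 0 0 := by
    ext (i | i) (j | j) <;> simp [he₁, Matrix.vecMulVec_apply]
    fin_cases i <;> fin_cases j <;> simp
  have h01 : Matrix.vecMulVec (e₀ + e₁) (e₀ + e₁) = Matrix.fromBlocks !![1, 1; 1, 1] 0 0 0 := by
    ext (i | i) (j | j) <;> simp [he₁, he₀, Matrix.vecMulVec_apply]
    fin_cases i <;> fin_cases j <;> simp
  have hD : Matrix.vecMulVec e₀ e₀ + Matrix.vecMulVec e₁ e₁ =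
      Matrix.fromBlocks !![1, 0; 0, 1] 0 0 (0 : Matrix {v : V // v ∈ A ∧ v ≠ a ∧ v ≠ c ∧ v ≠ d}
        {v : V // v ∈ A ∧ v ≠ a ∧ v ≠ c ∧ v ≠ d} ℝ) := by
    rw [h0, h1, Matrix.fromBlocks_add]
    congr 1
    · ext i j; fin_cases i <;> fin_cases j <;> simp
    all_goals simp
  have rab : coordVecR A a b c d a - coordVecR A a b c d b = e₀ := coordVecR_sub_ab hab
  have rcd : coordVecR A a b c d c - coordVecR A a b c d d = e₁ := coordVecR_sub_cd hac had hcd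
  -- Only the polarized form of the adjugate is needed, which is symmetric.
  set u : V → Coord A a c d → ℝ := coordVecR A a b c d with hu
  set q : (Coord A a c d → ℝ) → (Coord A a c d → ℝ) → ℝ := fun x y =>
    x ⬝ᵥ Matrix.mulVec L.adjugate y with hq
  have hsymm : ∀ x y, q x y = q y x := by
    intro x y
    have : L.adjugate.transpose = L.adjugate := by
      rw [Matrix.adjugate_transpose, hL, lap_transpose]
    simp only [hq]
    rw [Matrix.dotProduct_mulVec, ← Matrix.mulVec_transpose, this, dotProduct_comm]
  have hadd : ∀ x y z, q (x + y) z = q x z + q y z := by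
    intro x y z; simp [hq, add_dotProduct]
  have hsub : ∀ x y z, q (x - y) z = q x z - q y z := by
    intro x y z; simp [hq, sub_dotProduct]
  have hadd' : ∀ x y z, q z (x + y) = q z x + q z y := by
    intro x y z; rw [hsymm, hadd, hsymm x, hsymm y]
  have hsub' : ∀ x y z, q z (x - y) = q z x - q z y := by
    intro x y z; rw [hsymm, hsub, hsymm x, hsymm y]
  have hcross : q e₀ e₁ = q (u a) (u c) - q (u a) (u d) - q (u b) (u c) + q (u b) (u d) := by
    rw [← rab, ← rcd, hsub, hsub', hsub']
    ring
  simp only [response, minors, hdet, lap_add_bond ha hb, lap_add_bond hc hd, lap_add_bond ha hc,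
    lap_add_bond hb hd, lap_add_bond ha hd, lap_add_bond hb hc, ← hu, ← hL, rab, rcd, ← h01, ← h0,
    ← h1]
  rw [add_assoc L, hD]
  congr 1
  · rw [Matrix.fromBlocks_zero, add_zero]
  · simp only [Matrix.fromBlocks_zero, add_zero]
    congr 3
    congr 1
    simp only [det_add_vecMulVec]
    change L.det + q (u a - u c) (u a - u c) + (L.det + q (u b - u d) (u b - u d)) -
      (L.det + q (u a - u d) (u a - u d)) - (L.det + q (u b - u c) (u b - u c)) =
      L.det + q e₀ e₀ + (L.det + q e₁ e₁) - (L.det + q (e₀ + e₁) (e₀ + e₁)) - L.det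
    simp only [hsub, hsub', hadd, hadd', hsymm e₁ e₀, hcross, hsymm (u c) (u a), hsymm (u d) (u a),
      hsymm (u c) (u b), hsymm (u d) (u b)]
    ring

end Response

/-! ### Monotonicity of the effective energies -/

section Energy

variable {V : Type*} [Fintype V] {A A' : Finset V} {a b c d : V} {w : Sym2 V → ℝ}

/-- The block of the Laplacian that belongs to the contraction of `a` with `b` and `c` with `d`. -/
noncomputable def innerLap (A : Finset V) (a b c d : V) (w : Sym2 V → ℝ) :
    Matrix {v : V // v ∈ A ∧ v ≠ a ∧ v ≠ c ∧ v ≠ d} {v : V // v ∈ A ∧ v ≠ a ∧ v ≠ c ∧ v ≠ d} ℝ :=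
  (lap A a b c d w).toBlocks₂₂

theorem exists_lap_mulVec_eq_zero (hw : ∀ e, 0 ≤ w e) (hZ : (innerLap A a b c d w).det = 0) :
    ∃ z, z ≠ 0 ∧ (lap A a b c d w).mulVec (Sum.elim 0 z) = 0 ∧
      ∀ e, inside A w e ≠ 0 → edgeDiff (pot A a b c d (Sum.elim 0 z)) e = 0 := by
  obtain ⟨z, hz, hZz⟩ := Matrix.exists_mulVec_eq_zero_iff.2 hZ
  have hquad : (Sum.elim 0 z) ⬝ᵥ (lap A a b c d w).mulVec (Sum.elim 0 z) = 0 := by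
    rw [← Matrix.fromBlocks_toBlocks (lap A a b c d w), Matrix.fromBlocks_mulVec,
      sumElim_dotProduct_sumElim]
    simp only [Sum.elim_comp_inl, Sum.elim_comp_inr, Matrix.mulVec_zero, zero_add, zero_dotProduct]
    rw [show (lap A a b c d w).toBlocks₂₂.mulVec z = 0 from hZz, dotProduct_zero]
  have hterm : ∀ e, inside A w e ≠ 0 → edgeDiff (pot A a b c d (Sum.elim 0 z)) e = 0 := by
    intro e he
    rw [dotProduct_lap_mulVec, Finset.sum_eq_zero_iff_of_nonneg] at hquad
    · have := hquad e (Finset.mem_univ e)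
      rw [mul_assoc] at this
      exact mul_self_eq_zero.1 ((mul_eq_zero.1 this).resolve_left he)
    · intro e _
      rw [mul_assoc]
      exact mul_nonneg (inside_nonneg hw e) (mul_self_nonneg _)
  refine ⟨z, hz, ?_, hterm⟩
  ext i
  rw [lap, gram_mulVec]
  refine Finset.sum_eq_zero fun e _ => ?_
  by_cases he : inside A w e = 0
  · rw [he, zero_mul, zero_mul]
  · rw [edgeVecR_dotProduct, hterm e he, mul_zero]

/-- If the inner block is singular, then some nonzero potential that is equal on both pairs has no
energy. It still has none after a perturbation in the two distinguished coordinates, so all minors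
vanish. -/
theorem response_treeOn_eq_zero (hac : a ≠ c) (had : a ≠ d) (hcd : c ≠ d) (hab : a ≠ b)
    (ha : a ∈ A) (hb : b ∈ A) (hc : c ∈ A) (hd : d ∈ A) (hw : ∀ e, 0 ≤ w e)
    (hZ : (innerLap A a b c d w).det = 0) :
    response (weightSum (TreeOn A)) a b c d w = 0 := by
  obtain ⟨z, hz, hLz, -⟩ := exists_lap_mulVec_eq_zero hw hZ
  have hzero : ∀ T : Matrix (Fin 2) (Fin 2) ℝ,
      (lap A a b c d w + Matrix.fromBlocks T 0 0 0).det = 0 := by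
    intro T
    refine Matrix.exists_mulVec_eq_zero_iff.1 ⟨Sum.elim 0 z, ?_, ?_⟩
    · intro h
      exact hz (funext fun i => congrFun h (Sum.inr i))
    · rw [Matrix.add_mulVec, hLz, Matrix.fromBlocks_mulVec]
      ext (i | i) <;> simp
  rw [response_treeOn hac had hcd hab ha hb hc hd]
  simp only [minors, hzero]
  ext i
  fin_cases i <;> simp

/-- The contracted Laplacian is nonsingular if every function that is constant along the edges
of `A` and satisfies the two contraction constraints is constant. -/
theorem innerLap_det_ne_zero (hac : a ≠ c) (had : a ≠ d) (hcd : c ≠ d) (hab : a ≠ b)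
    (hw : ∀ e, 0 ≤ w e)
    (h : ∀ φ : V → ℝ, φ a = φ b → φ c = φ d →
      (∀ e, inside A w e ≠ 0 → edgeDiff φ e = 0) → ∀ v ∈ A, φ v = φ d) :
    (innerLap A a b c d w).det ≠ 0 := by
  intro hZ
  obtain ⟨z, hz, -, hterm⟩ := exists_lap_mulVec_eq_zero hw hZ
  refine hz (funext fun v => ?_)
  have := h _ (by rw [pot_a hab]; simp) (by rw [pot_c hac, pot_d had hcd]; simp) hterm v v.2.1
  rw [pot_d had hcd, pot_inner _ v.2] at this
  exact this

theorem inside_le_inside (hA : A' ⊆ A) (hw : ∀ e, 0 ≤ w e) (e : Sym2 V) :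
    inside A' w e ≤ inside A w e := by
  unfold inside
  by_cases h' : ∀ v ∈ e, v ∈ A'
  · rw [if_pos h', if_pos fun v hv => hA (h' v hv)]
  · rw [if_neg h']
    exact inside_nonneg hw e

theorem inside_ne_zero {e : Sym2 V} (h : inside A w e ≠ 0) : (∀ v ∈ e, v ∈ A) ∧ w e ≠ 0 := by
  unfold inside at h
  split_ifs at h with h'
  · exact ⟨h', h⟩
  · exact absurd rfl h

theorem edgeDiff_pot_ofPot (hac : a ≠ c) (had : a ≠ d) (hcd : c ≠ d) (hab : a ≠ b) (hb : b ∈ A)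
    (φ : V → ℝ) {e : Sym2 V} (he : ∀ v ∈ e, v ∈ A) :
    edgeDiff (pot A a b c d (ofPot A a b c d φ)) e = edgeDiff φ e := by
  simp only [edgeDiff]
  rw [pot_ofPot hab hac had hcd hb φ (he _ (Sym2.out_fst_mem e)),
    pot_ofPot hab hac had hcd hb φ (he _ (Sym2.out_snd_mem e))]
  ring

/-- The energy gap between the responses of `A` and of a subset `A'`: it is at least the energy
of the minimizer on the edges of `A` that are not edges of `A'`. -/
theorem schur_sub_schur_ge (hac : a ≠ c) (had : a ≠ d) (hcd : c ≠ d) (hab : a ≠ b)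
    (hb : b ∈ A') (hw : ∀ e, 0 ≤ w e)
    (hZ : (innerLap A a b c d w).det ≠ 0) (hZ' : (innerLap A' a b c d w).det ≠ 0)
    (ξ : Fin 2 → ℝ) :
    ∑ e, (inside A w e - inside A' w e) *
        edgeDiff (pot A a b c d (minimizer (lap A a b c d w) ξ)) e ^ 2 ≤
      ξ ⬝ᵥ (schur (lap A a b c d w) - schur (lap A' a b c d w)).mulVec ξ := by
  set φ := pot A a b c d (minimizer (lap A a b c d w) ξ) with hφ
  have hE : ξ ⬝ᵥ (schur (lap A a b c d w)).mulVec ξ = ∑ e, inside A w e * edgeDiff φ e ^ 2 := by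
    rw [← minimizer_dotProduct hZ, dotProduct_lap_mulVec]
    exact Finset.sum_congr rfl fun e _ => by rw [← hφ]; ring
  have hE' : ξ ⬝ᵥ (schur (lap A' a b c d w)).mulVec ξ ≤ ∑ e, inside A' w e * edgeDiff φ e ^ 2 := by
    have h := schur_le hZ' (lap_transpose w) (lap_nonneg hw) (ofPot A' a b c d φ)
    have hξ : ofPot A' a b c d φ ∘ Sum.inl = ξ := by
      ext i
      fin_cases i
      · simp [ofPot, hφ, pot_a hab, minimizer]
      · simp [ofPot, hφ, pot_c hac, pot_d had hcd, minimizer]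
    rw [hξ, dotProduct_lap_mulVec] at h
    refine h.trans_eq (Finset.sum_congr rfl fun e _ => ?_)
    by_cases he : inside A' w e = 0
    · rw [he]; ring
    · rw [edgeDiff_pot_ofPot hac had hcd hab hb φ (inside_ne_zero he).1]; ring
  rw [Matrix.sub_mulVec, dotProduct_sub, hE]
  simp only [sub_mul, Finset.sum_sub_distrib]
  linarith

theorem pair_zero_right (x : Fin 5 → ℝ) : pair x 0 = 0 := by simp [pair]

theorem pair_zero_left (x : Fin 5 → ℝ) : pair 0 x = 0 := by simp [pair]

theorem innerLap_posSemidef (hw : ∀ e, 0 ≤ w e) : (innerLap A a b c d w).PosSemidef := by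
  have h : (lap A a b c d w).PosSemidef := by
    refine Matrix.PosSemidef.of_dotProduct_mulVec_nonneg ?_ ?_
    · rw [Matrix.IsHermitian, Matrix.conjTranspose_eq_transpose_of_trivial, lap_transpose]
    · intro x
      simpa using lap_nonneg hw x
  exact h.submatrix Sum.inr

theorem pair_treeOn_eq (hac : a ≠ c) (had : a ≠ d) (hcd : c ≠ d) (hab : a ≠ b)
    (hA : A' ⊆ A) (ha : a ∈ A') (hb : b ∈ A') (hc : c ∈ A') (hd : d ∈ A')
    (hZ : (innerLap A a b c d w).det ≠ 0) (hZ' : (innerLap A' a b c d w).det ≠ 0) :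
    pair (response (weightSum (TreeOn A)) a b c d w)
      (response (weightSum (TreeOn A')) a b c d w) =
    (innerLap A a b c d w).det * (innerLap A' a b c d w).det *
      (schur (lap A a b c d w) - schur (lap A' a b c d w)).det := by
  rw [response_treeOn hac had hcd hab (hA ha) (hA hb) (hA hc) (hA hd),
    response_treeOn hac had hcd hab ha hb hc hd, minors_det (lap_transpose w) hZ,
    minors_det (lap_transpose w) hZ', pair_smul_smul (schur_symm (lap_transpose w))
      (schur_symm (lap_transpose w))]
  rfl

theorem schur_sub_isHermitian : (schur (lap A a b c d w) - schur (lap A' a b c d w)).IsHermitian := by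
  rw [Matrix.IsHermitian, Matrix.conjTranspose_eq_transpose_of_trivial, Matrix.transpose_sub,
    schur_symm (lap_transpose w), schur_symm (lap_transpose w)]

/-- Fewer vertices carry less energy, so the determinant in `pair_treeOn_eq` is that of a positive
semidefinite matrix. -/
theorem pair_treeOn_nonneg (hac : a ≠ c) (had : a ≠ d) (hcd : c ≠ d) (hab : a ≠ b)
    (hA : A' ⊆ A) (ha : a ∈ A') (hb : b ∈ A') (hc : c ∈ A') (hd : d ∈ A') (hw : ∀ e, 0 ≤ w e) :
    0 ≤ pair (response (weightSum (TreeOn A)) a b c d w)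
      (response (weightSum (TreeOn A')) a b c d w) := by
  by_cases hZ : (innerLap A a b c d w).det = 0
  · rw [response_treeOn_eq_zero hac had hcd hab (hA ha) (hA hb) (hA hc) (hA hd) hw hZ,
      pair_zero_left]
  by_cases hZ' : (innerLap A' a b c d w).det = 0
  · rw [response_treeOn_eq_zero hac had hcd hab ha hb hc hd hw hZ', pair_zero_right]
  rw [pair_treeOn_eq hac had hcd hab hA ha hb hc hd hZ hZ']
  refine mul_nonneg (mul_nonneg (innerLap_posSemidef hw).det_nonneg
    (innerLap_posSemidef hw).det_nonneg) (Matrix.PosSemidef.det_nonneg ?_)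
  refine Matrix.PosSemidef.of_dotProduct_mulVec_nonneg schur_sub_isHermitian fun ξ => ?_
  rw [star_trivial]
  refine le_trans ?_ (schur_sub_schur_ge hac had hcd hab hb hw hZ hZ' ξ)
  exact Finset.sum_nonneg fun e _ =>
    mul_nonneg (sub_nonneg.2 (inside_le_inside hA hw e)) (sq_nonneg _)

/-- The response of a tree sum lies on the null cone of `pair`. -/
theorem pair_treeOn_self (hac : a ≠ c) (had : a ≠ d) (hcd : c ≠ d) (hab : a ≠ b)
    (ha : a ∈ A) (hb : b ∈ A) (hc : c ∈ A) (hd : d ∈ A) (hw : ∀ e, 0 ≤ w e) :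
    pair (response (weightSum (TreeOn A)) a b c d w)
      (response (weightSum (TreeOn A)) a b c d w) = 0 := by
  by_cases hZ : (innerLap A a b c d w).det = 0
  · rw [response_treeOn_eq_zero hac had hcd hab ha hb hc hd hw hZ, pair_zero_left]
  · rw [pair_treeOn_eq hac had hcd hab le_rfl ha hb hc hd hZ hZ, sub_self, Matrix.det_fin_two]
    simp

/-- Strict positivity, unless some potential that is not constant on both pairs and whose only
currents enter at `a`, `c` and leave at `b`, `d` in equal amounts carries no current on the edges
of `A` that are not edges of `A'`. -/
theorem pair_treeOn_pos (hac : a ≠ c) (had : a ≠ d) (hcd : c ≠ d) (hab : a ≠ b)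
    (hA : A' ⊆ A) (ha : a ∈ A') (hb : b ∈ A') (hc : c ∈ A') (hd : d ∈ A') (hw : ∀ e, 0 ≤ w e)
    (hZ : (innerLap A a b c d w).det ≠ 0) (hZ' : (innerLap A' a b c d w).det ≠ 0)
    (h : ∀ φ : V → ℝ,
      (∀ ψ : V → ℝ, ψ a = ψ b → ψ c = ψ d → ∑ e, inside A w e * edgeDiff ψ e * edgeDiff φ e = 0) →
      (∀ e, inside A w e ≠ inside A' w e → edgeDiff φ e = 0) → φ a = φ b ∧ φ c = φ d) :
    0 < pair (response (weightSum (TreeOn A)) a b c d w)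
      (response (weightSum (TreeOn A')) a b c d w) := by
  rw [pair_treeOn_eq hac had hcd hab hA ha hb hc hd hZ hZ']
  refine mul_pos (mul_pos ((innerLap_posSemidef hw).det_nonneg.lt_of_ne' hZ)
    ((innerLap_posSemidef hw).det_nonneg.lt_of_ne' hZ')) (Matrix.PosDef.det_pos ?_)
  refine Matrix.PosDef.of_dotProduct_mulVec_pos schur_sub_isHermitian fun ξ hξ => ?_
  rw [star_trivial]
  set φ := pot A a b c d (minimizer (lap A a b c d w) ξ) with hφ
  have hnn : ∀ e, 0 ≤ (inside A w e - inside A' w e) * edgeDiff φ e ^ 2 := fun e =>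
    mul_nonneg (sub_nonneg.2 (inside_le_inside hA hw e)) (sq_nonneg _)
  refine lt_of_lt_of_le ?_ (schur_sub_schur_ge hac had hcd hab hb hw hZ hZ' ξ)
  rw [← hφ]
  refine lt_of_le_of_ne (Finset.sum_nonneg fun e _ => hnn e) fun h0 => hξ ?_
  have hzero := (Finset.sum_eq_zero_iff_of_nonneg fun e _ => hnn e).1 h0.symm
  have hφ2 := h φ ?_ ?_
  · ext i
    fin_cases i
    · have := hφ2.1
      simp only [hφ, pot_a hab, minimizer, Sum.elim_inl] at this
      simpa using this
    · have := hφ2.2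
      simp only [hφ, pot_c hac, pot_d had hcd, minimizer, Sum.elim_inl] at this
      simpa using this
  · intro ψ hψ1 hψ2
    have hL := dotProduct_lap_mulVec (A := A) (a := a) (b := b) (c := c) (d := d) w
      (minimizer (lap A a b c d w) ξ) (ofPot A a b c d ψ)
    rw [mulVec_minimizer hZ, ← hφ, ofPot, sumElim_dotProduct_sumElim, hψ1, hψ2, sub_self, sub_self,
      dotProduct_zero, add_zero] at hL
    have h00 : (![0, 0] : Fin 2 → ℝ) ⬝ᵥ (schur (lap A a b c d w)).mulVec ξ = 0 := by
      simp [dotProduct]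
    rw [h00] at hL
    rw [hL]
    refine Finset.sum_congr rfl fun e _ => ?_
    by_cases he : inside A w e = 0
    · rw [he]; ring
    · have := edgeDiff_pot_ofPot hac had hcd hab (hA hb) ψ (inside_ne_zero he).1
      rw [ofPot, hψ1, hψ2, sub_self, sub_self] at this
      rw [this]
  · intro e he
    have := hzero e (Finset.mem_univ e)
    exact pow_eq_zero_iff (two_ne_zero) |>.1 ((mul_eq_zero.1 this).resolve_left (sub_ne_zero.2 he))

end Energy

/-! ### Potentials and separating vertices -/

section Separation

variable {V : Type*} {G : SimpleGraph V} {a b c d : V}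

/-- The graph `G` without the edges that meet `X`. -/
def avoid (G : SimpleGraph V) (X : Set V) : SimpleGraph V where
  Adj u v := G.Adj u v ∧ u ∉ X ∧ v ∉ X
  symm := ⟨fun _ _ h => ⟨h.1.symm, h.2.2, h.2.1⟩⟩
  loopless := ⟨fun _ h => h.1.ne rfl⟩

/-- The vertices that are connected to `s` or `t` in `G` without `X`. -/
def Side (G : SimpleGraph V) (s t : V) (X : Set V) : Set V :=
  {x | ∃ p, (p = s ∨ p = t) ∧ p ∉ X ∧ (avoid G X).Reachable p x}

/-- After removal of `X` there still is a path from `{a, b}` to `{c, d}`. -/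
def Crosses (G : SimpleGraph V) (a b c d : V) (X : Set V) : Prop :=
  c ∈ Side G a b X ∨ d ∈ Side G a b X

theorem side_start {s t p : V} {X : Set V} (h : p = s ∨ p = t) (hp : p ∉ X) : p ∈ Side G s t X :=
  ⟨p, h, hp, SimpleGraph.Reachable.refl _⟩

theorem side_notMem {s t x : V} {X : Set V} (h : x ∈ Side G s t X) : x ∉ X := by
  obtain ⟨p, _, hp, hr⟩ := h
  exact reachable_induction (P := fun x => x ∉ X) hr hp fun _ _ _ h => h.2.2

theorem side_step {s t x y : V} {X : Set V} (h : x ∈ Side G s t X) (hxy : G.Adj x y)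
    (hy : y ∉ X) : y ∈ Side G s t X := by
  have hx := side_notMem h
  obtain ⟨p, hp, hpX, hr⟩ := h
  exact ⟨p, hp, hpX, hr.trans (SimpleGraph.Adj.reachable (G := avoid G X) ⟨hxy, hx, hy⟩)⟩

theorem side_induction {s t x : V} {X : Set V} {P : V → Prop} (h : x ∈ Side G s t X)
    (h0 : ∀ p, (p = s ∨ p = t) → p ∉ X → P p)
    (hs : ∀ u v, u ∈ Side G s t X → P u → G.Adj u v → v ∉ X → P v) : P x := by
  obtain ⟨p, hp, hpX, hr⟩ := h
  refine (reachable_induction (P := fun x => x ∈ Side G s t X ∧ P x) hr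
    ⟨side_start hp hpX, h0 p hp hpX⟩ ?_).2
  rintro u v ⟨hu, hPu⟩ ⟨huv, _, hv⟩
  exact ⟨side_step hu huv hv, hs u v hu hPu huv hv⟩

theorem side_comm (s t : V) (X : Set V) : Side G s t X = Side G t s X := by
  ext x
  simp only [Side, or_comm]

theorem Crosses.symm {X : Set V} (h : Crosses G a b c d X) : Crosses G c d a b X := by
  have key : ∀ r, (r = c ∨ r = d) → r ∈ Side G a b X → Crosses G c d a b X := by
    intro r hr h
    have hrX := side_notMem h
    obtain ⟨p, hp, hpX, hpr⟩ := h
    have : p ∈ Side G c d X := ⟨r, hr, hrX, hpr.symm⟩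
    rcases hp with rfl | rfl
    · exact Or.inl this
    · exact Or.inr this
  rcases h with h | h
  · exact key c (Or.inl rfl) h
  · exact key d (Or.inr rfl) h

theorem Crosses.swap_left {X : Set V} (h : Crosses G a b c d X) : Crosses G b a c d X := by
  rwa [Crosses, side_comm]

theorem Crosses.swap_right {X : Set V} (h : Crosses G a b c d X) : Crosses G a b d c X := Or.symm h

theorem crosses_of_mem_side {X : Set V} {x : V} (h : x ∈ Side G a b X) (h' : x ∈ Side G c d X) :
    Crosses G a b c d X := by
  obtain ⟨p, hp, hpX, hpr⟩ := h
  obtain ⟨q, hq, hqX, hqr⟩ := h'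
  have : q ∈ Side G a b X := ⟨p, hp, hpX, hpr.trans hqr.symm⟩
  rcases hq with rfl | rfl
  · exact Or.inl this
  · exact Or.inr this

theorem exists_boundary_edge {U : Set V} {p r : V} (h : G.Reachable p r) (hp : p ∈ U)
    (hr : r ∉ U) : ∃ u ∈ U, ∃ v ∉ U, G.Adj u v := by
  by_contra! hcon
  exact hr (reachable_induction (P := fun x => x ∈ U) h hp fun u v hu huv => by
    by_contra hv
    exact hcon u hu v hv huv)

/-- `φ` behaves like the potential of an electrical current that enters at `a` and `c` and leaves
in the same amounts at `b` and `d`: if a set of vertices separates neither `a` from `b` nor `c`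
from `d`, then the net current out of this set vanishes; in particular there is no current at all
if all of it flows outwards. -/
def IsFlow (G : SimpleGraph V) (a b c d : V) (φ : V → ℝ) : Prop :=
  ∀ U : Set V, (a ∈ U ↔ b ∈ U) → (c ∈ U ↔ d ∈ U) →
    (∀ u ∈ U, ∀ v ∉ U, G.Adj u v → φ v ≤ φ u) → ∀ u ∈ U, ∀ v ∉ U, G.Adj u v → φ u = φ v

variable {φ : V → ℝ}

theorem IsFlow.neg (h : IsFlow G a b c d φ) : IsFlow G a b c d (-φ) := by
  intro U h1 h2 h3 u hu v hv huv
  have := h Uᶜ (not_congr h1) (not_congr h2) (fun x hx y hy hxy => by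
    have := h3 y (not_not.1 hy) x hx hxy.symm
    simpa using this) v hv u (not_not.2 hu) huv.symm
  simp [this]

theorem IsFlow.sub_const (h : IsFlow G a b c d φ) (k : ℝ) :
    IsFlow G a b c d (fun v => φ v - k) := by
  intro U h1 h2 h3 u hu v hv huv
  have := h U h1 h2 (fun x hx y hy hxy => by have := h3 x hx y hy hxy; linarith) u hu v hv huv
  simp [this]

theorem IsFlow.symm (h : IsFlow G a b c d φ) : IsFlow G c d a b φ :=
  fun U h1 h2 => h U h2 h1

theorem IsFlow.swap_left (h : IsFlow G a b c d φ) : IsFlow G b a c d φ :=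
  fun U h1 h2 => h U h1.symm h2

theorem IsFlow.swap_right (h : IsFlow G a b c d φ) : IsFlow G a b d c φ :=
  fun U h1 h2 => h U h1 h2.symm

/-- If the potential vanishes on a set `X` that cuts `{a, b}` off from `{c, d}`, and also at `b`,
then `b` alone cuts `a` off, unless the potential vanishes at `a` too. -/
theorem IsFlow.not_pos_of_cut (hG : G.Preconnected) (h : IsFlow G a b c d φ) {X : Set V}
    (hX : ∀ x ∈ X, φ x = 0) (hcut : ¬ Crosses G a b c d X) (ha : a ∉ X) (hb : b ∉ X)
    (hb0 : φ b = 0) (hsep : Crosses G a b c d {b}) : ¬ 0 < φ a := by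
  intro hpos
  have hA : ∀ u ∈ Side G a b X, ∀ v ∉ Side G a b X, G.Adj u v → φ v = 0 := by
    intro u hu v hv huv
    by_contra hne
    exact hv (side_step hu huv fun hvX => hne (hX v hvX))
  have haS : a ∈ Side G a b X := side_start (Or.inl rfl) ha
  have hbS : b ∈ Side G a b X := side_start (Or.inr rfl) hb
  have hc : c ∉ Side G a b X := fun hc => hcut (Or.inl hc)
  have hd : d ∉ Side G a b X := fun hd => hcut (Or.inr hd)
  have hnonneg : ∀ x ∈ Side G a b X, 0 ≤ φ x := by
    by_contra! hcon
    obtain ⟨x, hx, hxneg⟩ := hcon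
    set U : Set V := {x | x ∈ Side G a b X ∧ φ x < 0} with hU
    have haU : a ∉ U := fun h => by linarith [h.2]
    have hbU : b ∉ U := fun h => by linarith [h.2]
    have hbd : ∀ u ∈ U, ∀ v ∉ U, G.Adj u v → φ u < φ v := by
      intro u hu v hv huv
      have : 0 ≤ φ v := by
        by_cases hvS : v ∈ Side G a b X
        · by_contra hneg
          exact hv ⟨hvS, not_le.1 hneg⟩
        · rw [hA u hu.1 v hvS huv]
      linarith [hu.2]
    obtain ⟨u, hu, v, hv, huv⟩ := exists_boundary_edge (hG x a) (show x ∈ U from ⟨hx, hxneg⟩) haU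
    have := h.neg U (iff_of_false haU hbU)
      (iff_of_false (fun hh => hc hh.1) fun hh => hd hh.1)
      (fun u hu v hv huv => by have := hbd u hu v hv huv; simp; linarith) u hu v hv huv
    have h2 := hbd u hu v hv huv
    simp only [Pi.neg_apply, neg_inj] at this
    linarith
  set P : Set V := {x | x ∈ Side G a b X ∧ 0 < φ x} with hP
  have hflow := h (P ∪ {b}) (iff_of_true (Or.inl ⟨haS, hpos⟩) (Or.inr rfl))
    (iff_of_false
      (by rintro (hh | hh); exacts [hc hh.1, hc (by rw [Set.mem_singleton_iff.1 hh]; exact hbS)])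
      (by rintro (hh | hh); exacts [hd hh.1, hd (by rw [Set.mem_singleton_iff.1 hh]; exact hbS)]))
  have houter : ∀ u ∈ P ∪ {b}, ∀ v ∉ P ∪ {b}, G.Adj u v → φ v ≤ 0 := by
    intro u hu v hv huv
    have huS : u ∈ Side G a b X := by
      rcases hu with hu | hu
      · exact hu.1
      · rw [Set.mem_singleton_iff.1 hu]; exact hbS
    by_cases hvS : v ∈ Side G a b X
    · by_contra hneg
      exact hv (Or.inl ⟨hvS, not_le.1 hneg⟩)
    · exact (hA u huS v hvS huv).le
  have hflow := hflow (fun u hu v hv huv => by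
    have h1 := houter u hu v hv huv
    rcases hu with hu | hu
    · linarith [hu.2]
    · rw [Set.mem_singleton_iff.1 hu, hb0]; exact h1)
  have hclosed : ∀ x ∈ Side G a b {b}, x ∈ P := by
    intro x hx
    refine side_induction hx ?_ ?_
    · rintro p (rfl | rfl) hp
      · exact ⟨haS, hpos⟩
      · exact absurd rfl hp
    · intro u v _ hu huv hv
      by_contra hvP
      have hvn : v ∉ P ∪ {b} := fun hh => hh.elim hvP hv
      have h1 := hflow u (Or.inl hu) v hvn huv
      have h2 := houter u (Or.inl hu) v hvn huv
      linarith [hu.2]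
  rcases hsep with hh | hh
  · exact hc (hclosed _ hh).1
  · exact hd (hclosed _ hh).1

theorem IsFlow.eq_of_cut (hG : G.Preconnected) (h : IsFlow G a b c d φ) {X : Set V}
    (hX : ∀ x ∈ X, φ x = 0) (hcut : ¬ Crosses G a b c d X) (ha : a ∉ X) (hb : b ∉ X)
    (h0 : φ a = 0 ∨ φ b = 0) (hsep : ∀ z, Crosses G a b c d {z}) : φ a = φ b := by
  have hX' : ∀ x ∈ X, (-φ) x = 0 := fun x hx => by simp [hX x hx]
  have hcut' : ¬ Crosses G b a c d X := fun hh => hcut hh.swap_left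
  rcases h0 with h0 | h0
  · have h1 := h.swap_left.not_pos_of_cut hG hX hcut' hb ha h0 (hsep a).swap_left
    have h2 := h.swap_left.neg.not_pos_of_cut hG hX' hcut' hb ha (by simp [h0])
      (hsep a).swap_left
    simp only [Pi.neg_apply] at h2
    linarith
  · have h1 := h.not_pos_of_cut hG hX hcut ha hb h0 (hsep b)
    have h2 := h.neg.not_pos_of_cut hG hX' hcut ha hb (by simp [h0]) (hsep b)
    simp only [Pi.neg_apply] at h2
    linarith

/-- A potential that vanishes at `a`, `b` and `c` vanishes at `d`, unless `c` separates `d` from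
`a` and `b`. -/
theorem IsFlow.not_pos_of_three (h : IsFlow G a b c d φ) (ha : φ a = 0) (hb : φ b = 0)
    (hc : φ c = 0) (hac : a ≠ c) (hbc : b ≠ c) (hsep : Crosses G a b c d {c}) : ¬ 0 < φ d := by
  intro hpos
  set P : Set V := {x | 0 < φ x} with hP
  have haP : a ∉ P ∪ {c} := by rintro (hh | hh); exacts [hh.ne' ha, hac hh]
  have hbP : b ∉ P ∪ {c} := by rintro (hh | hh); exacts [hh.ne' hb, hbc hh]
  have houter : ∀ v ∉ P ∪ {c}, φ v ≤ 0 := fun v hv => not_lt.1 fun hh => hv (Or.inl hh)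
  have hflow := h (P ∪ {c}) (iff_of_false haP hbP) (iff_of_true (Or.inr rfl) (Or.inl hpos))
    (fun u hu v hv _ => by
      have h1 := houter v hv
      rcases hu with hu | hu
      · exact h1.trans (le_of_lt hu)
      · rw [Set.mem_singleton_iff.1 hu, hc]; exact h1)
  have hclosed : ∀ x ∈ Side G c d {c}, x ∈ P := by
    intro x hx
    refine side_induction hx ?_ ?_
    · rintro p (rfl | rfl) hp
      · exact absurd rfl hp
      · exact hpos
    · intro u v _ hu huv hv
      by_contra hvP
      have hvn : v ∉ P ∪ {c} := fun hh => hh.elim hvP hv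
      have h1 := hflow u (Or.inl hu) v hvn huv
      have h2 := houter v hvn
      have hu : 0 < φ u := hu
      linarith
  rcases hsep.symm with hh | hh
  · exact haP (Or.inl (hclosed _ hh))
  · exact hbP (Or.inl (hclosed _ hh))

theorem IsFlow.eq_zero_of_three (h : IsFlow G a b c d φ) (ha : φ a = 0) (hb : φ b = 0)
    (hc : φ c = 0) (hac : a ≠ c) (hbc : b ≠ c) (hsep : Crosses G a b c d {c}) : φ d = 0 := by
  have h1 := h.not_pos_of_three ha hb hc hac hbc hsep
  have h2 := h.neg.not_pos_of_three (by simp [ha]) (by simp [hb]) (by simp [hc]) hac hbc hsep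
  simp only [Pi.neg_apply] at h2
  linarith

/-- If no single vertex separates `{a, b}` from `{c, d}`, but every vertex of `N` together with
`S` does, and `N` contains all neighbours of `S` other than the four terminals, then `a` or `b`
is a neighbour of `S`. -/
theorem exists_adj_of_cuts [Fintype V] {S N : Set V} (ha : a ∉ S ∪ N) (hb : b ∉ S ∪ N)
    (hc : c ∉ S ∪ N) (hd : d ∉ S ∪ N) (hne : N.Nonempty)
    (hN : ∀ x ∈ S, ∀ y ∉ S, G.Adj x y → y ∈ N ∨ y = a ∨ y = b ∨ y = c ∨ y = d)
    (hS : Crosses G a b c d S) (hcut : ∀ v ∈ N, ¬ Crosses G a b c d (insert v S))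
    (hsep : ∀ z, Crosses G a b c d {z}) :
    ∃ x ∈ S, G.Adj x a ∨ G.Adj x b := by
  -- The vertex of `N` closest to `{a, b}`, measured by what it cuts off together with `S`.
  obtain ⟨v, hv, hmin⟩ := Set.exists_min_image N (fun v => (Side G a b (insert v S)).ncard)
    N.toFinite hne
  have hnot : ∀ t, t ∉ S ∪ N → ∀ v ∈ N, t ∉ insert v S := by
    rintro t ht v hv (rfl | h)
    · exact ht (Or.inr hv)
    · exact ht (Or.inl h)
  have hterm : ∀ v ∈ N, c ∉ Side G a b (insert v S) ∧ d ∉ Side G a b (insert v S) := fun v hv =>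
    ⟨fun h => hcut v hv (Or.inl h), fun h => hcut v hv (Or.inr h)⟩
  -- A path avoiding `v` leaves the side of `{a, b}` through `S`.
  have hexit : ∃ x ∈ Side G a b (insert v S), ∃ y ∈ S, G.Adj x y := by
    by_contra! hcon
    have hclosed : ∀ x ∈ Side G a b {v}, x ∈ Side G a b (insert v S) := by
      intro x hx
      refine side_induction hx ?_ ?_
      · intro p hp _
        refine side_start hp (hnot p ?_ v hv)
        rcases hp with rfl | rfl <;> assumption
      · intro u y _ hu huy hy
        refine side_step hu huy ?_
        rintro (rfl | hyS)
        · exact hy rfl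
        · exact hcon u hu y hyS huy
    rcases hsep v with h | h
    · exact (hterm v hv).1 (hclosed _ h)
    · exact (hterm v hv).2 (hclosed _ h)
  obtain ⟨x, hx, y, hy, hxy⟩ := hexit
  have hxv : x ∉ insert v S := side_notMem hx
  rcases hN y hy x (fun h => hxv (Or.inr h)) hxy.symm with hxN | rfl | rfl | rfl | rfl
  · exfalso
    have hxc : x ∉ Side G c d (insert v S) := fun h => hcut v hv (crosses_of_mem_side hx h)
    have hcd : ∀ p, p = c ∨ p = d → p ∉ S ∪ N := by
      rintro p (rfl | rfl) <;> assumption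
    -- `x` is a vertex of `N` on the side of `{a, b}`; so `v` is connected to `{c, d}` without `x`.
    have hsub : ∀ z ∈ Side G c d (insert v S), z ∈ Side G c d (insert x S) := by
      intro z hz
      refine side_induction hz ?_ ?_
      · intro p hp _
        exact side_start hp (hnot p (hcd p hp) x hxN)
      · intro u z hu' hu huz hz
        refine side_step hu huz ?_
        have hz' := side_step hu' huz hz
        rintro (rfl | h)
        · exact hxc hz'
        · exact hz (Or.inr h)
    have hvx : v ≠ x := fun h => hxv (Or.inl h.symm)
    have hvS : v ∉ S := by
      intro h
      have := hcut v hv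
      rw [Set.insert_eq_of_mem h] at this
      exact this hS
    have hvside : v ∈ Side G c d (insert x S) := by
      by_contra hvn
      have hclosed : ∀ z ∈ Side G c d S, z ∈ Side G c d (insert v S) := by
        intro z hz
        refine side_induction hz ?_ ?_
        · intro p hp _
          exact side_start hp (hnot p (hcd p hp) v hv)
        · intro u z _ hu huz hz
          refine side_step hu huz ?_
          rintro (rfl | h)
          · refine hvn (side_step (hsub u hu) huz ?_)
            rintro (h | h)
            · exact hvx h
            · exact hvS h
          · exact hz h
      have hcross : Crosses G c d a b (insert v S) := by
        rcases hS.symm with h | h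
        · exact Or.inl (hclosed _ h)
        · exact Or.inr (hclosed _ h)
      exact hcut v hv hcross.symm
    have hsub2 : Side G a b (insert x S) ⊆ Side G a b (insert v S) := by
      intro z hz
      refine side_induction hz ?_ ?_
      · intro p hp _
        refine side_start hp (hnot p ?_ v hv)
        rcases hp with rfl | rfl <;> assumption
      · intro u z hu' hu huz hz
        refine side_step hu huz ?_
        rintro (rfl | h)
        · exact hcut x hxN (crosses_of_mem_side (side_step hu' huz hz) hvside)
        · exact hz (Or.inr h)
    have hlt : (Side G a b (insert x S)).ncard < (Side G a b (insert v S)).ncard :=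
      Set.ncard_lt_ncard (Set.ssubset_iff_of_subset hsub2 |>.2
        ⟨x, hx, fun h => side_notMem h (Or.inl rfl)⟩) (Set.toFinite _)
    exact absurd (hmin x hxN) (not_le.2 hlt)
  · exact ⟨y, hy, Or.inl hxy.symm⟩
  · exact ⟨y, hy, Or.inr hxy.symm⟩
  · exact absurd hx (hterm v hv).1
  · exact absurd hx (hterm v hv).2

/-- The sets of vertices other than the four terminals whose removal is used to show strict
positivity. They are connected, their removal neither separates `{a, b}` from `{c, d}` nor cuts
off vertices from all terminals, and every potential that carries no current on the edges meeting
the set is constant on both pairs. -/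
structure IsRigid (G : SimpleGraph V) (a b c d : V) (S : Finset V) : Prop where
  nonempty : S.Nonempty
  notMem : a ∉ S ∧ b ∉ S ∧ c ∉ S ∧ d ∉ S
  connected : ∀ x ∈ S, ∀ y ∈ S, (avoid G (S : Set V)ᶜ).Reachable x y
  crosses : Crosses G a b c d S
  reachable : ∀ v ∉ S, ∃ t, (t = a ∨ t = b ∨ t = c ∨ t = d) ∧ (avoid G (S : Set V)).Reachable t v
  const : ∀ φ : V → ℝ, IsFlow G a b c d φ → (∀ x ∈ S, ∀ y, G.Adj x y → φ x = φ y) →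
    φ a = φ b ∧ φ c = φ d

/-- If no vertex separates `{a, b}` from `{c, d}`, and if some component of the graph without the
four terminals has three of them as neighbours, then this component contains a rigid set, namely
any largest connected set whose removal leaves a path from `{a, b}` to `{c, d}`. -/
theorem exists_isRigid [Fintype V] (hG : G.Preconnected) (hsep : ∀ z, Crosses G a b c d {z})
    {s : V} (hs : s ∉ ({a, b, c, d} : Set V)) {t₁ t₂ t₃ : V} (h₁₂ : t₁ ≠ t₂) (h₁₃ : t₁ ≠ t₃)
    (h₂₃ : t₂ ≠ t₃)
    (ht : ∀ t, t = t₁ ∨ t = t₂ ∨ t = t₃ → t ∈ ({a, b, c, d} : Set V) ∧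
      ∃ x, (avoid G {a, b, c, d}).Reachable s x ∧ G.Adj x t) :
    ∃ S, IsRigid G a b c d S := by
  set T : Set V := {a, b, c, d} with hT
  have haT : a ∈ T := by simp [hT]
  have hbT : b ∈ T := by simp [hT]
  have hcT : c ∈ T := by simp [hT]
  have hdT : d ∈ T := by simp [hT]
  set C : Set V := {x | (avoid G T).Reachable s x} with hC
  have hCT : ∀ x ∈ C, x ∉ T := fun x hx =>
    reachable_induction (P := fun x => x ∉ T) hx hs fun _ _ _ h => h.2.2
  have hCstep : ∀ x ∈ C, ∀ y, G.Adj x y → y ∉ T → y ∈ C := fun x hx y hxy hy =>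
    SimpleGraph.Reachable.trans hx
      (SimpleGraph.Adj.reachable (G := avoid G T) ⟨hxy, hCT x hx, hy⟩)
  let Good : Finset V → Prop := fun S => S.Nonempty ∧ (∀ x ∈ S, x ∈ C) ∧
    (∀ x ∈ S, ∀ y ∈ S, (avoid G (S : Set V)ᶜ).Reachable x y) ∧ Crosses G a b c d S
  obtain ⟨S, hS, hmax⟩ := Finset.exists_max_image (Finset.univ.filter Good) Finset.card
    ⟨{s}, by
      simp only [Finset.mem_filter, Finset.mem_univ, true_and, Good]
      refine ⟨Finset.singleton_nonempty s, ?_, ?_, by simpa using hsep s⟩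
      · intro x hx
        rw [Finset.mem_singleton.1 hx]
        exact SimpleGraph.Reachable.refl _
      · intro x hx y hy
        rw [Finset.mem_singleton.1 hx, Finset.mem_singleton.1 hy]⟩
  simp only [Finset.mem_filter, Finset.mem_univ, true_and] at hS hmax
  obtain ⟨hne, hSC, hconn, hcross⟩ := hS
  have hST : ∀ x ∈ S, x ∉ T := fun x hx => hCT x (hSC x hx)
  have hTS : ∀ t ∈ T, t ∉ S := fun t ht h => hST t h ht
  -- A neighbour of `S` cannot be added to `S`.
  have hcut : ∀ x ∈ S, ∀ v ∉ S, G.Adj x v → v ∉ T → ¬ Crosses G a b c d (insert v (S : Set V)) := by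
    intro x hx v hv hxv hvT hcr
    have hle : avoid G (S : Set V)ᶜ ≤ avoid G ((insert v S : Finset V) : Set V)ᶜ := by
      rintro p q ⟨hpq, hp, hq⟩
      refine ⟨hpq, ?_, ?_⟩
      · simp only [Set.mem_compl_iff, not_not, Finset.mem_coe] at hp ⊢
        exact Finset.mem_insert_of_mem hp
      · simp only [Set.mem_compl_iff, not_not, Finset.mem_coe] at hq ⊢
        exact Finset.mem_insert_of_mem hq
    have hto : ∀ y ∈ insert v S, (avoid G ((insert v S : Finset V) : Set V)ᶜ).Reachable x y := by
      intro y hy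
      rcases Finset.mem_insert.1 hy with rfl | hy
      · exact SimpleGraph.Adj.reachable ⟨hxv, by simp [hx], by simp⟩
      · exact (hconn x hx y hy).mono hle
    have := hmax (insert v S) ⟨Finset.insert_nonempty _ _, ?_,
      fun p hp q hq => (hto p hp).symm.trans (hto q hq), by simpa using hcr⟩
    · rw [Finset.card_insert_of_notMem hv] at this
      omega
    · intro y hy
      rcases Finset.mem_insert.1 hy with rfl | hy
      · exact hCstep x (hSC x hx) y hxv hvT
      · exact hSC y hy
  refine ⟨S, hne, ⟨hTS a haT, hTS b hbT, hTS c hcT, hTS d hdT⟩, hconn, hcross, ?_, ?_⟩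
  · -- A vertex cut off from all terminals could be added to `S`.
    by_contra! hcon
    obtain ⟨v₀, hv₀, hno⟩ := hcon
    set O : Set V := {v | v ∉ S ∧ ∀ t ∈ T, ¬ (avoid G (S : Set V)).Reachable t v} with hO
    have hv₀O : v₀ ∈ O := ⟨hv₀, fun t ht => hno t (by simpa [hT] using ht)⟩
    obtain ⟨x₀, hx₀⟩ := hne
    obtain ⟨u, hu, y, hy, huy⟩ := exists_boundary_edge (hG v₀ x₀) hv₀O (fun h => h.1 hx₀)
    have hyS : y ∈ S := by
      by_contra hyS
      refine hy ⟨hyS, fun t ht h => hu.2 t ht (h.trans ?_)⟩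
      exact SimpleGraph.Adj.reachable ⟨huy.symm, hyS, hu.1⟩
    have huT : u ∉ T := fun h => hu.2 u h (SimpleGraph.Reachable.refl _)
    refine hcut y hyS u hu.1 huy.symm huT ?_
    have hclosed : ∀ x ∈ Side G a b (S : Set V), x ∈ Side G a b (insert u (S : Set V)) := by
      intro x hx
      refine side_induction hx ?_ ?_
      · intro p hp hpS
        refine side_start hp ?_
        rintro (rfl | h)
        · rcases hp with rfl | rfl
          · exact huT haT
          · exact huT hbT
        · exact hpS h
      · intro p q hp' hp hpq hq
        refine side_step hp hpq ?_
        rintro (rfl | h)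
        · obtain ⟨t, ht, _, htr⟩ := side_step hp' hpq hq
          refine hu.2 t ?_ htr
          rcases ht with rfl | rfl
          · exact haT
          · exact hbT
        · exact hq h
    rcases hcross with h | h
    · exact Or.inl (hclosed _ h)
    · exact Or.inr (hclosed _ h)
  · intro φ₀ hφ₀ hconst₀
    obtain ⟨x₀, hx₀⟩ := hne
    set φ : V → ℝ := fun v => φ₀ v - φ₀ x₀ with hφdef
    have hφ : IsFlow G a b c d φ := hφ₀.sub_const _
    suffices φ a = φ b ∧ φ c = φ d by
      simpa [hφdef] using this
    have hzero : ∀ x ∈ S, φ x = 0 := by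
      intro x hx
      refine reachable_induction (P := fun x => φ x = 0) (hconn x₀ hx₀ x hx) (by simp [hφdef]) ?_
      rintro u v hu ⟨huv, huS, -⟩
      simp only [Set.mem_compl_iff, not_not, Finset.mem_coe] at huS
      have := hconst₀ u huS v huv
      simp only [hφdef] at hu ⊢
      linarith
    have hzero' : ∀ x ∈ S, ∀ y, G.Adj x y → φ y = 0 := by
      intro x hx y hxy
      have h1 := hconst₀ x hx y hxy
      have h2 := hzero x hx
      simp only [hφdef] at h2 ⊢
      linarith
    set N : Set V := {v | v ∉ S ∧ v ∉ T ∧ ∃ x ∈ S, G.Adj x v} with hN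
    by_cases hNe : N.Nonempty
    · have hnot : ∀ t ∈ T, t ∉ (S : Set V) ∪ N := by
        rintro t ht (h | h)
        · exact hTS t ht h
        · exact h.2.1 ht
      have hcutN : ∀ v ∈ N, ¬ Crosses G a b c d (insert v (S : Set V)) := by
        rintro v ⟨hv, hvT, x, hx, hxv⟩
        exact hcut x hx v hv hxv hvT
      obtain ⟨v, hv⟩ := hNe
      have hXzero : ∀ x ∈ insert v (S : Set V), φ x = 0 := by
        rintro x (rfl | hx)
        · obtain ⟨-, -, y, hy, hyx⟩ := hv
          exact hzero' y hy x hyx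
        · exact hzero x hx
      have hnotX : ∀ t ∈ T, t ∉ insert v (S : Set V) := by
        rintro t ht (rfl | h)
        · exact hv.2.1 ht
        · exact hTS t ht h
      have hNcl : ∀ x ∈ (S : Set V), ∀ y ∉ (S : Set V), G.Adj x y →
          y ∈ N ∨ y = a ∨ y = b ∨ y = c ∨ y = d := by
        intro x hx y hy hxy
        by_cases hyT : y ∈ T
        · right; simpa [hT] using hyT
        · exact Or.inl ⟨hy, hyT, x, hx, hxy⟩
      constructor
      · obtain ⟨x, hx, hxa⟩ := exists_adj_of_cuts (hnot a haT) (hnot b hbT) (hnot c hcT)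
          (hnot d hdT) ⟨v, hv⟩ hNcl hcross hcutN hsep
        exact hφ.eq_of_cut hG hXzero (hcutN v hv) (hnotX a haT) (hnotX b hbT)
          (hxa.imp (hzero' x hx a) (hzero' x hx b)) hsep
      · obtain ⟨x, hx, hxa⟩ := exists_adj_of_cuts (hnot c hcT) (hnot d hdT) (hnot a haT)
          (hnot b hbT) ⟨v, hv⟩ (fun x hx y hy hxy => by have := hNcl x hx y hy hxy; tauto)
          hcross.symm (fun v hv h => hcutN v hv h.symm) (fun z => (hsep z).symm)
        exact hφ.symm.eq_of_cut hG hXzero (fun h => hcutN v hv h.symm) (hnotX c hcT)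
          (hnotX d hdT) (hxa.imp (hzero' x hx c) (hzero' x hx d)) fun z => (hsep z).symm
    · -- Here `S` is the whole component.
      have hSall : ∀ x ∈ C, x ∈ S := by
        intro x hx
        by_contra hxS
        have hx₀C := hSC x₀ hx₀
        have hr : (avoid G T).Reachable x₀ x := SimpleGraph.Reachable.trans hx₀C.symm hx
        obtain ⟨u, hu, v, hv, huv⟩ := exists_boundary_edge (U := (S : Set V)) hr hx₀ hxS
        exact hNe ⟨v, hv, huv.2.2, u, hu, huv.1⟩
      have hz : ∀ t, t = t₁ ∨ t = t₂ ∨ t = t₃ → φ t = 0 := by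
        intro t htt
        obtain ⟨-, x, hx, hxt⟩ := ht t htt
        exact hzero' x (hSall x hx) t hxt
      have hz1 := hz t₁ (Or.inl rfl)
      have hz2 := hz t₂ (Or.inr (Or.inl rfl))
      have hz3 := hz t₃ (Or.inr (Or.inr rfl))
      have ht1 : t₁ = a ∨ t₁ = b ∨ t₁ = c ∨ t₁ = d := by
        simpa [hT] using (ht t₁ (Or.inl rfl)).1
      have ht2 : t₂ = a ∨ t₂ = b ∨ t₂ = c ∨ t₂ = d := by
        simpa [hT] using (ht t₂ (Or.inr (Or.inl rfl))).1
      have ht3 : t₃ = a ∨ t₃ = b ∨ t₃ = c ∨ t₃ = d := by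
        simpa [hT] using (ht t₃ (Or.inr (Or.inr rfl))).1
      -- A terminal where the potential does not vanish differs from the three given ones.
      have hda : φ a = 0 := by
        by_contra hne
        have e1 : ∀ t, φ t = 0 → t ≠ a := fun t h h' => hne (h' ▸ h)
        have : φ b = 0 ∧ φ c = 0 ∧ φ d = 0 ∧ c ≠ b ∧ d ≠ b := by
          have n1 := e1 _ hz1
          have n2 := e1 _ hz2
          have n3 := e1 _ hz3
          clear_value T φ
          grind
        exact hne (hφ.symm.swap_right.eq_zero_of_three this.2.1 this.2.2.1 this.1 this.2.2.2.1
          this.2.2.2.2 (hsep b).symm.swap_right)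
      have hdb : φ b = 0 := by
        by_contra hne
        have e1 : ∀ t, φ t = 0 → t ≠ b := fun t h h' => hne (h' ▸ h)
        have : φ c = 0 ∧ φ d = 0 ∧ c ≠ a ∧ d ≠ a := by
          have n1 := e1 _ hz1
          have n2 := e1 _ hz2
          have n3 := e1 _ hz3
          clear_value T φ
          grind
        exact hne (hφ.symm.eq_zero_of_three this.1 this.2.1 hda this.2.2.1 this.2.2.2
          (hsep a).symm)
      have hdc : φ c = 0 := by
        by_contra hne
        have e1 : ∀ t, φ t = 0 → t ≠ c := fun t h h' => hne (h' ▸ h)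
        have : φ d = 0 ∧ a ≠ d ∧ b ≠ d := by
          have n1 := e1 _ hz1
          have n2 := e1 _ hz2
          have n3 := e1 _ hz3
          clear_value T φ
          grind
        exact hne (hφ.swap_right.eq_zero_of_three hda hdb this.1 this.2.1 this.2.2
          (hsep d).swap_right)
      have hdd : φ d = 0 := by
        by_contra hne
        have e1 : ∀ t, φ t = 0 → t ≠ d := fun t h h' => hne (h' ▸ h)
        have : a ≠ c ∧ b ≠ c := by
          have n1 := e1 _ hz1
          have n2 := e1 _ hz2
          have n3 := e1 _ hz3
          clear_value T φ
          grind
        exact hne (hφ.eq_zero_of_three hda hdb hdc this.1 this.2 (hsep c))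
      exact ⟨by rw [hda, hdb], by rw [hdc, hdd]⟩

end Separation

/-! ### Counting the edges of forests and trees -/

section Counting

variable {V : Type*}

theorem coe_edgeSet_subset (F : Finset (Sym2 V)) : (spanningGraph F).edgeSet ⊆ (F : Set (Sym2 V)) := by
  simp [spanningGraph]

theorem IsForest.edgeSet_eq {F : Finset (Sym2 V)} (h : IsForest F) :
    (spanningGraph F).edgeSet = (F : Set (Sym2 V)) := by
  rw [spanningGraph, SimpleGraph.edgeSet_fromEdgeSet, sdiff_eq_left, Set.disjoint_left]
  intro e he
  exact h.1 e he

theorem isForest_of_subset_edgeSet {G : SimpleGraph V} {F : Finset (Sym2 V)}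
    (hF : (F : Set (Sym2 V)) ⊆ G.edgeSet) (h : (spanningGraph F).IsAcyclic) : IsForest F :=
  ⟨fun _ he => G.not_isDiag_of_mem_edgeSet (hF he), h⟩

theorem IsForest.reachable_congr {F : Finset (Sym2 V)} (h : IsForest F) {x y z : V}
    (hxy : s(x, y) ∈ F) : (spanningGraph F).Reachable z x ↔ (spanningGraph F).Reachable z y := by
  have hadj : (spanningGraph F).Adj x y := spanningGraph_adj.2 ⟨hxy, fun he => h.1 _ hxy (by simp [he])⟩
  exact ⟨fun h => h.trans hadj.reachable, fun h => h.trans hadj.symm.reachable⟩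

/-- A set of edges inside `A` cannot be left by a walk that starts in `A`. -/
theorem mem_of_reachable {A : Set V} {F : Finset (Sym2 V)} (hF : ∀ e ∈ F, ∀ v ∈ e, v ∈ A) {u v : V}
    (hu : u ∈ A) (h : (spanningGraph F).Reachable u v) : v ∈ A :=
  reachable_induction (P := fun v => v ∈ A) h hu fun _ _ _ hxy =>
    hF _ (spanningGraph_adj.1 hxy).1 _ (Sym2.mem_mk_right _ _)

theorem TreeOn.insert_leaf {A : Finset V} {F : Finset (Sym2 V)} (h : TreeOn A F) {u v : V}
    (hu : u ∈ A) (hv : v ∉ A) : TreeOn (insert v A) (insert s(u, v) F) := by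
  have hn : s(u, v) ∉ F := fun hm => hv (h.1 _ hm v (Sym2.mem_mk_right _ _))
  refine ⟨?_, ?_, ?_⟩
  · intro e he x hx
    rcases Finset.mem_insert.1 he with rfl | he
    · rcases Sym2.mem_iff.1 hx with rfl | rfl
      · exact Finset.mem_insert_of_mem hu
      · exact Finset.mem_insert_self _ _
    · exact Finset.mem_insert_of_mem (h.1 e he x hx)
  · rw [Finset.card_insert_of_notMem hn, Finset.card_insert_of_notMem hv, h.2.1]
  · have hmono : spanningGraph F ≤ spanningGraph (insert s(u, v) F) :=
      spanningGraph_mono (Finset.subset_insert _ _)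
    have key : ∀ x ∈ insert v A, (spanningGraph (insert s(u, v) F)).Reachable u x := by
      intro x hx
      rcases Finset.mem_insert.1 hx with rfl | hx
      · exact SimpleGraph.Adj.reachable
          (spanningGraph_adj.2 ⟨Finset.mem_insert_self _ _, fun h => hv (h ▸ hu)⟩)
      · exact (h.2.2 u hu x hx).mono hmono
    exact fun x hx y hy => (key x hx).symm.trans (key y hy)

variable [Fintype V]

theorem IsForest.card_add_one_le [Nonempty V] {F : Finset (Sym2 V)} (h : IsForest F) :
    F.card + 1 ≤ Fintype.card V ∧
      (F.card + 1 = Fintype.card V → ∀ u v, (spanningGraph F).Reachable u v) := by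
  obtain ⟨T, hle, -, hT⟩ := (SimpleGraph.connected_top (V := V)).exists_isTree_le_of_le_of_isAcyclic
    le_top h.2
  have hcard := hT.card_edgeFinset
  have hsub : F ⊆ T.edgeFinset := by
    intro e he
    rw [SimpleGraph.mem_edgeFinset]
    exact SimpleGraph.edgeSet_mono hle (by rw [h.edgeSet_eq]; exact he)
  refine ⟨by have := Finset.card_le_card hsub; omega, fun hF u v => ?_⟩
  have heq : F = T.edgeFinset := Finset.eq_of_subset_of_card_le hsub (by omega)
  have : spanningGraph F = T := by
    rw [spanningGraph, heq, SimpleGraph.coe_edgeFinset, SimpleGraph.fromEdgeSet_edgeSet]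
  rw [this]
  exact hT.1.preconnected u v

theorem card_le_card_add_one {F : Finset (Sym2 V)}
    (h : ∀ u v, (spanningGraph F).Reachable u v) : Fintype.card V ≤ F.card + 1 := by
  cases isEmpty_or_nonempty V
  · simp
  have hc : (spanningGraph F).Connected := ⟨h⟩
  have h1 := hc.card_vert_le_card_edgeSet_add_one
  have h2 : Nat.card (spanningGraph F).edgeSet ≤ F.card := by
    rw [← Set.ncard_coe_finset, Nat.card_coe_set_eq]
    exact Set.ncard_le_ncard (coe_edgeSet_subset F) (Finset.finite_toSet F)
  rw [Nat.card_eq_fintype_card] at h1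
  omega

/-- The spanning trees of the whole vertex set are the forests with the largest possible number
of edges. -/
theorem treeOn_univ_iff [Nonempty V] {F : Finset (Sym2 V)} :
    TreeOn Finset.univ F ↔ IsForest F ∧ F.card + 1 = Fintype.card V := by
  constructor
  · rintro ⟨-, hcard, hr⟩
    rw [Finset.card_univ] at hcard
    have hc : (spanningGraph F).Connected :=
      ⟨fun u v => hr u (Finset.mem_univ _) v (Finset.mem_univ _)⟩
    have h1 := hc.card_vert_le_card_edgeSet_add_one
    have hsub := coe_edgeSet_subset F
    have heq : (spanningGraph F).edgeSet = (F : Set (Sym2 V)) := by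
      refine Set.eq_of_subset_of_ncard_le hsub ?_ (Finset.finite_toSet F)
      rw [Set.ncard_coe_finset, ← Nat.card_coe_set_eq]
      rw [Nat.card_eq_fintype_card] at h1
      omega
    refine ⟨⟨fun e he => ?_, ?_⟩, hcard⟩
    · have : e ∈ (spanningGraph F).edgeSet := by rw [heq]; exact he
      exact (spanningGraph F).not_isDiag_of_mem_edgeSet this
    · refine (SimpleGraph.isTree_iff_connected_and_card.2 ⟨hc, ?_⟩).2
      rw [Nat.card_coe_set_eq, heq, Set.ncard_coe_finset, Nat.card_eq_fintype_card, hcard]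
  · rintro ⟨hF, hcard⟩
    exact ⟨fun _ _ _ _ => Finset.mem_univ _, by rw [hcard, Finset.card_univ],
      fun u _ v _ => hF.card_add_one_le.2 hcard u v⟩

/-- An edge set that connects all of `A` has at least `A.card - 1` edges. -/
theorem card_le_of_reachable_on {A : Finset V} {F : Finset (Sym2 V)} {r : V} (hr : r ∈ A)
    (h : ∀ u ∈ A, (spanningGraph F).Reachable r u) : A.card ≤ F.card + 1 := by
  -- Attach every vertex outside `A` to `r`.
  set F' := F ∪ Aᶜ.image fun v => s(r, v) with hF'
  have hmono : spanningGraph F ≤ spanningGraph F' := spanningGraph_mono Finset.subset_union_left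
  have hall : ∀ v, (spanningGraph F').Reachable r v := by
    intro v
    by_cases hv : v ∈ A
    · exact (h v hv).mono hmono
    · refine SimpleGraph.Adj.reachable (spanningGraph_adj.2 ⟨?_, fun h => hv (h ▸ hr)⟩)
      refine Finset.mem_union_right _ (Finset.mem_image_of_mem _ (Finset.mem_compl.2 hv))
  have h1 := card_le_card_add_one fun u v => (hall u).symm.trans (hall v)
  have h2 : F'.card ≤ F.card + (Fintype.card V - A.card) := by
    refine (Finset.card_union_le _ _).trans (Nat.add_le_add_left ?_ _)
    exact Finset.card_image_le.trans (Finset.card_compl A).le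
  have h3 := Finset.card_le_univ A
  omega

/-- A connected vertex set has a spanning tree; it is found by adding one leaf at a time. -/
theorem exists_treeOn {G : SimpleGraph V} {S : Finset V} (hne : S.Nonempty)
    (h : ∀ x ∈ S, ∀ y ∈ S, (avoid G (S : Set V)ᶜ).Reachable x y) :
    ∃ F, TreeOn S F ∧ (F : Set (Sym2 V)) ⊆ G.edgeSet := by
  obtain ⟨x₀, hx₀⟩ := hne
  obtain ⟨A, hA, hmax⟩ := Finset.exists_max_image
    (Finset.univ.filter fun A : Finset V => A ⊆ S ∧ x₀ ∈ A ∧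
      ∃ F, TreeOn A F ∧ (F : Set (Sym2 V)) ⊆ G.edgeSet) Finset.card
    ⟨{x₀}, by
      simp only [Finset.mem_filter, Finset.mem_univ, true_and]
      refine ⟨by simpa using hx₀, by simp, ∅, ⟨by simp, by simp, ?_⟩, by simp⟩
      intro u hu v hv
      rw [Finset.mem_singleton.1 hu, Finset.mem_singleton.1 hv]⟩
  simp only [Finset.mem_filter, Finset.mem_univ, true_and] at hA hmax
  obtain ⟨hAS, hxA, F, hF, hFG⟩ := hA
  suffices A = S by subst this; exact ⟨F, hF, hFG⟩
  by_contra hAne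
  obtain ⟨y, hy, hyA⟩ : ∃ y ∈ S, y ∉ A := by
    by_contra! hcon
    exact hAne (Finset.Subset.antisymm hAS hcon)
  obtain ⟨u, hu, v, hv, huv⟩ := exists_boundary_edge (U := (A : Set V)) (h x₀ hx₀ y hy) hxA hyA
  have hvS : v ∈ S := by
    have := huv.2.2
    simpa using this
  have := hmax (insert v A) ⟨Finset.insert_subset hvS hAS, Finset.mem_insert_of_mem hxA,
    insert s(u, v) F, hF.insert_leaf hu hv, by
      rw [Finset.coe_insert, Set.insert_subset_iff]
      exact ⟨huv.1, hFG⟩⟩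
  rw [Finset.card_insert_of_notMem hv] at this
  omega

end Counting

/-! ### Forests with two components -/

section TwoComponents

variable {V : Type*} [Fintype V]

/-- A spanning tree of `S` and a spanning tree of the complement form a forest with two
components. Conversely, the forest becomes a spanning tree when an edge from `S` to `d` is added. -/
theorem two_component_iff {S : Finset V} {d : V} (hS : S.Nonempty) (hd : d ∉ S)
    {F₁ F₂ : Finset (Sym2 V)} (h₁ : ∀ e ∈ F₁, ∃ v ∈ e, v ∈ S) (h₂ : ∀ e ∈ F₂, ¬ ∃ v ∈ e, v ∈ S) :
    (IsForest (F₁ ∪ F₂) ∧ (F₁ ∪ F₂).card + 2 = Fintype.card V ∧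
      ∀ v, v ∈ S ↔ ¬ (spanningGraph (F₁ ∪ F₂)).Reachable d v) ↔ TreeOn S F₁ ∧ TreeOn Sᶜ F₂ := by
  have : Nonempty V := ⟨d⟩
  have hdisj : Disjoint F₁ F₂ := Finset.disjoint_left.2 fun e he he' => h₂ e he' (h₁ e he)
  have hcard : (F₁ ∪ F₂).card = F₁.card + F₂.card := Finset.card_union_of_disjoint hdisj
  have hcompl : S.card + Sᶜ.card = Fintype.card V := Finset.card_add_card_compl S
  have hin₂ : ∀ e ∈ F₂, ∀ v ∈ e, v ∈ Sᶜ := fun e he v hv =>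
    Finset.mem_compl.2 fun hvS => h₂ e he ⟨v, hv, hvS⟩
  obtain ⟨s, hs⟩ := hS
  constructor
  · rintro ⟨hF, hc, hSF⟩
    have hin₁ : ∀ e ∈ F₁, ∀ v ∈ e, v ∈ S := by
      intro e he v hv
      obtain ⟨u, hu, huS⟩ := h₁ e he
      by_cases huv : u = v
      · exact huv ▸ huS
      have he' : s(u, v) ∈ F₁ ∪ F₂ := by
        rw [← (Sym2.mem_and_mem_iff huv).1 ⟨hu, hv⟩]
        exact Finset.mem_union_left _ he
      rw [hSF] at huS ⊢
      rwa [← hF.reachable_congr he']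
    have hsd : ¬ (spanningGraph (F₁ ∪ F₂)).Reachable s d := fun h => (hSF s).1 hs h.symm
    have hn : s(s, d) ∉ F₁ ∪ F₂ := fun h => hsd (SimpleGraph.Adj.reachable (spanningGraph_adj.2
      ⟨h, fun h => hd (h ▸ hs)⟩))
    have hall := ((isForest_insert hn).2 ⟨hF, hsd⟩).card_add_one_le.2
      (by rw [Finset.card_insert_of_notMem hn]; omega)
    rw [spanningGraph_insert] at hall
    have hr₁ : ∀ v ∈ S, (spanningGraph F₁).Reachable s v := by
      intro v hv
      have hsv : (spanningGraph (F₁ ∪ F₂)).Reachable s v := by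
        rcases reachable_sup_edge.1 (hall s v) with h | ⟨-, h⟩ | ⟨-, h⟩
        · exact h
        · exact absurd h ((hSF v).1 hv)
        · exact h
      refine (reachable_induction (P := fun v => v ∈ S ∧ (spanningGraph F₁).Reachable s v) hsv
        ⟨hs, SimpleGraph.Reachable.refl _⟩ ?_).2
      rintro x y ⟨hx, hxr⟩ hxy
      obtain ⟨hxyF, hne⟩ := spanningGraph_adj.1 hxy
      rcases Finset.mem_union.1 hxyF with h | h
      · exact ⟨hin₁ _ h y (Sym2.mem_mk_right _ _),
          hxr.trans (SimpleGraph.Adj.reachable (spanningGraph_adj.2 ⟨h, hne⟩))⟩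
      · exact absurd ⟨x, Sym2.mem_mk_left _ _, hx⟩ (h₂ _ h)
    have hr₂ : ∀ v ∈ Sᶜ, (spanningGraph F₂).Reachable d v := by
      intro v hv
      have hdv : (spanningGraph (F₁ ∪ F₂)).Reachable d v := by
        by_contra h
        exact Finset.mem_compl.1 hv ((hSF v).2 h)
      refine (reachable_induction (P := fun v => v ∉ S ∧ (spanningGraph F₂).Reachable d v) hdv
        ⟨hd, SimpleGraph.Reachable.refl _⟩ ?_).2
      rintro x y ⟨hx, hxr⟩ hxy
      obtain ⟨hxyF, hne⟩ := spanningGraph_adj.1 hxy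
      rcases Finset.mem_union.1 hxyF with h | h
      · exact absurd (hin₁ _ h x (Sym2.mem_mk_left _ _)) hx
      · exact ⟨fun hy => h₂ _ h ⟨y, Sym2.mem_mk_right _ _, hy⟩,
          hxr.trans (SimpleGraph.Adj.reachable (spanningGraph_adj.2 ⟨h, hne⟩))⟩
    have c₁ := card_le_of_reachable_on hs hr₁
    have c₂ := card_le_of_reachable_on (Finset.mem_compl.2 hd) hr₂
    exact ⟨⟨hin₁, by omega, fun u hu v hv => (hr₁ u hu).symm.trans (hr₁ v hv)⟩,
      ⟨hin₂, by omega, fun u hu v hv => (hr₂ u hu).symm.trans (hr₂ v hv)⟩⟩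
  · rintro ⟨t₁, t₂⟩
    have hnot : ∀ v ∈ S, ¬ (spanningGraph (F₁ ∪ F₂)).Reachable d v := by
      intro v hv h
      refine reachable_induction (P := fun v => v ∉ S) h hd ?_ hv
      intro x y hx hxy
      rcases Finset.mem_union.1 (spanningGraph_adj.1 hxy).1 with h | h
      · exact absurd (t₁.1 _ h x (Sym2.mem_mk_left _ _)) hx
      · exact fun hy => h₂ _ h ⟨y, Sym2.mem_mk_right _ _, hy⟩
    have hn : s(s, d) ∉ F₁ ∪ F₂ := fun h => hnot s hs (SimpleGraph.Adj.reachable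
      (spanningGraph_adj.2 ⟨h, fun h => hd (h ▸ hs)⟩)).symm
    have hd₂ : ∀ v, v ∉ S → (spanningGraph (F₁ ∪ F₂)).Reachable d v := fun v hv =>
      (t₂.2.2 d (Finset.mem_compl.2 hd) v (Finset.mem_compl.2 hv)).mono
        (spanningGraph_mono Finset.subset_union_right)
    have htree : TreeOn Finset.univ (insert s(s, d) (F₁ ∪ F₂)) := by
      refine ⟨fun _ _ _ _ => Finset.mem_univ _, ?_, ?_⟩
      · have e₁ := t₁.2.1
        have e₂ := t₂.2.1
        rw [Finset.card_insert_of_notMem hn, Finset.card_univ]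
        omega
      · have key : ∀ v, (spanningGraph (insert s(s, d) (F₁ ∪ F₂))).Reachable d v := by
          intro v
          rw [spanningGraph_insert, reachable_sup_edge]
          by_cases hv : v ∈ S
          · exact Or.inr (Or.inr ⟨SimpleGraph.Reachable.refl _, (t₁.2.2 s hs v hv).mono
              (spanningGraph_mono Finset.subset_union_left)⟩)
          · exact Or.inl (hd₂ v hv)
        exact fun u _ v _ => (key u).symm.trans (key v)
    refine ⟨(treeOn_univ_iff.1 htree).1.subset (Finset.subset_insert _ _), ?_, fun v => ?_⟩
    · have e₁ := t₁.2.1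
      have e₂ := t₂.2.1
      omega
    · by_cases hv : v ∈ S
      · simp [hv, hnot v hv]
      · simp [hv, hd₂ v hv]

/-- All four terminals lie in one component. -/
def Joins (a b c d : V) (F : Finset (Sym2 V)) : Prop :=
  (spanningGraph F).Reachable d a ∧ (spanningGraph F).Reachable d b ∧
    (spanningGraph F).Reachable d c

/-- The forests in which all four terminals lie in one component. -/
def JoinForest (a b c d : V) (F : Finset (Sym2 V)) : Prop := IsForest F ∧ Joins a b c d F

/-- The forests with two components such that one contains all terminals are classified by the
vertex set of the other component. -/
theorem weightSum_two_components (a b c d : V) (w : Sym2 V → ℝ) :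
    weightSum (fun F => JoinForest a b c d F ∧ F.card + 2 = Fintype.card V) w =
      ∑ S with S.Nonempty ∧ a ∉ S ∧ b ∉ S ∧ c ∉ S ∧ d ∉ S,
        weightSum (TreeOn S) w * weightSum (TreeOn Sᶜ) w := by
  have : Nonempty V := ⟨d⟩
  set cut : Finset (Sym2 V) → Finset V := fun F =>
    Finset.univ.filter fun v => ¬ (spanningGraph F).Reachable d v with hcut
  have hmem : ∀ F S, cut F = S ↔ ∀ v, v ∈ S ↔ ¬ (spanningGraph F).Reachable d v := by
    intro F S
    rw [hcut, Finset.ext_iff]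
    simp only [Finset.mem_filter, Finset.mem_univ, true_and]
    exact ⟨fun h v => (h v).symm, fun h v => (h v).symm⟩
  unfold weightSum
  rw [← Finset.sum_fiberwise_of_maps_to (g := cut) (t := Finset.univ.filter fun S : Finset V =>
    S.Nonempty ∧ a ∉ S ∧ b ∉ S ∧ c ∉ S ∧ d ∉ S)]
  · refine Finset.sum_congr rfl fun S hS => ?_
    simp only [Finset.mem_filter, Finset.mem_univ, true_and] at hS
    obtain ⟨hne, haS, hbS, hcS, hdS⟩ := hS
    rw [Finset.filter_filter]
    trans weightSum (fun F => (JoinForest a b c d F ∧ F.card + 2 = Fintype.card V) ∧ cut F = S) w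
    · unfold weightSum
      exact Finset.sum_congr (by ext F; simp) fun _ _ => rfl
    rw [weightSum_split (fun e => ∃ v ∈ e, v ∈ S), Finset.sum_mul_sum]
    simp only [Finset.sum_filter]
    refine Finset.sum_congr rfl fun F₁ _ => ?_
    by_cases h₁ : ∀ e ∈ F₁, ∃ v ∈ e, v ∈ S
    swap
    · rw [if_neg h₁, if_neg]
      intro ht
      refine h₁ fun e he => ?_
      exact ⟨_, Sym2.out_fst_mem e, ht.1 e he _ (Sym2.out_fst_mem e)⟩
    rw [if_pos h₁]
    trans ∑ F₂, if TreeOn S F₁ then if TreeOn Sᶜ F₂ then (∏ e ∈ F₁, w e) * ∏ e ∈ F₂, w e else 0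
      else 0
    swap
    · by_cases ht : TreeOn S F₁
      · simp only [if_pos ht]
      · simp only [if_neg ht, Finset.sum_const_zero]
    refine Finset.sum_congr rfl fun F₂ _ => ?_
    by_cases h₂ : ∀ e ∈ F₂, ¬ ∃ v ∈ e, v ∈ S
    swap
    · rw [if_neg h₂]
      have : ¬ TreeOn Sᶜ F₂ := fun ht => h₂ fun e he ⟨v, hv, hvS⟩ =>
        Finset.mem_compl.1 (ht.1 e he v hv) hvS
      simp [this]
    rw [if_pos h₂]
    have hiff := two_component_iff hne hdS h₁ h₂
    have hP : ((JoinForest a b c d (F₁ ∪ F₂) ∧ (F₁ ∪ F₂).card + 2 = Fintype.card V) ∧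
        cut (F₁ ∪ F₂) = S) ↔ TreeOn S F₁ ∧ TreeOn Sᶜ F₂ := by
      rw [← hiff, hmem]
      constructor
      · rintro ⟨⟨hJ, hc⟩, hS⟩
        exact ⟨hJ.1, hc, hS⟩
      · rintro ⟨hF, hc, hS⟩
        have hr : ∀ v, v ∉ S → (spanningGraph (F₁ ∪ F₂)).Reachable d v := fun v hv => by
          by_contra h
          exact hv ((hS v).2 h)
        exact ⟨⟨⟨hF, hr a haS, hr b hbS, hr c hcS⟩, hc⟩, hS⟩
    by_cases ht₁ : TreeOn S F₁ <;> by_cases ht₂ : TreeOn Sᶜ F₂ <;> simp [hP, ht₁, ht₂]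
  · intro F hF
    simp only [Finset.mem_filter, Finset.mem_univ, true_and] at hF ⊢
    obtain ⟨⟨hF, ha, hb, hc⟩, hcard⟩ := hF
    refine ⟨?_, by simp [hcut, ha], by simp [hcut, hb], by simp [hcut, hc], by simp [hcut]⟩
    by_contra hne
    rw [Finset.not_nonempty_iff_eq_empty, hmem] at hne
    have hall : ∀ v, (spanningGraph F).Reachable d v := fun v => by
      by_contra h
      exact absurd ((hne v).2 h) (Finset.notMem_empty v)
    have := card_le_card_add_one fun u v => (hall u).symm.trans (hall v)
    omega

end TwoComponents

/-! ### Expansion for large parameters -/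

section Expansion

variable {V : Type*}

/-- Responses only depend on perturbations along edges between terminals. -/
theorem response_congr {f g : (Sym2 V → ℝ) → ℝ} {a b c d : V} {w w' : Sym2 V → ℝ}
    (h : ∀ δ : Sym2 V → ℝ, (∀ e, δ e ≠ 0 → ∀ v ∈ e, v = a ∨ v = b ∨ v = c ∨ v = d) →
      f (w + δ) = g (w' + δ)) : response f a b c d w = response g a b c d w' := by
  have hb : ∀ x y : V, (x = a ∨ x = b ∨ x = c ∨ x = d) → (y = a ∨ y = b ∨ y = c ∨ y = d) →
      ∀ e, bond x y e ≠ 0 → ∀ v ∈ e, v = a ∨ v = b ∨ v = c ∨ v = d := by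
    intro x y hx hy e he v hv
    have : e = s(x, y) := by
      by_contra hne
      exact he (by simp [bond, hne])
    subst this
    rcases Sym2.mem_iff.1 hv with rfl | rfl <;> assumption
  have h0 : f w = g w' := by simpa using h 0 (by simp)
  have h2 : f (w + bond a b + bond c d) = g (w' + bond a b + bond c d) := by
    rw [add_assoc, add_assoc]
    refine h _ fun e he => ?_
    by_cases h1 : bond a b e = 0
    · exact hb c d (by simp) (by simp) e (by simpa [h1] using he)
    · exact hb a b (by simp) (by simp) e h1
  simp only [response, h0, h2, h _ (hb a b (by simp) (by simp)), h _ (hb c d (by simp) (by simp)),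
    h _ (hb a c (by simp) (by simp)), h _ (hb b d (by simp) (by simp)),
    h _ (hb a d (by simp) (by simp)), h _ (hb b c (by simp) (by simp))]

theorem response_const_mul (k : ℝ) (f : (Sym2 V → ℝ) → ℝ) (a b c d : V) (w : Sym2 V → ℝ) :
    response (fun w => k * f w) a b c d w = k • response f a b c d w := by
  ext i
  fin_cases i <;> simp [response] <;> ring

theorem response_sum {ι : Type*} (s : Finset ι) (f : ι → (Sym2 V → ℝ) → ℝ) (a b c d : V)
    (w : Sym2 V → ℝ) :
    response (fun w => ∑ i ∈ s, f i w) a b c d w = ∑ i ∈ s, response (f i) a b c d w := by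
  ext i
  rw [Finset.sum_apply]
  fin_cases i <;>
    simp [response, Finset.sum_add_distrib, Finset.sum_sub_distrib, ← Finset.sum_div]

theorem pair_smul_self (k : ℝ) (x : Fin 5 → ℝ) : pair (k • x) (k • x) = k ^ 2 * pair x x := by
  simp [pair]
  ring

theorem pair_sum_right {ι : Type*} (x : Fin 5 → ℝ) (s : Finset ι) (k : ι → ℝ) (y : ι → Fin 5 → ℝ) :
    pair x (∑ i ∈ s, k i • y i) = ∑ i ∈ s, k i * pair x (y i) := by
  induction s using Finset.induction_on with
  | empty => simp [pair]
  | insert i s hi ih =>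
    rw [Finset.sum_insert hi, Finset.sum_insert hi, ← ih]
    simp [pair]
    ring

variable [Fintype V]

theorem response_weightSum (P : Finset (Sym2 V) → Prop) (a b c d : V) (w : Sym2 V → ℝ) :
    response (weightSum P) a b c d w =
      ![weightSum P w, weightSum (Link s(a, b) P) w, weightSum (Link s(c, d) P) w,
        (weightSum (Link s(a, c) P) w + weightSum (Link s(b, d) P) w -
          weightSum (Link s(a, d) P) w - weightSum (Link s(b, c) P) w) / 2,
        weightSum (Link s(a, b) (Link s(c, d) P)) w] := by
  simp only [response, bond, weightSum_add_single]
  ext i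
  fin_cases i <;> simp <;> ring

/-- Rescaling of the weights by `t` multiplies first differences by `t` and second differences
by `t ^ 2`, so that the quadratic form gets the factor `t ^ 2`. -/
theorem pair_response_smul (P : Finset (Sym2 V) → Prop) (a b c d : V) (w : Sym2 V → ℝ) (t : ℝ) :
    pair (response (fun w => weightSum P (t • w)) a b c d w)
        (response (fun w => weightSum P (t • w)) a b c d w) =
      t ^ 2 * pair (response (weightSum P) a b c d (t • w))
        (response (weightSum P) a b c d (t • w)) := by
  have hs : ∀ x y : V, t • bond x y = Pi.single s(x, y) t := by
    intro x y
    ext e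
    simp [bond, Pi.single_apply]
  have hr : response (fun w => weightSum P (t • w)) a b c d w =
      ![weightSum P (t • w), t * weightSum (Link s(a, b) P) (t • w),
        t * weightSum (Link s(c, d) P) (t • w),
        t * ((weightSum (Link s(a, c) P) (t • w) + weightSum (Link s(b, d) P) (t • w) -
          weightSum (Link s(a, d) P) (t • w) - weightSum (Link s(b, c) P) (t • w)) / 2),
        t ^ 2 * weightSum (Link s(a, b) (Link s(c, d) P)) (t • w)] := by
    simp only [response, smul_add, hs, weightSum_add_single]
    ext i
    fin_cases i <;> simp <;> ring
  rw [hr, response_weightSum]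
  simp [pair]
  ring

/-- The sum over the forests joining all terminals, in which a forest gets a factor `ε` for every
edge that it lacks in comparison with a spanning tree. -/
noncomputable def deficitSum (a b c d : V) (ε : ℝ) (w : Sym2 V → ℝ) : ℝ :=
  ∑ F with JoinForest a b c d F, ε ^ (Fintype.card V - 1 - F.card) * ∏ e ∈ F, w e

/-- Up to a power of the parameter, the weighted sum for large `t` is the polynomial `deficitSum`
near `0`. -/
theorem deficitSum_eq (a b c d : V) {t : ℝ} (ht : t ≠ 0) (w : Sym2 V → ℝ) :
    deficitSum a b c d t⁻¹ w =
      t⁻¹ ^ (Fintype.card V - 1) * weightSum (JoinForest a b c d) (t • w) := by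
  have : Nonempty V := ⟨d⟩
  rw [deficitSum, weightSum, Finset.mul_sum]
  refine Finset.sum_congr rfl fun F hF => ?_
  simp only [Finset.mem_filter, Finset.mem_univ, true_and] at hF
  have hle := hF.1.card_add_one_le.1
  simp only [Pi.smul_apply, smul_eq_mul, Finset.prod_mul_distrib, Finset.prod_const]
  have hp : t⁻¹ ^ (Fintype.card V - 1) = t⁻¹ ^ (Fintype.card V - 1 - F.card) * t⁻¹ ^ F.card := by
    rw [← pow_add]
    congr 1
    omega
  rw [hp, mul_assoc, ← mul_assoc (t⁻¹ ^ F.card), ← mul_pow, inv_mul_cancel₀ ht, one_pow, one_mul]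

theorem hasDerivAt_deficitSum (a b c d : V) (w : Sym2 V → ℝ) :
    HasDerivAt (fun ε => deficitSum a b c d ε w)
      (weightSum (fun F => JoinForest a b c d F ∧ F.card + 2 = Fintype.card V) w) 0 := by
  have : Nonempty V := ⟨d⟩
  have h : HasDerivAt (fun ε : ℝ => deficitSum a b c d ε w)
      (∑ F with JoinForest a b c d F, (((Fintype.card V - 1 - F.card : ℕ) : ℝ) *
        0 ^ (Fintype.card V - 1 - F.card - 1)) * ∏ e ∈ F, w e) 0 :=
    HasDerivAt.fun_sum fun F _ => (hasDerivAt_pow _ _).mul_const _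
  convert h using 1
  rw [weightSum, Finset.sum_filter, Finset.sum_filter]
  refine Finset.sum_congr rfl fun F _ => ?_
  by_cases hF : JoinForest a b c d F
  · have hle := hF.1.card_add_one_le.1
    by_cases hc : F.card + 2 = Fintype.card V
    · rw [if_pos ⟨hF, hc⟩, if_pos hF, show Fintype.card V - 1 - F.card = 1 by omega]
      simp
    · rw [if_neg fun h => hc h.2, if_pos hF]
      rcases Nat.eq_zero_or_pos (Fintype.card V - 1 - F.card) with h0 | h0
      · simp [h0]
      · rw [zero_pow (by omega)]
        simp
  · rw [if_neg fun h => hF h.1, if_neg hF]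

theorem deficitSum_zero (a b c d : V) (w : Sym2 V → ℝ) :
    deficitSum a b c d 0 w = weightSum (TreeOn Finset.univ) w := by
  have : Nonempty V := ⟨d⟩
  rw [deficitSum, weightSum, Finset.sum_filter, Finset.sum_filter]
  refine Finset.sum_congr rfl fun F _ => ?_
  by_cases hT : TreeOn Finset.univ F
  · have hF := treeOn_univ_iff.1 hT
    have hr : ∀ v, (spanningGraph F).Reachable d v := fun v =>
      hT.2.2 d (Finset.mem_univ _) v (Finset.mem_univ _)
    rw [if_pos ⟨hF.1, hr a, hr b, hr c⟩, if_pos hT,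
      show Fintype.card V - 1 - F.card = 0 by omega, pow_zero, one_mul]
  · rw [if_neg hT]
    split_ifs with hJ
    · have hle := hJ.1.card_add_one_le.1
      have : F.card + 1 ≠ Fintype.card V := fun h => hT (treeOn_univ_iff.2 ⟨hJ.1, h⟩)
      rw [zero_pow (by omega), zero_mul]
    · rfl

/-- The leading order of the quadratic form vanishes because it only sees spanning trees; the
next order, if positive, decides the sign for large parameters. -/
theorem eventually_pair_pos {a b c d : V} (hac : a ≠ c) (had : a ≠ d) (hcd : c ≠ d) (hab : a ≠ b)
    {w : Sym2 V → ℝ} (hw : ∀ e, 0 ≤ w e)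
    (h : 0 < pair (response (weightSum (TreeOn Finset.univ)) a b c d w)
      (response (weightSum fun F => JoinForest a b c d F ∧ F.card + 2 = Fintype.card V) a b c d w)) :
    ∀ᶠ t : ℝ in Filter.atTop, 0 < pair (response (weightSum (JoinForest a b c d)) a b c d (t • w))
      (response (weightSum (JoinForest a b c d)) a b c d (t • w)) := by
  set X₀ := response (weightSum (TreeOn Finset.univ)) a b c d w with hX₀
  set X₁ := response (weightSum fun F => JoinForest a b c d F ∧ F.card + 2 = Fintype.card V)
    a b c d w with hX₁
  set x : ℝ → Fin 5 → ℝ := fun ε => response (deficitSum a b c d ε) a b c d w with hx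
  have hx0 : x 0 = X₀ := by
    have : deficitSum a b c d 0 = weightSum (TreeOn Finset.univ) := funext (deficitSum_zero a b c d)
    rw [hx, hX₀, ← this]
  have hD := hasDerivAt_deficitSum a b c d
  have hderiv : ∀ i, HasDerivAt (fun ε => x ε i) (X₁ i) 0 := by
    intro i
    fin_cases i
    · exact hD _
    · exact (hD _).sub (hD _)
    · exact (hD _).sub (hD _)
    · exact ((((hD _).add (hD _)).sub (hD _)).sub (hD _)).div_const 2
    · exact (((hD _).sub (hD _)).sub (hD _)).add (hD _)
  have hg : HasDerivAt (fun ε => pair (x ε) (x ε)) (2 * pair X₀ X₁) 0 := by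
    have h1 := ((((hderiv 0).mul (hderiv 4)).add ((hderiv 0).mul (hderiv 4))).add
      (((hderiv 3).mul (hderiv 3)).const_mul 2)).sub ((hderiv 1).mul (hderiv 2)) |>.sub
      ((hderiv 1).mul (hderiv 2))
    refine h1.congr_deriv ?_
    simp only [hx0, pair]
    ring
  have hg0 : pair (x 0) (x 0) = 0 := by
    rw [hx0]
    exact pair_treeOn_self hac had hcd hab (Finset.mem_univ _) (Finset.mem_univ _)
      (Finset.mem_univ _) (Finset.mem_univ _) hw
  have hpos : ∀ᶠ ε : ℝ in nhdsWithin 0 (Set.Ioi 0), 0 < pair (x ε) (x ε) := by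
    have hs := (hasDerivAt_iff_tendsto_slope.1 hg).eventually (lt_mem_nhds (by linarith))
    filter_upwards [nhdsWithin_mono 0 (fun y hy => ne_of_gt hy) hs, self_mem_nhdsWithin] with ε h1 h2
    rw [slope_def_field, hg0, sub_zero, sub_zero] at h1
    have h2 : 0 < ε := h2
    exact (div_pos_iff_of_pos_right h2).1 h1
  filter_upwards [tendsto_inv_atTop_nhdsGT_zero.eventually hpos, Filter.eventually_gt_atTop 0]
    with t ht ht0
  have hfun : deficitSum a b c d t⁻¹ = fun w => t⁻¹ ^ (Fintype.card V - 1) *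
      (fun w => weightSum (JoinForest a b c d) (t • w)) w :=
    funext (deficitSum_eq a b c d ht0.ne')
  simp only [hx] at ht
  rw [hfun] at ht
  rw [response_const_mul (t⁻¹ ^ (Fintype.card V - 1))
    (fun w => weightSum (JoinForest a b c d) (t • w)), pair_smul_self, pair_response_smul] at ht
  exact pos_of_mul_pos_right (pos_of_mul_pos_right ht (by positivity)) (by positivity)

/-- The next order is a nonnegative combination of the gaps between the tree sum of all vertices
and the tree sums of the complements of `S`. -/
theorem pair_two_components_pos {a b c d : V} (hac : a ≠ c) (had : a ≠ d) (hcd : c ≠ d)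
    (hab : a ≠ b) {w : Sym2 V → ℝ} (hw : ∀ e, 0 ≤ w e) {S : Finset V} (hS : S.Nonempty)
    (hT : a ∉ S ∧ b ∉ S ∧ c ∉ S ∧ d ∉ S) (hpos : 0 < weightSum (TreeOn S) w)
    (h : 0 < pair (response (weightSum (TreeOn Finset.univ)) a b c d w)
      (response (weightSum (TreeOn Sᶜ)) a b c d w)) :
    0 < pair (response (weightSum (TreeOn Finset.univ)) a b c d w)
      (response (weightSum fun F => JoinForest a b c d F ∧ F.card + 2 = Fintype.card V)
        a b c d w) := by
  have hsum : response (weightSum fun F => JoinForest a b c d F ∧ F.card + 2 = Fintype.card V)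
      a b c d w = ∑ S with S.Nonempty ∧ a ∉ S ∧ b ∉ S ∧ c ∉ S ∧ d ∉ S,
        weightSum (TreeOn S) w • response (weightSum (TreeOn Sᶜ)) a b c d w := by
    simp only [← response_const_mul]
    rw [← response_sum]
    refine response_congr fun δ hδ => ?_
    rw [weightSum_two_components]
    refine Finset.sum_congr rfl fun S hS => ?_
    simp only [Finset.mem_filter, Finset.mem_univ, true_and] at hS
    obtain ⟨-, ha, hb, hc, hd⟩ := hS
    congr 1
    unfold weightSum
    refine Finset.sum_congr rfl fun F hF => Finset.prod_congr rfl fun e he => ?_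
    simp only [Finset.mem_filter, Finset.mem_univ, true_and] at hF
    have : δ e = 0 := by
      by_contra hne
      have hmem := hF.1 e he _ (Sym2.out_fst_mem e)
      rcases hδ e hne _ (Sym2.out_fst_mem e) with h | h | h | h <;> rw [h] at hmem <;>
        contradiction
    rw [Pi.add_apply, this, add_zero]
  rw [hsum, pair_sum_right]
  have hnn : ∀ S, 0 ≤ weightSum (TreeOn S) w := fun S =>
    Finset.sum_nonneg fun F _ => Finset.prod_nonneg fun e _ => hw e
  refine Finset.sum_pos' (fun S' hS' => ?_) ⟨S, ?_, mul_pos hpos h⟩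
  · simp only [Finset.mem_filter, Finset.mem_univ, true_and] at hS'
    obtain ⟨-, ha, hb, hc, hd⟩ := hS'
    exact mul_nonneg (hnn S') (pair_treeOn_nonneg hac had hcd hab (Finset.subset_univ _)
      (Finset.mem_compl.2 ha) (Finset.mem_compl.2 hb) (Finset.mem_compl.2 hc)
      (Finset.mem_compl.2 hd) hw)
  · simp only [Finset.mem_filter, Finset.mem_univ, true_and]
    exact ⟨hS, hT⟩

end Expansion

/-! ### Strict positivity from a rigid set -/

section Rigid

variable {V : Type*} {G : SimpleGraph V} {a b c d : V}

/-- The indicator function of the edge set of a graph. -/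
noncomputable def edgeWeight (G : SimpleGraph V) (e : Sym2 V) : ℝ :=
  if e ∈ G.edgeSet then 1 else 0

theorem edgeWeight_nonneg (G : SimpleGraph V) (e : Sym2 V) : 0 ≤ edgeWeight G e := by
  unfold edgeWeight
  split_ifs <;> norm_num

theorem edgeWeight_adj {u v : V} (h : G.Adj u v) : edgeWeight G s(u, v) = 1 :=
  if_pos h

theorem adj_of_edgeWeight_ne_zero {u v : V} (h : edgeWeight G s(u, v) ≠ 0) : G.Adj u v := by
  by_contra hn
  exact h (if_neg hn)

theorem edgeDiff_mul_edgeDiff (ψ φ : V → ℝ) (u v : V) :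
    edgeDiff ψ s(u, v) * edgeDiff φ s(u, v) = (ψ u - ψ v) * (φ u - φ v) := by
  unfold edgeDiff
  rcases out_mk u v with ⟨h1, h2⟩ | ⟨h1, h2⟩ <;> rw [h1, h2]
  ring

theorem edgeDiff_mk_eq_zero {φ : V → ℝ} {u v : V} (h : edgeDiff φ s(u, v) = 0) : φ u = φ v :=
  edgeDiff_eq_zero.1 h u (Sym2.mem_mk_left _ _) v (Sym2.mem_mk_right _ _)

variable [Fintype V]

/-- Testing with the indicator function of a vertex set shows that potentials are flows. -/
theorem isFlow_of_orthogonal {φ : V → ℝ}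
    (h : ∀ ψ : V → ℝ, ψ a = ψ b → ψ c = ψ d →
      ∑ e, inside Finset.univ (edgeWeight G) e * edgeDiff ψ e * edgeDiff φ e = 0) :
    IsFlow G a b c d φ := by
  intro U h1 h2 hle u hu v hv huv
  set ψ : V → ℝ := fun x => if x ∈ U then 1 else 0 with hψ
  have hsum := h ψ (by simp [hψ, h1]) (by simp [hψ, h2])
  have hnn : ∀ e ∈ Finset.univ,
      0 ≤ inside Finset.univ (edgeWeight G) e * edgeDiff ψ e * edgeDiff φ e := by
    intro e _
    induction e using Sym2.ind with
    | _ x y =>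
      rw [mul_assoc, edgeDiff_mul_edgeDiff]
      by_cases hxy : inside Finset.univ (edgeWeight G) s(x, y) = 0
      · rw [hxy, zero_mul]
      have hadj := adj_of_edgeWeight_ne_zero (inside_ne_zero hxy).2
      refine mul_nonneg (inside_nonneg (edgeWeight_nonneg G) _) ?_
      by_cases hx : x ∈ U <;> by_cases hy : y ∈ U
      · simp [hψ, hx, hy]
      · have := hle x hx y hy hadj
        simpa [hψ, hx, hy] using this
      · have := hle y hy x hx hadj.symm
        simpa [hψ, hx, hy] using this
      · simp [hψ, hx, hy]
  have := (Finset.sum_eq_zero_iff_of_nonneg hnn).1 hsum s(u, v) (Finset.mem_univ _)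
  rw [mul_assoc, edgeDiff_mul_edgeDiff] at this
  simp only [inside, Finset.mem_univ, implies_true, if_true, edgeWeight_adj huv, hψ, hu, hv,
    if_false, sub_zero, one_mul] at this
  exact sub_eq_zero.1 this

theorem IsRigid.eventually_pair_pos (hac : a ≠ c) (had : a ≠ d) (hcd : c ≠ d) (hab : a ≠ b)
    (hG : G.Preconnected) {S : Finset V} (hS : IsRigid G a b c d S) :
    ∀ᶠ t : ℝ in Filter.atTop,
      0 < pair (response (weightSum (JoinForest a b c d)) a b c d (t • edgeWeight G))
        (response (weightSum (JoinForest a b c d)) a b c d (t • edgeWeight G)) := by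
  have hw := edgeWeight_nonneg G
  obtain ⟨ha, hb, hc, hd⟩ := hS.notMem
  refine ArborealGas.eventually_pair_pos hac had hcd hab hw
    (pair_two_components_pos hac had hcd hab hw hS.nonempty hS.notMem ?_ ?_)
  · obtain ⟨F, hF, hFG⟩ := exists_treeOn hS.nonempty hS.connected
    refine Finset.sum_pos' (fun F _ => Finset.prod_nonneg fun e _ => hw e) ⟨F, by simp [hF], ?_⟩
    refine Finset.prod_pos fun e he => ?_
    rw [edgeWeight, if_pos (hFG he)]
    norm_num
  refine pair_treeOn_pos hac had hcd hab (Finset.subset_univ _) (Finset.mem_compl.2 ha)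
    (Finset.mem_compl.2 hb) (Finset.mem_compl.2 hc) (Finset.mem_compl.2 hd) hw ?_ ?_ ?_
  · refine innerLap_det_ne_zero hac had hcd hab hw fun φ _ _ hφ v _ => ?_
    refine reachable_induction (P := fun v => φ v = φ d) (hG d v) rfl fun u v hu huv => ?_
    rw [← hu]
    refine (edgeDiff_mk_eq_zero (hφ s(u, v) ?_)).symm
    simp [inside, edgeWeight_adj huv]
  · refine innerLap_det_ne_zero hac had hcd hab hw fun φ hab' hcd' hφ v hv => ?_
    have hconst : ∀ p r, (avoid G (S : Set V)).Reachable p r → φ r = φ p := by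
      intro p r hpr
      refine reachable_induction (P := fun v => φ v = φ p) hpr rfl fun u v hu huv => ?_
      rw [← hu]
      refine (edgeDiff_mk_eq_zero (hφ s(u, v) ?_)).symm
      have : ∀ x ∈ s(u, v), x ∈ Sᶜ := by
        intro x hx
        rcases Sym2.mem_iff.1 hx with rfl | rfl
        · exact Finset.mem_compl.2 huv.2.1
        · exact Finset.mem_compl.2 huv.2.2
      rw [inside, if_pos this, edgeWeight_adj huv.1]
      norm_num
    have hside : ∀ x ∈ Side G a b (S : Set V), φ x = φ a := by
      rintro x ⟨p, rfl | rfl, -, hr⟩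
      · exact hconst _ _ hr
      · rw [hconst _ _ hr, hab']
    have had' : φ a = φ d := by
      rcases hS.crosses with h | h
      · rw [← hside c h, hcd']
      · rw [← hside d h]
    obtain ⟨t, ht, hr⟩ := hS.reachable v (Finset.mem_compl.1 hv)
    rw [hconst _ _ hr]
    rcases ht with rfl | rfl | rfl | rfl
    · exact had'
    · rw [← hab', had']
    · exact hcd'
    · rfl
  · intro φ horth hφ
    refine hS.const φ (isFlow_of_orthogonal horth) fun x hx y hxy => ?_
    refine edgeDiff_mk_eq_zero (hφ _ ?_)
    have : ¬ ∀ v ∈ s(x, y), v ∈ Sᶜ := fun h =>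
      Finset.mem_compl.1 (h x (Sym2.mem_mk_left _ _)) hx
    simp [inside, edgeWeight_adj hxy]
    exact fun h => absurd hx h

end Rigid

/-! ### Elimination of a part attached at two vertices -/

section Elimination

variable {V : Type*}

/-- The part `F₁` of a forest that lies on a piece without terminals, attached at `x` and `y`, acts
on the rest of the forest like the presence or absence of the edge `xy`. -/
theorem joinForest_union_iff {C : Set V} {a b c d x y : V} (hxy : x ≠ y)
    (ha : a ∉ C) (hb : b ∉ C) (hc : c ∉ C) (hd : d ∉ C) {F₁ F₂ : Finset (Sym2 V)}
    (h₁ : ∀ e ∈ F₁, (∃ v ∈ e, v ∈ C) ∧ ∀ v ∈ e, v ∈ C ∨ v = x ∨ v = y)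
    (h₂ : ∀ e ∈ F₂, ¬ ∃ v ∈ e, v ∈ C) :
    JoinForest a b c d (F₁ ∪ F₂) ↔ IsForest F₁ ∧
      ((¬ (spanningGraph F₁).Reachable x y ∧ JoinForest a b c d F₂) ∨
        ((spanningGraph F₁).Reachable x y ∧ Link s(x, y) (JoinForest a b c d) F₂)) := by
  have g₁ : ∀ u v, (spanningGraph F₁).Adj u v → u ∈ C ∪ {x, y} := fun u v huv => by
    rcases (h₁ _ (spanningGraph_adj.1 huv).1).2 u (Sym2.mem_mk_left _ _) with h | h | h
    · exact Or.inl h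
    · exact Or.inr (Or.inl h)
    · exact Or.inr (Or.inr h)
  have g₂ : ∀ u v, (spanningGraph F₂).Adj u v → u ∈ Cᶜ := fun u v huv hu =>
    h₂ _ (spanningGraph_adj.1 huv).1 ⟨u, Sym2.mem_mk_left _ _, hu⟩
  have hA : ∀ v ∈ C ∪ {x, y}, v ∈ Cᶜ → v = x ∨ v = y := by
    rintro v (h | h) h'
    · exact absurd h h'
    · exact h
  have hdisj : ∀ u v, (spanningGraph F₁).Adj u v → ¬ (spanningGraph F₂).Adj u v := fun u v h h' =>
    h₂ _ (spanningGraph_adj.1 h').1 (h₁ _ (spanningGraph_adj.1 h).1).1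
  have hforest : IsForest (F₁ ∪ F₂) ↔ IsForest F₁ ∧ IsForest F₂ ∧
      ¬ ((spanningGraph F₁).Reachable x y ∧ (spanningGraph F₂).Reachable x y) := by
    unfold IsForest
    rw [spanningGraph_union, isAcyclic_sup_iff g₁ g₂ hA hdisj hxy]
    simp only [Finset.mem_union, or_imp, forall_and]
    tauto
  have hreach : ∀ p, p ∉ C → ((spanningGraph (F₁ ∪ F₂)).Reachable d p ↔
      ReachVia (spanningGraph F₁) (spanningGraph F₂) x y d p) := fun p hp => by
    rw [spanningGraph_union, reachable_sup_iff_reachVia g₁ g₂ hA hd hp]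
  unfold JoinForest Joins
  rw [hforest, hreach a ha, hreach b hb, hreach c hc]
  by_cases hr : (spanningGraph F₁).Reachable x y
  · have hvia : ∀ p, ReachVia (spanningGraph F₁) (spanningGraph F₂) x y d p ↔
        (spanningGraph (insert s(x, y) F₂)).Reachable d p := fun p => by
      rw [spanningGraph_insert, reachable_sup_edge, ReachVia]
      simp [hr]
    simp only [hvia, Link, hr]
    by_cases hn : s(x, y) ∈ F₂
    · have : (spanningGraph F₂).Reachable x y :=
        SimpleGraph.Adj.reachable (spanningGraph_adj.2 ⟨hn, hxy⟩)
      simp [hn, this]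
    · simp only [isForest_insert hn, hn]
      tauto
  · simp only [ReachVia, hr]
    tauto

/-- The weights without the edges that touch `C`. -/
noncomputable def detach (C : Set V) (w : Sym2 V → ℝ) (e : Sym2 V) : ℝ :=
  if ∃ v ∈ e, v ∈ C then 0 else w e

variable [Fintype V]

theorem weightSum_detach {C : Set V} {w δ : Sym2 V → ℝ} (hδ : ∀ e, (∃ v ∈ e, v ∈ C) → δ e = 0)
    (P : Finset (Sym2 V) → Prop) : weightSum P (detach C w + δ) =
      ∑ F with ∀ e ∈ F, ¬ ∃ v ∈ e, v ∈ C, if P F then ∏ e ∈ F, (w + δ) e else 0 := by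
  rw [weightSum, Finset.sum_filter, Finset.sum_filter]
  refine Finset.sum_congr rfl fun F _ => ?_
  by_cases hF : ∀ e ∈ F, ¬ ∃ v ∈ e, v ∈ C
  · rw [if_pos hF]
    congr 1
    refine Finset.prod_congr rfl fun e he => ?_
    rw [Pi.add_apply, Pi.add_apply, detach, if_neg (hF e he)]
  · rw [if_neg hF]
    push Not at hF
    obtain ⟨e, he, hv⟩ := hF
    rw [Finset.prod_eq_zero he, ite_self]
    rw [Pi.add_apply, detach, if_pos hv, hδ e hv, add_zero]

/-- A part of the graph without terminals that is attached at two vertices `x` and `y` can be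
replaced by a single edge between `x` and `y`, up to a positive factor. If the part is attached
at `x` only, then no edge is needed. -/
theorem exists_response_eq_detach {C : Set V} {a b c d x y : V} (hxy : x ≠ y)
    (ha : a ∉ C) (hb : b ∉ C) (hc : c ∉ C) (hd : d ∉ C) {w : Sym2 V → ℝ}
    (hw : ∀ e, 0 ≤ w e)
    (hC : ∀ e, w e ≠ 0 → (∃ v ∈ e, v ∈ C) → ∀ v ∈ e, v ∈ C ∨ v = x ∨ v = y) :
    ∃ n k : ℝ, 0 < n ∧ 0 ≤ k ∧ ((∀ e, w e ≠ 0 → (∃ v ∈ e, v ∈ C) → y ∉ e) → k = 0) ∧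
      response (weightSum (JoinForest a b c d)) a b c d w =
        n • response (weightSum (JoinForest a b c d)) a b c d (detach C w + k • bond x y) := by
  set P := JoinForest a b c d with hP
  set n : ℝ := weightSum (fun F => (∀ e ∈ F, ∃ v ∈ e, v ∈ C) ∧ IsForest F ∧
    ¬ (spanningGraph F).Reachable x y) w with hn
  set m : ℝ := weightSum (fun F => (∀ e ∈ F, ∃ v ∈ e, v ∈ C) ∧ IsForest F ∧
    (spanningGraph F).Reachable x y) w with hm
  have hprod : ∀ F : Finset (Sym2 V), 0 ≤ ∏ e ∈ F, w e := fun F =>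
    Finset.prod_nonneg fun e _ => hw e
  have hnpos : 0 < n := by
    refine Finset.sum_pos' (fun F _ => hprod F) ⟨∅, ?_, by simp⟩
    simp only [Finset.mem_filter, Finset.mem_univ, true_and]
    refine ⟨by simp, ⟨by simp, by simp [spanningGraph]⟩, fun h => ?_⟩
    exact hxy.symm (mem_of_reachable (A := {x}) (by simp) rfl h)
  have hmnn : 0 ≤ m := Finset.sum_nonneg fun F _ => hprod F
  refine ⟨n, m / n, hnpos, div_nonneg hmnn hnpos.le, fun hnot => ?_, ?_⟩
  · rw [div_eq_zero_iff]
    left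
    refine Finset.sum_eq_zero fun F hF => ?_
    simp only [Finset.mem_filter, Finset.mem_univ, true_and] at hF
    obtain ⟨ht, -, hr⟩ := hF
    by_contra hne
    refine mem_of_reachable (A := {v | v ≠ y}) (fun e he v hv hvy => ?_) hxy hr rfl
    exact hnot e (fun h0 => hne (Finset.prod_eq_zero he h0)) (ht e he) (hvy ▸ hv)
  rw [← response_const_mul]
  refine response_congr fun δ hδT => ?_
  have hδ : ∀ e, (∃ v ∈ e, v ∈ C) → δ e = 0 := by
    rintro e ⟨v, hv, hvC⟩
    by_contra hne
    rcases hδT e hne v hv with rfl | rfl | rfl | rfl <;> contradiction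
  have hbond : detach C w + (m / n) • bond x y + δ =
      detach C w + δ + (Pi.single s(x, y) (m / n) : Sym2 V → ℝ) := by
    ext e
    by_cases he : e = s(x, y)
    · subst he; simp [bond]; ring
    · simp [bond, he]
  rw [hbond, weightSum_add_single, mul_add, ← mul_assoc, mul_div_cancel₀ m hnpos.ne',
    weightSum_split fun e => ∃ v ∈ e, v ∈ C, weightSum_detach hδ, weightSum_detach hδ, hn, hm,
    weightSum, weightSum, Finset.sum_mul, Finset.sum_mul]
  simp only [Finset.sum_filter]
  rw [← Finset.sum_add_distrib]
  refine Finset.sum_congr rfl fun F₁ _ => ?_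
  by_cases h₁ : ∀ e ∈ F₁, ∃ v ∈ e, v ∈ C
  swap
  · rw [if_neg h₁, if_neg fun h => h₁ h.1, if_neg fun h => h₁ h.1, add_zero]
  have hwδ : ∏ e ∈ F₁, (w + δ) e = ∏ e ∈ F₁, w e :=
    Finset.prod_congr rfl fun e he => by rw [Pi.add_apply, hδ e (h₁ e he), add_zero]
  rw [if_pos h₁, hwδ]
  by_cases h0 : ∏ e ∈ F₁, w e = 0
  · simp [h0]
  have hin : ∀ e ∈ F₁, (∃ v ∈ e, v ∈ C) ∧ ∀ v ∈ e, v ∈ C ∨ v = x ∨ v = y := fun e he =>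
    ⟨h₁ e he, hC e (fun hw0 => h0 (Finset.prod_eq_zero he hw0)) (h₁ e he)⟩
  have hiff : ∀ F₂ : Finset (Sym2 V), (∀ e ∈ F₂, ¬ ∃ v ∈ e, v ∈ C) → (P (F₁ ∪ F₂) ↔ _) :=
    fun F₂ h₂ => joinForest_union_iff hxy ha hb hc hd hin h₂
  by_cases hF : IsForest F₁
  swap
  · rw [if_neg fun h => hF h.2.1, if_neg fun h => hF h.2.1, add_zero]
    refine Finset.sum_eq_zero fun F₂ _ => ?_
    split_ifs with h₂ hPF
    · exact absurd ((hiff F₂ h₂).1 hPF).1 hF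
    · rfl
    · rfl
  by_cases hr : (spanningGraph F₁).Reachable x y
  · rw [if_neg fun h => h.2.2 hr, if_pos ⟨h₁, hF, hr⟩, zero_add, Finset.mul_sum]
    refine Finset.sum_congr rfl fun F₂ _ => ?_
    by_cases h₂ : ∀ e ∈ F₂, ¬ ∃ v ∈ e, v ∈ C
    · have := hiff F₂ h₂
      simp only [hF, hr, true_and, not_true_eq_false, false_and, false_or] at this
      rw [if_pos h₂, if_pos h₂]
      simp only [this, ← hP, mul_ite, mul_zero]
    · rw [if_neg h₂, if_neg h₂, mul_zero]
  · rw [if_pos ⟨h₁, hF, hr⟩, if_neg fun h => hr h.2.2, add_zero, Finset.mul_sum]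
    refine Finset.sum_congr rfl fun F₂ _ => ?_
    by_cases h₂ : ∀ e ∈ F₂, ¬ ∃ v ∈ e, v ∈ C
    · have := hiff F₂ h₂
      simp only [hF, hr, true_and, not_false_eq_true, false_and, or_false] at this
      rw [if_pos h₂, if_pos h₂]
      simp only [this, ← hP, mul_ite, mul_zero]
    · rw [if_neg h₂, if_neg h₂, mul_zero]

end Elimination

/-! ### Components with at most two contacts -/

section Contacts

variable {V : Type*}

theorem TreeOn.isForest [Fintype V] {A : Finset V} {F : Finset (Sym2 V)} (h : TreeOn A F)
    (hA : A.Nonempty) : IsForest F := by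
  obtain ⟨k, hk⟩ : ∃ k, Aᶜ.card = k := ⟨_, rfl⟩
  induction k generalizing A F with
  | zero =>
    have : Nonempty V := hA.to_type
    rw [Finset.card_eq_zero, Finset.compl_eq_empty_iff] at hk
    subst hk
    exact (treeOn_univ_iff.1 h).1
  | succ k ih =>
    obtain ⟨u, hu⟩ := hA
    obtain ⟨v, hv⟩ := Finset.card_pos.1 (by omega : 0 < Aᶜ.card)
    have hv' := Finset.mem_compl.1 hv
    refine (ih (h.insert_leaf hu hv') (Finset.insert_nonempty _ _) ?_).subset
      (Finset.subset_insert _ _)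
    have h1 := Finset.card_add_card_compl A
    have h2 := Finset.card_add_card_compl (insert v A)
    rw [Finset.card_insert_of_notMem hv'] at h2
    omega

theorem IsForest.card_add_one_le_card [Fintype V] {A : Finset V} {F : Finset (Sym2 V)}
    (h : IsForest F) (hin : ∀ e ∈ F, ∀ v ∈ e, v ∈ A) (hA : A.Nonempty) : F.card + 1 ≤ A.card := by
  obtain ⟨k, hk⟩ : ∃ k, Aᶜ.card = k := ⟨_, rfl⟩
  induction k generalizing A F with
  | zero =>
    have : Nonempty V := hA.to_type
    rw [Finset.card_eq_zero, Finset.compl_eq_empty_iff] at hk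
    subst hk
    exact h.card_add_one_le.1
  | succ k ih =>
    obtain ⟨u, hu⟩ := hA
    obtain ⟨v, hv⟩ := Finset.card_pos.1 (by omega : 0 < Aᶜ.card)
    have hv' := Finset.mem_compl.1 hv
    have hn : s(u, v) ∉ F := fun hm => hv' (hin _ hm v (Sym2.mem_mk_right _ _))
    have hr : ¬ (spanningGraph F).Reachable u v := fun hr => hv' (mem_of_reachable hin hu hr)
    have := ih ((isForest_insert hn).2 ⟨h, hr⟩) (A := insert v A) ?_ (Finset.insert_nonempty _ _) ?_
    · rw [Finset.card_insert_of_notMem hn, Finset.card_insert_of_notMem hv'] at this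
      omega
    · intro e he x hx
      rcases Finset.mem_insert.1 he with rfl | he
      · rcases Sym2.mem_iff.1 hx with rfl | rfl
        · exact Finset.mem_insert_of_mem hu
        · exact Finset.mem_insert_self _ _
      · exact Finset.mem_insert_of_mem (hin e he x hx)
    · have h1 := Finset.card_add_card_compl A
      have h2 := Finset.card_add_card_compl (insert v A)
      rw [Finset.card_insert_of_notMem hv'] at h2
      omega

/-- The graph of the edges with nonzero weight. -/
def supportGraph (w : Sym2 V → ℝ) : SimpleGraph V := SimpleGraph.fromEdgeSet {e | w e ≠ 0}

theorem supportGraph_adj {w : Sym2 V → ℝ} {u v : V} :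
    (supportGraph w).Adj u v ↔ w s(u, v) ≠ 0 ∧ u ≠ v := by
  simp [supportGraph]

variable [Fintype V] {a b c d : V}

/-- If the weights live on the terminals, then the forests joining the terminals are the spanning
trees of the set of terminals. -/
theorem response_eq_of_support {w : Sym2 V → ℝ}
    (h : ∀ u v, (supportGraph w).Adj u v → u ∈ ({a, b, c, d} : Finset V)) :
    response (weightSum (JoinForest a b c d)) a b c d w =
      response (weightSum (TreeOn {a, b, c, d})) a b c d w := by
  refine response_congr fun δ hδ => weightSum_congr fun F hF => ?_
  have hne : ∏ e ∈ F, (w + δ) e ≠ 0 := by tauto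
  have hd : d ∈ ({a, b, c, d} : Finset V) := by simp
  have hin : IsForest F → ∀ e ∈ F, ∀ v ∈ e, v ∈ ({a, b, c, d} : Finset V) := by
    intro hF e he v hv
    have hwe : (w + δ) e ≠ 0 := fun h0 => hne (Finset.prod_eq_zero he h0)
    by_cases hδe : δ e = 0
    · obtain ⟨u, rfl⟩ := Sym2.mem_iff_exists.1 hv
      have hvu : v ≠ u := fun hvu => hF.1 _ he (by simp [hvu])
      exact h v u (supportGraph_adj.2 ⟨by simpa [hδe] using hwe, hvu⟩)
    · simpa using hδ e hδe v hv
  suffices JoinForest a b c d F ↔ TreeOn {a, b, c, d} F by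
    refine ⟨?_, ?_, rfl⟩ <;> tauto
  constructor
  · rintro ⟨hf, ha, hb, hc⟩
    have hr : ∀ v ∈ ({a, b, c, d} : Finset V), (spanningGraph F).Reachable d v := by
      intro v hv
      simp only [Finset.mem_insert, Finset.mem_singleton] at hv
      rcases hv with rfl | rfl | rfl | rfl
      · exact ha
      · exact hb
      · exact hc
      · exact SimpleGraph.Reachable.refl _
    have h1 := card_le_of_reachable_on hd hr
    have h2 := hf.card_add_one_le_card (hin hf) ⟨d, hd⟩
    exact ⟨hin hf, by omega, fun u hu v hv => (hr u hu).symm.trans (hr v hv)⟩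
  · intro hT
    exact ⟨hT.isForest ⟨d, hd⟩, hT.2.2 d hd a (by simp), hT.2.2 d hd b (by simp),
      hT.2.2 d hd c (by simp)⟩

/-- If every component of the nonterminal vertices has at most two terminals as neighbours, then
all of them can be replaced by edges between terminals, and the quadratic form vanishes because
only spanning trees of the terminals remain. -/
theorem pair_response_eq_zero_of_contacts (hac : a ≠ c) (had : a ≠ d) (hcd : c ≠ d) (hab : a ≠ b)
    {w : Sym2 V → ℝ} (hw : ∀ e, 0 ≤ w e)
    (h : ∀ s ∉ ({a, b, c, d} : Set V), ∃ x ∈ ({a, b, c, d} : Set V), ∃ y ∈ ({a, b, c, d} : Set V),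
      x ≠ y ∧ ∀ p, (avoid (supportGraph w) {a, b, c, d}).Reachable s p →
        ∀ t ∈ ({a, b, c, d} : Set V), (supportGraph w).Adj p t → t = x ∨ t = y) :
    pair (response (weightSum (JoinForest a b c d)) a b c d w)
      (response (weightSum (JoinForest a b c d)) a b c d w) = 0 := by
  obtain ⟨k, hk⟩ : ∃ k, {v | v ∉ ({a, b, c, d} : Set V) ∧ ∃ u, (supportGraph w).Adj v u}.ncard ≤ k :=
    ⟨_, le_rfl⟩
  induction k generalizing w with
  | zero =>
    rw [response_eq_of_support, pair_treeOn_self hac had hcd hab (by simp) (by simp) (by simp)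
      (by simp) hw]
    intro u v huv
    by_contra hu
    have h0 := (Set.ncard_eq_zero (Set.toFinite _)).1 (Nat.le_zero.1 hk)
    have : u ∈ {v | v ∉ ({a, b, c, d} : Set V) ∧ ∃ u, (supportGraph w).Adj v u} :=
      ⟨by simpa using hu, v, huv⟩
    rw [h0] at this
    exact this
  | succ k ih =>
    set T : Set V := {a, b, c, d} with hT
    by_cases hempty : ∃ s, s ∉ T ∧ ∃ u, (supportGraph w).Adj s u
    swap
    · refine ih hw h ?_
      have : {v | v ∉ T ∧ ∃ u, (supportGraph w).Adj v u} = ∅ := by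
        ext v
        simp only [Set.mem_ofPred_eq, Set.mem_empty_iff_false, iff_false]
        exact fun hv => hempty ⟨v, hv⟩
      rw [this, Set.ncard_empty]
      exact Nat.zero_le k
    obtain ⟨s, hs, u₀, hu₀⟩ := hempty
    obtain ⟨x, hx, y, hy, hxy, hcon⟩ := h s hs
    set C : Set V := {p | (avoid (supportGraph w) T).Reachable s p} with hC
    have hsC : s ∈ C := SimpleGraph.Reachable.refl _
    have hCT : ∀ p ∈ C, p ∉ T := fun p hp =>
      reachable_induction (P := fun p => p ∉ T) hp hs fun _ _ _ h => h.2.2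
    have hnot : ∀ t ∈ T, t ∉ C := fun t ht htC => hCT t htC ht
    have hstep : ∀ p ∈ C, ∀ v, (supportGraph w).Adj p v → v ∈ C ∨ v = x ∨ v = y := by
      intro p hp v hpv
      by_cases hv : v ∈ T
      · exact Or.inr (hcon p hp v hv hpv)
      · exact Or.inl (SimpleGraph.Reachable.trans hp
          (SimpleGraph.Adj.reachable (G := avoid _ T) ⟨hpv, hCT p hp, hv⟩))
    obtain ⟨n, m, -, hm, -, hresp⟩ := exists_response_eq_detach hxy (hnot a (by simp [hT]))
      (hnot b (by simp [hT])) (hnot c (by simp [hT])) (hnot d (by simp [hT])) hw (C := C) (by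
        rintro e he ⟨p, hp, hpC⟩ v hv
        by_cases hpv : p = v
        · exact Or.inl (hpv ▸ hpC)
        · have hev := (Sym2.mem_and_mem_iff hpv).1 ⟨hp, hv⟩
          exact hstep p hpC v (supportGraph_adj.2 ⟨hev ▸ he, hpv⟩))
    have hadj : ∀ p q, (supportGraph (detach C w + m • bond x y)).Adj p q → p ∉ T →
        (supportGraph w).Adj p q ∧ p ∉ C := by
      intro p q hpq hp
      rw [supportGraph_adj] at hpq ⊢
      have hne : s(p, q) ≠ s(x, y) := by
        intro h
        rcases Sym2.eq_iff.1 h with ⟨rfl, -⟩ | ⟨rfl, -⟩ <;> exact hp (by assumption)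
      have hw' := hpq.1
      rw [Pi.add_apply, Pi.smul_apply, bond, Pi.single_eq_of_ne hne, smul_zero, add_zero,
        detach] at hw'
      split_ifs at hw' with hd
      · exact absurd rfl hw'
      · exact ⟨⟨hw', hpq.2⟩, fun hpC => hd ⟨p, Sym2.mem_mk_left _ _, hpC⟩⟩
    rw [hresp, pair_smul_self, ih, mul_zero]
    · intro e
      rw [Pi.add_apply, Pi.smul_apply, detach, bond, Pi.single_apply, smul_eq_mul]
      have := hw e
      split_ifs <;> positivity
    · intro s' hs'
      obtain ⟨x', hx', y', hy', hne', hcon'⟩ := h s' hs'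
      refine ⟨x', hx', y', hy', hne', fun p hp t ht hpt => ?_⟩
      have hle : avoid (supportGraph (detach C w + m • bond x y)) T ≤ avoid (supportGraph w) T :=
        fun p q hpq => ⟨(hadj p q hpq.1 hpq.2.1).1, hpq.2⟩
      have hp' := hp.mono hle
      have hpT : p ∉ T := reachable_induction (P := fun p => p ∉ T) hp' hs' fun _ _ _ h => h.2.2
      exact hcon' p hp' t ht (hadj p t hpt hpT).1
    · have hlt : {v | v ∉ T ∧ ∃ u, (supportGraph (detach C w + m • bond x y)).Adj v u}.ncard <
          {v | v ∉ T ∧ ∃ u, (supportGraph w).Adj v u}.ncard := by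
        refine Set.ncard_lt_ncard ((Set.ssubset_iff_of_subset ?_).2 ⟨s, ⟨hs, u₀, hu₀⟩, ?_⟩)
          (Set.toFinite _)
        · rintro v ⟨hv, u, hu⟩
          exact ⟨hv, u, (hadj v u hu hv).1⟩
        · rintro ⟨-, u, hu⟩
          exact (hadj s u hu hs).2 hsC
      omega

end Contacts

/-! ### Partitions of the terminals -/

section Partitions

variable {V : Type*}

/-- The forests in which `p` is separated from a component that contains `q`, `r` and `s`. -/
def OneThree (p q r s : V) (F : Finset (Sym2 V)) : Prop :=
  IsForest F ∧ ¬ (spanningGraph F).Reachable p q ∧ (spanningGraph F).Reachable q r ∧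
    (spanningGraph F).Reachable q s

/-- The forests in which `p` and `q` are in one component, `r` and `s` in another one. -/
def TwoTwo (p q r s : V) (F : Finset (Sym2 V)) : Prop :=
  IsForest F ∧ ¬ (spanningGraph F).Reachable p r ∧ (spanningGraph F).Reachable p q ∧
    (spanningGraph F).Reachable r s

/-- The forests in which three different components contain `p`, both `q` and `r`, and `s`. -/
def OneTwoOne (p q r s : V) (F : Finset (Sym2 V)) : Prop :=
  IsForest F ∧ ¬ (spanningGraph F).Reachable p q ∧ ¬ (spanningGraph F).Reachable p s ∧
    ¬ (spanningGraph F).Reachable q s ∧ (spanningGraph F).Reachable q r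

theorem link_joinForest_iff (a b c d x y : V) (F : Finset (Sym2 V)) :
    Link s(x, y) (JoinForest a b c d) F ↔ IsForest F ∧ ¬ (spanningGraph F).Reachable x y ∧
      ∀ p, p = a ∨ p = b ∨ p = c → (spanningGraph F).Reachable d p ∨
        ((spanningGraph F).Reachable d x ∧ (spanningGraph F).Reachable y p) ∨
          ((spanningGraph F).Reachable d y ∧ (spanningGraph F).Reachable x p) := by
  unfold Link JoinForest Joins
  simp only [spanningGraph_insert, reachable_sup_edge, forall_eq_or_imp, forall_eq]
  constructor
  · rintro ⟨h1, h2, h3⟩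
    rw [isForest_insert h1] at h2
    exact ⟨h2.1, h2.2, h3⟩
  · rintro ⟨h1, h2, h3⟩
    have hn : s(x, y) ∉ F := fun h => h2 (by
      by_cases hxy : x = y
      · rw [hxy]
      · exact SimpleGraph.Adj.reachable (spanningGraph_adj.2 ⟨h, hxy⟩))
    exact ⟨hn, (isForest_insert hn).2 ⟨h1, h2⟩, h3⟩

/-- When the edge `xy` is added, the terminals get connected if and only if they lie in two
components and `x` and `y` are in different ones. -/
theorem link_joinForest_iff_partition (a b c d : V) (F : Finset (Sym2 V)) :
    (Link s(a, b) (JoinForest a b c d) F ↔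
      OneThree a b c d F ∨ OneThree b a c d F ∨ TwoTwo a c b d F ∨ TwoTwo a d b c F) ∧
    (Link s(c, d) (JoinForest a b c d) F ↔
      OneThree c a b d F ∨ OneThree d a b c F ∨ TwoTwo a c b d F ∨ TwoTwo a d b c F) ∧
    (Link s(a, c) (JoinForest a b c d) F ↔
      OneThree a b c d F ∨ OneThree c a b d F ∨ TwoTwo a b c d F ∨ TwoTwo a d b c F) ∧
    (Link s(b, d) (JoinForest a b c d) F ↔
      OneThree b a c d F ∨ OneThree d a b c F ∨ TwoTwo a b c d F ∨ TwoTwo a d b c F) ∧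
    (Link s(a, d) (JoinForest a b c d) F ↔
      OneThree a b c d F ∨ OneThree d a b c F ∨ TwoTwo a b c d F ∨ TwoTwo a c b d F) ∧
    (Link s(b, c) (JoinForest a b c d) F ↔
      OneThree b a c d F ∨ OneThree c a b d F ∨ TwoTwo a b c d F ∨ TwoTwo a c b d F) := by
  simp only [link_joinForest_iff]
  unfold OneThree TwoTwo
  have hr := fun v => SimpleGraph.Reachable.refl (G := spanningGraph F) v
  have hs := fun u v (h : (spanningGraph F).Reachable u v) => h.symm
  have ht := fun u v w (h : (spanningGraph F).Reachable u v)
    (h' : (spanningGraph F).Reachable v w) => h.trans h'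
  generalize (spanningGraph F).Reachable = R at *
  simp only [forall_eq_or_imp, forall_eq]
  refine ⟨?_, ?_, ?_, ?_, ?_, ?_⟩ <;> grind

/-- The forests that join all terminals once both `ab` and `cd` are added: one of `a`, `b` and one
of `c`, `d` share a component, and the other two terminals are in components of their own. -/
theorem link_link_joinForest_iff (a b c d : V) (F : Finset (Sym2 V)) :
    Link s(a, b) (Link s(c, d) (JoinForest a b c d)) F ↔
      OneTwoOne a b c d F ∨ OneTwoOne a b d c F ∨ OneTwoOne b a c d F ∨ OneTwoOne b a d c F := by
  have hR : Link s(a, b) (Link s(c, d) (JoinForest a b c d)) F ↔ IsForest F ∧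
      ¬ (spanningGraph F).Reachable a b ∧
      ¬ (spanningGraph F ⊔ SimpleGraph.edge a b).Reachable c d ∧
      ∀ p, p = a ∨ p = b ∨ p = c → (spanningGraph F ⊔ SimpleGraph.edge a b).Reachable d p ∨
        ((spanningGraph F ⊔ SimpleGraph.edge a b).Reachable d c ∧
          (spanningGraph F ⊔ SimpleGraph.edge a b).Reachable d p) ∨
          ((spanningGraph F ⊔ SimpleGraph.edge a b).Reachable d d ∧
            (spanningGraph F ⊔ SimpleGraph.edge a b).Reachable c p) := by
    rw [Link, link_joinForest_iff, spanningGraph_insert]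
    constructor
    · rintro ⟨h1, h2, h3⟩
      rw [isForest_insert h1] at h2
      exact ⟨h2.1, h2.2, h3⟩
    · rintro ⟨h1, h2, h3⟩
      have hn : s(a, b) ∉ F := fun h => h2 (by
        by_cases hxy : a = b
        · rw [hxy]
        · exact SimpleGraph.Adj.reachable (spanningGraph_adj.2 ⟨h, hxy⟩))
      exact ⟨hn, (isForest_insert hn).2 ⟨h1, h2⟩, h3⟩
  rw [hR]
  clear hR
  unfold OneTwoOne
  simp only [reachable_sup_edge]
  have hr := fun v => SimpleGraph.Reachable.refl (G := spanningGraph F) v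
  have hs := fun u v (h : (spanningGraph F).Reachable u v) => h.symm
  have ht := fun u v w (h : (spanningGraph F).Reachable u v)
    (h' : (spanningGraph F).Reachable v w) => h.trans h'
  generalize (spanningGraph F).Reachable = R at *
  have eba : R b a ↔ R a b := ⟨hs _ _, hs _ _⟩
  have eca : R c a ↔ R a c := ⟨hs _ _, hs _ _⟩
  have eda : R d a ↔ R a d := ⟨hs _ _, hs _ _⟩
  have ecb : R c b ↔ R b c := ⟨hs _ _, hs _ _⟩
  have edb : R d b ↔ R b d := ⟨hs _ _, hs _ _⟩
  have edc : R d c ↔ R c d := ⟨hs _ _, hs _ _⟩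
  simp only [forall_eq_or_imp, forall_eq, hr, eba, eca, eda, ecb, edb, edc]
  by_cases hab : R a b
  · simp [hab]
  by_cases hcd : R c d
  · grind
  grind (splits := 20)

variable [Fintype V]

theorem weightSum_of_iff_or {P A B C D : Finset (Sym2 V) → Prop}
    (h : ∀ F, P F ↔ A F ∨ B F ∨ C F ∨ D F)
    (hd : ∀ F, (A F → ¬ B F ∧ ¬ C F ∧ ¬ D F) ∧ (B F → ¬ C F ∧ ¬ D F) ∧ (C F → ¬ D F))
    (w : Sym2 V → ℝ) :
    weightSum P w = weightSum A w + weightSum B w + weightSum C w + weightSum D w := by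
  simp only [weightSum, Finset.sum_filter]
  rw [← Finset.sum_add_distrib, ← Finset.sum_add_distrib, ← Finset.sum_add_distrib]
  refine Finset.sum_congr rfl fun F _ => ?_
  have h1 := h F
  have h2 := hd F
  by_cases hA : A F
  · simp [h1, hA, h2.1 hA]
  by_cases hB : B F
  · simp [h1, hA, hB, h2.2.1 hB]
  by_cases hC : C F
  · simp [h1, hA, hB, hC, h2.2.2 hC]
  · simp [h1, hA, hB, hC]

/-- The responses of the sum over the forests that join all terminals, in terms of the partitions
of the terminals into components. -/
theorem response_joinForest (a b c d : V) (w : Sym2 V → ℝ) :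
    response (weightSum (JoinForest a b c d)) a b c d w = ![weightSum (JoinForest a b c d) w,
      weightSum (OneThree a b c d) w + weightSum (OneThree b a c d) w +
        weightSum (TwoTwo a c b d) w + weightSum (TwoTwo a d b c) w,
      weightSum (OneThree c a b d) w + weightSum (OneThree d a b c) w +
        weightSum (TwoTwo a c b d) w + weightSum (TwoTwo a d b c) w,
      weightSum (TwoTwo a d b c) w - weightSum (TwoTwo a c b d) w,
      weightSum (OneTwoOne a b c d) w + weightSum (OneTwoOne a b d c) w +
        weightSum (OneTwoOne b a c d) w + weightSum (OneTwoOne b a d c) w] := by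
  have hL := link_joinForest_iff_partition a b c d
  rw [response_weightSum, weightSum_of_iff_or (fun F => (hL F).1),
    weightSum_of_iff_or (fun F => (hL F).2.1), weightSum_of_iff_or (fun F => (hL F).2.2.1),
    weightSum_of_iff_or (fun F => (hL F).2.2.2.1), weightSum_of_iff_or (fun F => (hL F).2.2.2.2.1),
    weightSum_of_iff_or (fun F => (hL F).2.2.2.2.2),
    weightSum_of_iff_or (link_link_joinForest_iff a b c d)]
  · ext i
    fin_cases i <;> simp
    ring
  all_goals
    intro F
    simp only [OneThree, TwoTwo, OneTwoOne]
    have hr := fun v => SimpleGraph.Reachable.refl (G := spanningGraph F) v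
    have hs := fun u v (h : (spanningGraph F).Reachable u v) => h.symm
    have ht := fun u v w (h : (spanningGraph F).Reachable u v)
      (h' : (spanningGraph F).Reachable v w) => h.trans h'
    generalize (spanningGraph F).Reachable = R at *
    clear hL
    grind

end Partitions

/-! ### A separating vertex -/

section Cut

variable {V : Type*} {a b c d z : V} {C : Set V}

/-- If `C` is attached to the rest at the single vertex `z`, then forests decompose into a part
that touches `C` and a part that does not. -/
theorem joinForest_union_iff_of_cut (ha : a ∈ C ∨ a = z) (hb : b ∈ C ∨ b = z) (hc : c ∉ C)
    (hd : d ∉ C) (hcd : c ≠ d) {F₁ F₂ : Finset (Sym2 V)}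
    (h₁ : ∀ e ∈ F₁, (∃ v ∈ e, v ∈ C) ∧ ∀ v ∈ e, v ∈ C ∨ v = z)
    (h₂ : ∀ e ∈ F₂, ¬ ∃ v ∈ e, v ∈ C) :
    JoinForest a b c d (F₁ ∪ F₂) ↔
      (IsForest F₁ ∧ (spanningGraph F₁).Reachable z a ∧ (spanningGraph F₁).Reachable z b) ∧
        (IsForest F₂ ∧ (spanningGraph F₂).Reachable z c ∧ (spanningGraph F₂).Reachable z d) := by
  -- The second attaching vertex of the general gluing lemmas is a dummy outside `C`.
  obtain ⟨y, hyz, hyC⟩ : ∃ y, y ≠ z ∧ y ∉ C := by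
    by_cases h : c = z
    · exact ⟨d, fun h' => hcd (h.trans h'.symm), hd⟩
    · exact ⟨c, h, hc⟩
  have g₁ : ∀ u v, (spanningGraph F₁).Adj u v → u ∈ C ∪ {z} := fun u v huv =>
    (h₁ _ (spanningGraph_adj.1 huv).1).2 u (Sym2.mem_mk_left _ _)
  have g₂ : ∀ u v, (spanningGraph F₂).Adj u v → u ∈ Cᶜ := fun u v huv hu =>
    h₂ _ (spanningGraph_adj.1 huv).1 ⟨u, Sym2.mem_mk_left _ _, hu⟩
  have hA : ∀ v ∈ C ∪ {z}, v ∈ Cᶜ → v = z ∨ v = y := by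
    rintro v (h | h) h'
    · exact absurd h h'
    · exact Or.inl h
  have hdisj : ∀ u v, (spanningGraph F₁).Adj u v → ¬ (spanningGraph F₂).Adj u v := fun u v h h' =>
    h₂ _ (spanningGraph_adj.1 h').1 (h₁ _ (spanningGraph_adj.1 h).1).1
  have hy : ∀ v, (spanningGraph F₁).Reachable y v → v = y := fun v hv =>
    reachable_induction (P := fun v => v = y) hv rfl fun p q hp hpq => by
      subst hp
      exact absurd (g₁ _ _ hpq) (by rintro (h | h); exacts [hyC h, hyz h])
  have hzy : ¬ (spanningGraph F₁).Reachable z y := fun h => hyz (hy z h.symm).symm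
  have haA : a ∈ C ∪ {z} := ha
  have hbA : b ∈ C ∪ {z} := hb
  have hyA : y ∉ C ∪ {z} := by rintro (h | h); exacts [hyC h, hyz h]
  have hforest : IsForest (F₁ ∪ F₂) ↔ IsForest F₁ ∧ IsForest F₂ := by
    unfold IsForest
    rw [spanningGraph_union, isAcyclic_sup_iff g₁ g₂ hA hdisj hyz.symm]
    simp only [Finset.mem_union, or_imp, forall_and]
    tauto
  have hvia : ∀ p, ReachVia (spanningGraph F₁) (spanningGraph F₂) z y d p →
      (spanningGraph F₂).Reachable d p := fun p hp => hp.resolve_right fun h => hzy h.1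
  have hfar : ∀ p ∈ C ∪ {z}, (spanningGraph (F₁ ∪ F₂)).Reachable d p →
      (spanningGraph F₁).Reachable z p ∧ (spanningGraph F₂).Reachable d z := by
    intro p hp hr
    rw [spanningGraph_union] at hr
    obtain ⟨q, rfl | rfl, hdq, hqp⟩ := (reachable_sup_of_inter_subset g₁ g₂ hA hd hr).2 hp
    · exact ⟨hqp, hvia _ hdq⟩
    · exact absurd (hy p hqp ▸ hp) hyA
  have l₁ : spanningGraph F₁ ≤ spanningGraph (F₁ ∪ F₂) :=
    spanningGraph_mono Finset.subset_union_left
  have l₂ : spanningGraph F₂ ≤ spanningGraph (F₁ ∪ F₂) :=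
    spanningGraph_mono Finset.subset_union_right
  unfold JoinForest Joins
  rw [hforest]
  constructor
  · rintro ⟨⟨f₁, f₂⟩, ra, rb, rc⟩
    obtain ⟨hza, hdz⟩ := hfar a haA ra
    rw [spanningGraph_union] at rc
    have hdc := hvia _ ((reachable_sup_iff_reachVia g₁ g₂ hA hd hc).1 rc)
    exact ⟨⟨f₁, hza, (hfar b hbA rb).1⟩, f₂, hdz.symm.trans hdc, hdz.symm⟩
  · rintro ⟨⟨f₁, hza, hzb⟩, f₂, hzc, hzd⟩
    have hdz := hzd.symm.mono l₂
    exact ⟨⟨f₁, f₂⟩, hdz.trans (hza.mono l₁), hdz.trans (hzb.mono l₁), hdz.trans (hzc.mono l₂)⟩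

/-- A path from `{a, b}` to `{c, d}` passes through every vertex that separates these pairs. -/
theorem reachable_of_cut {G H : SimpleGraph V} (hH : H ≤ G) (hcut : ¬ Crosses G a b c d {z})
    {p q : V} (hp : p = a ∨ p = b) (hq : q = c ∨ q = d) (h : H.Reachable p q) : H.Reachable p z := by
  have key : H.Reachable p z ∨ (q ∈ Side G a b {z} ∧ H.Reachable p q) := by
    refine reachable_induction (P := fun q => H.Reachable p z ∨
      (q ∈ Side G a b {z} ∧ H.Reachable p q)) h ?_ ?_
    · by_cases hpz : p = z
      · rw [hpz]
        exact Or.inl (SimpleGraph.Reachable.refl _)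
      · exact Or.inr ⟨side_start hp hpz, SimpleGraph.Reachable.refl _⟩
    · rintro u v (hu | ⟨hu, hr⟩) huv
      · exact Or.inl hu
      · by_cases hvz : v = z
        · exact Or.inl (hvz ▸ hr.trans huv.reachable)
        · exact Or.inr ⟨side_step hu (hH huv) hvz, hr.trans huv.reachable⟩
  refine key.resolve_right fun hk => hcut ?_
  rcases hq with rfl | rfl
  · exact Or.inl hk.1
  · exact Or.inr hk.1

variable [Fintype V]

/-- If `z` separates `{a, b}` from `{c, d}`, then a forest joins all terminals exactly when its two
sides join `a`, `b` to `z` and `c`, `d` to `z`; so the sum factorizes, also after perturbations on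
either side. -/
theorem weightSum_joinForest_of_cut (ha : a ∈ C ∨ a = z) (hb : b ∈ C ∨ b = z) (hc : c ∉ C)
    (hd : d ∉ C) (hcd : c ≠ d) {w δ₁ δ₂ : Sym2 V → ℝ}
    (hw : ∀ e, w e ≠ 0 → (∃ v ∈ e, v ∈ C) → ∀ v ∈ e, v ∈ C ∨ v = z)
    (h₁ : ∀ e, δ₁ e ≠ 0 → (∃ v ∈ e, v ∈ C) ∧ ∀ v ∈ e, v ∈ C ∨ v = z)
    (h₂ : ∀ e, δ₂ e ≠ 0 → ¬ ∃ v ∈ e, v ∈ C) :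
    weightSum (JoinForest a b c d) (w + δ₁ + δ₂) =
      weightSum (fun F => (∀ e ∈ F, ∃ v ∈ e, v ∈ C) ∧ IsForest F ∧
        (spanningGraph F).Reachable z a ∧ (spanningGraph F).Reachable z b) (w + δ₁) *
      weightSum (fun F => (∀ e ∈ F, ¬ ∃ v ∈ e, v ∈ C) ∧ IsForest F ∧
        (spanningGraph F).Reachable z c ∧ (spanningGraph F).Reachable z d) (w + δ₂) := by
  rw [weightSum_split fun e => ∃ v ∈ e, v ∈ C, weightSum, weightSum, Finset.sum_mul_sum]
  simp only [Finset.sum_filter]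
  refine Finset.sum_congr rfl fun F₁ _ => ?_
  by_cases t₁ : ∀ e ∈ F₁, ∃ v ∈ e, v ∈ C
  swap
  · rw [if_neg t₁, if_neg fun h => t₁ h.1]
  have p₁ : ∏ e ∈ F₁, (w + δ₁ + δ₂) e = ∏ e ∈ F₁, (w + δ₁) e :=
    Finset.prod_congr rfl fun e he => by
      have : δ₂ e = 0 := by
        by_contra h
        exact h₂ e h (t₁ e he)
      simp [this]
  rw [if_pos t₁, p₁]
  by_cases h0 : ∏ e ∈ F₁, (w + δ₁) e = 0
  · simp only [h0, zero_mul, ite_self, Finset.sum_const_zero]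
  have hin : ∀ e ∈ F₁, (∃ v ∈ e, v ∈ C) ∧ ∀ v ∈ e, v ∈ C ∨ v = z := by
    intro e he
    have hne : (w + δ₁) e ≠ 0 := fun h => h0 (Finset.prod_eq_zero he h)
    by_cases hδ : δ₁ e = 0
    · exact ⟨t₁ e he, hw e (by simpa [hδ] using hne) (t₁ e he)⟩
    · exact h₁ e hδ
  have p₂ : ∀ F₂ : Finset (Sym2 V), (∀ e ∈ F₂, ¬ ∃ v ∈ e, v ∈ C) →
      ∏ e ∈ F₂, (w + δ₁ + δ₂) e = ∏ e ∈ F₂, (w + δ₂) e := fun F₂ t₂ =>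
    Finset.prod_congr rfl fun e he => by
      have : δ₁ e = 0 := by
        by_contra h
        exact t₂ e he (h₁ e h).1
      simp [this]
  have hiff : ∀ F₂ : Finset (Sym2 V), (∀ e ∈ F₂, ¬ ∃ v ∈ e, v ∈ C) → _ := fun F₂ t₂ =>
    joinForest_union_iff_of_cut ha hb hc hd hcd hin t₂
  by_cases q₁ : IsForest F₁ ∧ (spanningGraph F₁).Reachable z a ∧ (spanningGraph F₁).Reachable z b
  · rw [if_pos ⟨t₁, q₁⟩]
    refine Finset.sum_congr rfl fun F₂ _ => ?_
    by_cases t₂ : ∀ e ∈ F₂, ¬ ∃ v ∈ e, v ∈ C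
    swap
    · rw [if_neg t₂, if_neg fun h => t₂ h.1]
    rw [if_pos t₂, p₂ F₂ t₂]
    by_cases q₂ : IsForest F₂ ∧ (spanningGraph F₂).Reachable z c ∧ (spanningGraph F₂).Reachable z d
    · rw [if_pos ((hiff F₂ t₂).2 ⟨q₁, q₂⟩), if_pos ⟨t₂, q₂⟩]
    · rw [if_neg fun h => q₂ ((hiff F₂ t₂).1 h).2, if_neg fun h => q₂ h.2]
  · rw [if_neg fun h => q₁ h.2]
    refine Finset.sum_eq_zero fun F₂ _ => ?_
    by_cases t₂ : ∀ e ∈ F₂, ¬ ∃ v ∈ e, v ∈ C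
    · rw [if_pos t₂, if_neg fun h => q₁ ((hiff F₂ t₂).1 h).1]
    · rw [if_neg t₂]

/-- A vertex that separates `{a, b}` from `{c, d}` makes the two pairs independent. -/
theorem pair_response_eq_zero_of_cut (hab : a ≠ b) (hcd : c ≠ d) {w : Sym2 V → ℝ}
    (hcut : ¬ Crosses (supportGraph w) a b c d {z}) :
    pair (response (weightSum (JoinForest a b c d)) a b c d w)
      (response (weightSum (JoinForest a b c d)) a b c d w) = 0 := by
  set H := supportGraph w with hH
  set C := Side H a b {z} with hC
  have ha : a ∈ C ∨ a = z := by
    by_cases h : a = z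
    · exact Or.inr h
    · exact Or.inl (side_start (Or.inl rfl) h)
  have hb : b ∈ C ∨ b = z := by
    by_cases h : b = z
    · exact Or.inr h
    · exact Or.inl (side_start (Or.inr rfl) h)
  have hc : c ∉ C := fun h => hcut (Or.inl h)
  have hd : d ∉ C := fun h => hcut (Or.inr h)
  have hw : ∀ e, w e ≠ 0 → (∃ v ∈ e, v ∈ C) → ∀ v ∈ e, v ∈ C ∨ v = z := by
    rintro e he ⟨u, hu, huC⟩ v hv
    by_cases huv : u = v
    · exact Or.inl (huv ▸ huC)
    by_cases hvz : v = z
    · exact Or.inr hvz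
    have hev := (Sym2.mem_and_mem_iff huv).1 ⟨hu, hv⟩
    exact Or.inl (side_step huC (supportGraph_adj.2 ⟨hev ▸ he, huv⟩) hvz)
  have hbond : ∀ x y : V, ∀ e, bond x y e ≠ 0 → e = s(x, y) := fun x y e he => by
    by_contra hne
    exact he (by simp [bond, hne])
  have h₁ : ∀ e, bond a b e ≠ 0 → (∃ v ∈ e, v ∈ C) ∧ ∀ v ∈ e, v ∈ C ∨ v = z := by
    intro e he
    rw [hbond a b e he]
    constructor
    · rcases ha with ha | ha
      · exact ⟨a, Sym2.mem_mk_left _ _, ha⟩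
      · exact ⟨b, Sym2.mem_mk_right _ _, hb.resolve_right fun h => hab (ha.trans h.symm)⟩
    · intro v hv
      rcases Sym2.mem_iff.1 hv with rfl | rfl <;> assumption
  have h₂ : ∀ e, bond c d e ≠ 0 → ¬ ∃ v ∈ e, v ∈ C := by
    rintro e he ⟨v, hv, hvC⟩
    rw [hbond c d e he] at hv
    rcases Sym2.mem_iff.1 hv with rfl | rfl <;> contradiction
  have h0 : ∀ e, (0 : Sym2 V → ℝ) e ≠ 0 → (∃ v ∈ e, v ∈ C) ∧ ∀ v ∈ e, v ∈ C ∨ v = z := by simp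
  have h0' : ∀ e, (0 : Sym2 V → ℝ) e ≠ 0 → ¬ ∃ v ∈ e, v ∈ C := by simp
  have e0 := weightSum_joinForest_of_cut ha hb hc hd hcd hw h0 h0'
  have e1 := weightSum_joinForest_of_cut ha hb hc hd hcd hw h₁ h0'
  have e2 := weightSum_joinForest_of_cut ha hb hc hd hcd hw h0 h₂
  have e3 := weightSum_joinForest_of_cut ha hb hc hd hcd hw h₁ h₂
  simp only [add_zero] at e0 e1 e2
  have hpair : ∀ p q r s : V, (p = a ∨ p = b) → (r = a ∨ r = b) → (q = c ∨ q = d) →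
      (s = c ∨ s = d) → weightSum (TwoTwo p q r s) w = 0 := by
    intro p q r s hp hr hq hs
    refine Finset.sum_eq_zero fun F hF => ?_
    simp only [Finset.mem_filter, Finset.mem_univ, true_and] at hF
    obtain ⟨-, hpr, hpq, hrs⟩ := hF
    by_contra hne
    have hle : spanningGraph F ≤ H := fun u v huv => by
      rw [spanningGraph_adj] at huv
      exact supportGraph_adj.2 ⟨fun h => hne (Finset.prod_eq_zero huv.1 h), huv.2⟩
    exact hpr ((reachable_of_cut hle hcut hp hq hpq).trans
      (reachable_of_cut hle hcut hr hs hrs).symm)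
  have hY : response (weightSum (JoinForest a b c d)) a b c d w 3 = 0 := by
    rw [response_joinForest]
    simp [hpair a c b d (by simp) (by simp) (by simp) (by simp),
      hpair a d b c (by simp) (by simp) (by simp) (by simp)]
  unfold pair
  rw [hY]
  simp [response, e0, e1, e2, e3]
  ring

end Cut

/-! ### The sign of the quadratic form for large parameters -/

section Sign

variable {V : Type*} {G : SimpleGraph V} {a b c d : V}

theorem supportGraph_smul_edgeWeight (G : SimpleGraph V) {t : ℝ} (ht : t ≠ 0) :
    supportGraph (t • edgeWeight G) = G := by
  ext u v
  rw [supportGraph_adj, Pi.smul_apply, smul_eq_mul, mul_ne_zero_iff, and_iff_right ht]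
  constructor
  · exact fun h => adj_of_edgeWeight_ne_zero h.1
  · exact fun h => ⟨by rw [edgeWeight_adj h]; exact one_ne_zero, h.ne⟩

theorem smul_edgeWeight_nonneg (G : SimpleGraph V) {t : ℝ} (ht : 0 ≤ t) (e : Sym2 V) :
    0 ≤ (t • edgeWeight G) e :=
  mul_nonneg ht (edgeWeight_nonneg G e)

variable [Fintype V]

/-- Either the form vanishes identically, or there is a rigid set. -/
theorem eventually_pair_nonneg_of_preconnected (hac : a ≠ c) (had : a ≠ d) (hcd : c ≠ d)
    (hab : a ≠ b) (hG : G.Preconnected) : ∀ᶠ t : ℝ in Filter.atTop,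
      0 ≤ pair (response (weightSum (JoinForest a b c d)) a b c d (t • edgeWeight G))
        (response (weightSum (JoinForest a b c d)) a b c d (t • edgeWeight G)) := by
  by_cases hsep : ∀ z, Crosses G a b c d {z}
  swap
  · push Not at hsep
    obtain ⟨z, hz⟩ := hsep
    filter_upwards [Filter.eventually_gt_atTop 0] with t ht
    rw [← supportGraph_smul_edgeWeight G ht.ne'] at hz
    rw [pair_response_eq_zero_of_cut hab hcd hz]
  by_cases hcon : ∀ s ∉ ({a, b, c, d} : Set V), ∃ x ∈ ({a, b, c, d} : Set V),
      ∃ y ∈ ({a, b, c, d} : Set V), x ≠ y ∧ ∀ p, (avoid G {a, b, c, d}).Reachable s p →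
        ∀ t ∈ ({a, b, c, d} : Set V), G.Adj p t → t = x ∨ t = y
  · filter_upwards [Filter.eventually_gt_atTop 0] with t ht
    rw [pair_response_eq_zero_of_contacts hac had hcd hab (smul_edgeWeight_nonneg G ht.le)]
    rwa [supportGraph_smul_edgeWeight G ht.ne']
  · push Not at hcon
    obtain ⟨s, hs, hcon⟩ := hcon
    set T : Set V := {a, b, c, d} with hT
    -- Two terminals never contain all contacts, which gives three different contacts.
    obtain ⟨-, -, t₁, ht₁, h₁, -, -⟩ := hcon a (by simp [hT]) c (by simp [hT]) hac
    obtain ⟨t₀, ht₀, h₀⟩ : ∃ t ∈ T, t ≠ t₁ := by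
      by_cases h : a = t₁
      · exact ⟨c, by simp [hT], fun h' => hac (h.trans h'.symm)⟩
      · exact ⟨a, by simp [hT], h⟩
    obtain ⟨p₂, hp₂, t₂, ht₂, h₂, n₂, -⟩ := hcon t₁ ht₁ t₀ ht₀ h₀.symm
    obtain ⟨p₃, hp₃, t₃, ht₃, h₃, n₃, n₃'⟩ := hcon t₁ ht₁ t₂ ht₂ n₂.symm
    obtain ⟨p₁, hp₁, t₁', ht₁', h₁', n₁, n₁'⟩ := hcon t₂ ht₂ t₃ ht₃ n₃'.symm
    obtain ⟨S, hS⟩ := exists_isRigid hG hsep hs n₁ n₁' n₃'.symm (by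
      rintro t (rfl | rfl | rfl)
      · exact ⟨ht₁', p₁, hp₁, h₁'⟩
      · exact ⟨ht₂, p₂, hp₂, h₂⟩
      · exact ⟨ht₃, p₃, hp₃, h₃⟩)
    filter_upwards [hS.eventually_pair_pos hac had hcd hab hG] with t ht
    exact ht.le

/-- The components without terminals may be replaced by vertices attached to `d`. -/
theorem eventually_pair_nonneg_of_reachable (hac : a ≠ c) (had : a ≠ d) (hcd : c ≠ d)
    (hab : a ≠ b) (ha : G.Reachable d a) (hb : G.Reachable d b) (hc : G.Reachable d c) :
    ∀ᶠ t : ℝ in Filter.atTop,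
      0 ≤ pair (response (weightSum (JoinForest a b c d)) a b c d (t • edgeWeight G))
        (response (weightSum (JoinForest a b c d)) a b c d (t • edgeWeight G)) := by
  set C : Set V := {v | ¬ G.Reachable d v} with hC
  have hmem : ∀ v, G.Reachable d v → v ∉ C := fun v hv h => h hv
  have hd := hmem d (SimpleGraph.Reachable.refl _)
  have hstep : ∀ u v, G.Adj u v → u ∈ C → v ∈ C := fun u v huv hu hv =>
    hu (SimpleGraph.Reachable.trans hv huv.symm.reachable)
  let G' : SimpleGraph V :=
    { Adj := fun u v => (G.Adj u v ∧ u ∉ C) ∨ (u ∈ C ∧ v = d) ∨ (v ∈ C ∧ u = d)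
      symm := ⟨by
        rintro u v (⟨h, hu⟩ | ⟨hu, hv⟩ | ⟨hv, hu⟩)
        · exact Or.inl ⟨h.symm, fun hv => hu (hstep v u h.symm hv)⟩
        · exact Or.inr (Or.inr ⟨hu, hv⟩)
        · exact Or.inr (Or.inl ⟨hv, hu⟩)⟩
      loopless := ⟨by
        rintro u (⟨h, -⟩ | ⟨hu, rfl⟩ | ⟨hu, rfl⟩)
        · exact h.ne rfl
        · exact hd hu
        · exact hd hu⟩ }
  have hG' : G'.Preconnected := by
    have key : ∀ v, G'.Reachable d v := by
      intro v
      by_cases hv : v ∈ C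
      · exact SimpleGraph.Adj.reachable (Or.inr (Or.inr ⟨hv, rfl⟩))
      · refine (reachable_induction (P := fun v => v ∉ C ∧ G'.Reachable d v) (not_not.1 hv)
          ⟨hd, SimpleGraph.Reachable.refl _⟩ ?_).2
        rintro u v ⟨hu, hr⟩ huv
        exact ⟨fun hv => hu (hstep v u huv.symm hv),
          hr.trans (SimpleGraph.Adj.reachable (Or.inl ⟨huv, hu⟩))⟩
    exact fun u v => (key u).symm.trans (key v)
  -- Neither graph has an edge between `C` and a vertex outside `C` other than `d`.
  have hdet : ∀ H : SimpleGraph V, (∀ u v, H.Adj u v → u ∈ C → v ∈ C ∨ v = d) → ∀ t : ℝ, 0 ≤ t →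
      ∃ n : ℝ, 0 < n ∧ response (weightSum (JoinForest a b c d)) a b c d (t • edgeWeight H) =
        n • response (weightSum (JoinForest a b c d)) a b c d (detach C (t • edgeWeight H)) := by
    intro H hH t ht
    have hH' : ∀ e, (t • edgeWeight H) e ≠ 0 → (∃ v ∈ e, v ∈ C) → ∀ v ∈ e, v ∈ C ∨ v = d := by
      rintro e he ⟨u, hu, huC⟩ v hv
      by_cases huv : u = v
      · exact Or.inl (huv ▸ huC)
      · have hev := (Sym2.mem_and_mem_iff huv).1 ⟨hu, hv⟩
        subst hev
        exact hH u v (adj_of_edgeWeight_ne_zero (right_ne_zero_of_mul he)) huC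
    obtain ⟨n, k, hn, -, hk, hresp⟩ := exists_response_eq_detach had.symm (hmem a ha) (hmem b hb)
      (hmem c hc) hd (smul_edgeWeight_nonneg H ht) (C := C)
      (fun e he hv v hve => (hH' e he hv v hve).imp_right Or.inl)
    refine ⟨n, hn, ?_⟩
    rw [hresp, hk, zero_smul, add_zero]
    intro e he hv hae
    rcases hH' e he hv a hae with h | h
    · exact hmem a ha h
    · exact had h
  have heq : ∀ t : ℝ, detach C (t • edgeWeight G) = detach C (t • edgeWeight G') := by
    intro t
    ext e
    unfold detach
    split_ifs with he
    · rfl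
    · induction e using Sym2.ind with
      | _ u v =>
        have hu : u ∉ C := fun h => he ⟨u, Sym2.mem_mk_left _ _, h⟩
        have hv : v ∉ C := fun h => he ⟨v, Sym2.mem_mk_right _ _, h⟩
        have : G.Adj u v ↔ G'.Adj u v :=
          ⟨fun h => Or.inl ⟨h, hu⟩, fun h => by
            rcases h with h | h | h
            · exact h.1
            · exact absurd h.1 hu
            · exact absurd h.1 hv⟩
        simp only [Pi.smul_apply, edgeWeight, SimpleGraph.mem_edgeSet, this]
  filter_upwards [eventually_pair_nonneg_of_preconnected hac had hcd hab hG',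
    Filter.eventually_ge_atTop 0] with t h ht
  obtain ⟨n, -, hn⟩ := hdet G (fun u v huv hu => Or.inl (hstep u v huv hu)) t ht
  obtain ⟨n', hn'pos, hn'⟩ := hdet G' (by
    rintro u v (⟨-, hu'⟩ | ⟨-, hv⟩ | ⟨hv, -⟩) hu
    · exact absurd hu hu'
    · exact Or.inr hv
    · exact Or.inl hv) t ht
  rw [hn, heq, pair_smul_self]
  rw [hn', pair_smul_self] at h
  exact mul_nonneg (sq_nonneg n) (nonneg_of_mul_nonneg_right h (by positivity))

theorem pair_response_swap (w : Sym2 V → ℝ) :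
    pair (response (weightSum (JoinForest b a c d)) b a c d w)
        (response (weightSum (JoinForest b a c d)) b a c d w) =
      pair (response (weightSum (JoinForest a b c d)) a b c d w)
        (response (weightSum (JoinForest a b c d)) a b c d w) := by
  have h : JoinForest b a c d = JoinForest a b c d := by
    ext F
    simp only [JoinForest, Joins]
    tauto
  have hb : bond b a = bond a b := by rw [bond, bond, Sym2.eq_swap]
  rw [h]
  simp only [response, pair, hb]
  simp
  ring

end Sign

/-! ### Weights of partitions -/

section Partition

variable {V : Type*} [Fintype V] {G : SimpleGraph V} {a b c d : V}

theorem weightSum_eq_zero {P : Finset (Sym2 V) → Prop} {t : ℝ}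
    (h : ∀ F, P F → spanningGraph F ≤ G → False) : weightSum P (t • edgeWeight G) = 0 := by
  refine Finset.sum_eq_zero fun F hF => ?_
  simp only [Finset.mem_filter, Finset.mem_univ, true_and] at hF
  by_contra hne
  refine h F hF fun u v huv => ?_
  have he := (spanningGraph_adj.1 huv).1
  exact adj_of_edgeWeight_ne_zero
    (right_ne_zero_of_mul fun h0 => hne (Finset.prod_eq_zero he h0))

theorem weightSum_nonneg (P : Finset (Sym2 V) → Prop) {w : Sym2 V → ℝ} (hw : ∀ e, 0 ≤ w e) :
    0 ≤ weightSum P w :=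
  Finset.sum_nonneg fun _ _ => Finset.prod_nonneg fun e _ => hw e

/-- Probabilities are weighted sums, with weight `λ` on the edges of `G` and `0` elsewhere. -/
theorem prob_eq_weightSum (G : SimpleGraph V) (lam : ℝ) (A : Finset (Sym2 V) → Prop) :
    prob G lam A =
      weightSum (fun F => IsForest F ∧ A F) (lam • edgeWeight G) / partitionFunction G lam := by
  have hw : ∀ F : Finset (Sym2 V), ∏ e ∈ F, (lam • edgeWeight G) e =
      if (F : Set (Sym2 V)) ⊆ G.edgeSet then lam ^ F.card else 0 := by
    intro F
    split_ifs with hF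
    · rw [← Finset.prod_const]
      refine Finset.prod_congr rfl fun e he => ?_
      rw [Pi.smul_apply, edgeWeight, if_pos (hF he), smul_eq_mul, mul_one]
    · obtain ⟨e, he, hne⟩ := Set.not_subset.1 hF
      refine Finset.prod_eq_zero he ?_
      rw [Pi.smul_apply, edgeWeight, if_neg hne, smul_zero]
  rw [prob, weightSum, Finset.sum_div, Finset.sum_filter, Finset.sum_filter,
    Finset.sum_subset (Finset.subset_univ G.edgeFinset.powerset)]
  · refine Finset.sum_congr rfl fun F _ => ?_
    rw [hw, mass]
    simp only [mem_forests]
    by_cases hF : (F : Set (Sym2 V)) ⊆ G.edgeSet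
    · have hiff : (spanningGraph F).IsAcyclic ↔ IsForest F :=
        ⟨isForest_of_subset_edgeSet hF, fun h => h.2⟩
      by_cases h1 : IsForest F <;> by_cases h2 : A F <;> simp [hF, hiff, h1, h2]
    · simp [hF]
  · intro F _ hF
    have : ¬ (F : Set (Sym2 V)) ⊆ G.edgeSet := fun h => hF (by
      rw [Finset.mem_powerset, ← Finset.coe_subset, SimpleGraph.coe_edgeFinset]
      exact h)
    simp [mass, mem_forests, this]

/-- Nonnegativity of the quadratic form is the inequality for the unnormalized partition weights. -/
theorem nonneg_pair_iff (w : Sym2 V → ℝ) :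
    0 ≤ pair (response (weightSum (JoinForest a b c d)) a b c d w)
      (response (weightSum (JoinForest a b c d)) a b c d w) ↔
    (weightSum (OneThree a b c d) w + weightSum (OneThree b a c d) w +
        weightSum (TwoTwo a c b d) w + weightSum (TwoTwo a d b c) w) *
      (weightSum (OneThree c a b d) w + weightSum (OneThree d a b c) w +
        weightSum (TwoTwo a c b d) w + weightSum (TwoTwo a d b c) w) ≤
      (weightSum (OneTwoOne a b c d) w + weightSum (OneTwoOne a b d c) w +
        weightSum (OneTwoOne b a c d) w + weightSum (OneTwoOne b a d c) w) *
          weightSum (JoinForest a b c d) w +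
        (weightSum (TwoTwo a c b d) w - weightSum (TwoTwo a d b c) w) ^ 2 := by
  rw [response_joinForest]
  simp only [pair, Matrix.cons_val]
  constructor <;> intro h <;> linarith

/-- The inequality for the weights of the partitions when two terminals coincide or when the
terminals are not all connected: one of the factors vanishes, or both are equal to a single
weight that also appears on the right. -/
theorem pair_response_nonneg_of_degenerate (h : a = b ∨ c = d ∨ (a = c ∧ b = d) ∨ (a = d ∧ b = c) ∨
      ¬ (G.Reachable d a ∧ G.Reachable d b ∧ G.Reachable d c)) {t : ℝ} (ht : 0 ≤ t) :
    0 ≤ pair (response (weightSum (JoinForest a b c d)) a b c d (t • edgeWeight G))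
      (response (weightSum (JoinForest a b c d)) a b c d (t • edgeWeight G)) := by
  rw [nonneg_pair_iff]
  set w := t • edgeWeight G with hw
  have hnn : ∀ P, 0 ≤ weightSum P w := fun P => weightSum_nonneg P (smul_edgeWeight_nonneg G ht)
  -- A partition does not occur if two terminals of one block are not connected in `G`, or if
  -- terminals of different blocks coincide.
  have z₁ : ∀ p q r s : V, (p = q ∨ p = r ∨ p = s ∨ ¬ G.Reachable q r ∨ ¬ G.Reachable q s) →
      weightSum (OneThree p q r s) w = 0 := by
    intro p q r s h
    refine weightSum_eq_zero fun F hF hle => ?_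
    obtain ⟨-, hpq, hqr, hqs⟩ := hF
    rcases h with rfl | rfl | rfl | h | h
    · exact hpq (SimpleGraph.Reachable.refl _)
    · exact hpq hqr.symm
    · exact hpq hqs.symm
    · exact h (hqr.mono hle)
    · exact h (hqs.mono hle)
  have z₂ : ∀ p q r s : V, (p = r ∨ p = s ∨ q = r ∨ q = s ∨ ¬ G.Reachable p q ∨
      ¬ G.Reachable r s) → weightSum (TwoTwo p q r s) w = 0 := by
    intro p q r s h
    refine weightSum_eq_zero fun F hF hle => ?_
    obtain ⟨-, hpr, hpq, hrs⟩ := hF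
    rcases h with rfl | rfl | rfl | rfl | h | h
    · exact hpr (SimpleGraph.Reachable.refl _)
    · exact hpr hrs.symm
    · exact hpr hpq
    · exact hpr (hpq.trans hrs.symm)
    · exact h (hpq.mono hle)
    · exact h (hrs.mono hle)
  have hD : 0 ≤ (weightSum (OneTwoOne a b c d) w + weightSum (OneTwoOne a b d c) w +
        weightSum (OneTwoOne b a c d) w + weightSum (OneTwoOne b a d c) w) *
          weightSum (JoinForest a b c d) w :=
    mul_nonneg (add_nonneg (add_nonneg (add_nonneg (hnn _) (hnn _)) (hnn _)) (hnn _)) (hnn _)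
  refine le_trans ?_ (le_add_of_nonneg_left hD)
  have y₁ := z₁ a b c d
  have y₂ := z₁ b a c d
  have y₃ := z₁ c a b d
  have y₄ := z₁ d a b c
  have y₅ := z₂ a c b d
  have y₆ := z₂ a d b c
  have hr := fun v => SimpleGraph.Reachable.refl (G := G) v
  have hs := fun u v (h : G.Reachable u v) => h.symm
  have htr := fun u v w (h : G.Reachable u v) (h' : G.Reachable v w) => h.trans h'
  set o₁ := weightSum (OneThree a b c d) w
  set o₂ := weightSum (OneThree b a c d) w
  set o₃ := weightSum (OneThree c a b d) w
  set o₄ := weightSum (OneThree d a b c) w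
  set o₅ := weightSum (TwoTwo a c b d) w
  set o₆ := weightSum (TwoTwo a d b c) w
  -- In each case a factor vanishes, or exactly one of the two pairings remains in both factors.
  suffices hcase : (o₁ = 0 ∧ o₂ = 0 ∧ o₅ = 0 ∧ o₆ = 0) ∨ (o₃ = 0 ∧ o₄ = 0 ∧ o₅ = 0 ∧ o₆ = 0) ∨
      (o₁ = 0 ∧ o₂ = 0 ∧ o₃ = 0 ∧ o₄ = 0 ∧ (o₅ = 0 ∨ o₆ = 0)) by
    rcases hcase with ⟨h1, h2, h3, h4⟩ | ⟨h1, h2, h3, h4⟩ | ⟨h1, h2, h3, h4, h5 | h5⟩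
    · rw [h1, h2, h3, h4]; simp
    · rw [h1, h2, h3, h4]; simp
    · rw [h1, h2, h3, h4, h5]; ring_nf; rfl
    · rw [h1, h2, h3, h4, h5]; ring_nf; rfl
  clear_value o₁ o₂ o₃ o₄ o₅ o₆
  clear z₁ z₂ hD hnn
  rcases h with h | h | h | h | h
  · exact Or.inl ⟨y₁ (by simp [h]), y₂ (by simp [h]), y₅ (by simp [h]), y₆ (by simp [h])⟩
  · exact Or.inr (Or.inl ⟨y₃ (by simp [h]), y₄ (by simp [h]), y₅ (by simp [h]), y₆ (by simp [h])⟩)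
  · obtain ⟨rfl, rfl⟩ := h
    exact Or.inr (Or.inr ⟨y₁ (by simp), y₂ (by simp), y₃ (by simp), y₄ (by simp),
      Or.inr (y₆ (by simp))⟩)
  · obtain ⟨rfl, rfl⟩ := h
    exact Or.inr (Or.inr ⟨y₁ (by simp), y₂ (by simp), y₃ (by simp), y₄ (by simp),
      Or.inl (y₅ (by simp))⟩)
  · generalize G.Reachable = R at *
    by_cases k₁ : R a c ∧ R b d
    · refine Or.inr (Or.inr ⟨y₁ ?_, y₂ ?_, y₃ ?_, y₄ ?_, Or.inr (y₆ ?_)⟩) <;> grind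
    by_cases k₂ : R a d ∧ R b c
    · refine Or.inr (Or.inr ⟨y₁ ?_, y₂ ?_, y₃ ?_, y₄ ?_, Or.inl (y₅ ?_)⟩) <;> grind
    by_cases k₃ : (R b c ∧ R c d) ∨ (R a c ∧ R c d)
    · refine Or.inr (Or.inl ⟨y₃ ?_, y₄ ?_, y₅ ?_, y₆ ?_⟩) <;> grind
    · refine Or.inl ⟨y₁ ?_, y₂ ?_, y₅ ?_, y₆ ?_⟩ <;> grind

theorem eventually_pair_nonneg (G : SimpleGraph V) (a b c d : V) : ∀ᶠ t : ℝ in Filter.atTop,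
    0 ≤ pair (response (weightSum (JoinForest a b c d)) a b c d (t • edgeWeight G))
      (response (weightSum (JoinForest a b c d)) a b c d (t • edgeWeight G)) := by
  by_cases h : a = b ∨ c = d ∨ (a = c ∧ b = d) ∨ (a = d ∧ b = c) ∨
      ¬ (G.Reachable d a ∧ G.Reachable d b ∧ G.Reachable d c)
  · filter_upwards [Filter.eventually_ge_atTop 0] with t ht
    exact pair_response_nonneg_of_degenerate h ht
  push Not at h
  obtain ⟨hab, hcd, h1, h2, ha, hb, hc⟩ := h
  -- At least one of `a` and `b` differs from both `c` and `d`.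
  by_cases hacd : a ≠ c ∧ a ≠ d
  · exact eventually_pair_nonneg_of_reachable hacd.1 hacd.2 hcd hab ha hb hc
  · have hbcd : b ≠ c ∧ b ≠ d := by
      constructor
      · rintro rfl
        exact hacd ⟨hab, fun had => h2 had rfl⟩
      · rintro rfl
        exact hacd ⟨fun hac => h1 hac rfl, hab⟩
    simp only [← pair_response_swap (a := a) (b := b)]
    exact eventually_pair_nonneg_of_reachable hbcd.1 hbcd.2 hcd hab.symm hb ha hc

end Partition

/-! ### Partitions as block events -/

section Blocks

variable {V : Type*}

theorem isForest_and_blocks_iff (a b c d : V) (F : Finset (Sym2 V)) :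
    (IsForest F ∧ Blocks [[a], [b, c, d]] F ↔ OneThree a b c d F) ∧
    (IsForest F ∧ Blocks [[a, c, d], [b]] F ↔ OneThree b a c d F) ∧
    (IsForest F ∧ Blocks [[c], [a, b, d]] F ↔ OneThree c a b d F) ∧
    (IsForest F ∧ Blocks [[a, b, c], [d]] F ↔ OneThree d a b c F) ∧
    (IsForest F ∧ Blocks [[a, c], [b, d]] F ↔ TwoTwo a c b d F) ∧
    (IsForest F ∧ Blocks [[a, d], [b, c]] F ↔ TwoTwo a d b c F) ∧
    (IsForest F ∧ Blocks [[a], [b, c], [d]] F ↔ OneTwoOne a b c d F) ∧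
    (IsForest F ∧ Blocks [[a], [b, d], [c]] F ↔ OneTwoOne a b d c F) ∧
    (IsForest F ∧ Blocks [[b], [a, c], [d]] F ↔ OneTwoOne b a c d F) ∧
    (IsForest F ∧ Blocks [[b], [a, d], [c]] F ↔ OneTwoOne b a d c F) ∧
    (IsForest F ∧ Blocks [[a, b, c, d]] F ↔ JoinForest a b c d F) := by
  have hr := fun v => SimpleGraph.Reachable.refl (G := spanningGraph F) v
  have hs := fun u v (h : (spanningGraph F).Reachable u v) => h.symm
  have ht := fun u v w (h : (spanningGraph F).Reachable u v)
    (h' : (spanningGraph F).Reachable v w) => h.trans h'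
  simp only [Blocks, OneThree, TwoTwo, OneTwoOne, JoinForest, Joins, List.mem_cons,
    List.not_mem_nil, or_false, forall_eq_or_imp, forall_eq, List.pairwise_cons,
    List.Pairwise.nil, and_true, IsEmpty.forall_iff, implies_true]
  generalize (spanningGraph F).Reachable = R at *
  refine ⟨?_, ?_, ?_, ?_, ?_, ?_, ?_, ?_, ?_, ?_, ?_⟩ <;> grind

end Blocks

end ArborealGas

theorem mainTheorem9 {V : Type*} [Fintype V] (G : SimpleGraph V) (a b c d : V) :
    ∀ᶠ lam : ℝ in Filter.atTop,
      (ArborealGas.μ G lam [[a], [b, c, d]] + ArborealGas.μ G lam [[a, c, d], [b]]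
          + ArborealGas.μ G lam [[a, c], [b, d]] + ArborealGas.μ G lam [[a, d], [b, c]])
        * (ArborealGas.μ G lam [[c], [a, b, d]] + ArborealGas.μ G lam [[a, b, c], [d]]
          + ArborealGas.μ G lam [[a, c], [b, d]] + ArborealGas.μ G lam [[a, d], [b, c]])
      ≤ (ArborealGas.μ G lam [[a], [b, c], [d]] + ArborealGas.μ G lam [[a], [b, d], [c]]
          + ArborealGas.μ G lam [[b], [a, c], [d]] + ArborealGas.μ G lam [[b], [a, d], [c]])
          * ArborealGas.μ G lam [[a, b, c, d]]
        + (ArborealGas.μ G lam [[a, c], [b, d]] - ArborealGas.μ G lam [[a, d], [b, c]]) ^ 2 := by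
  filter_upwards [ArborealGas.eventually_pair_nonneg G a b c d] with lam h
  rw [ArborealGas.nonneg_pair_iff] at h
  have hB := ArborealGas.isForest_and_blocks_iff a b c d
  simp only [forall_and] at hB
  obtain ⟨h₁, h₂, h₃, h₄, h₅, h₆, h₇, h₈, h₉, h₁₀, h₁₁⟩ := hB
  simp only [ArborealGas.μ, ArborealGas.prob_eq_weightSum, h₁, h₂, h₃, h₄, h₅, h₆, h₇, h₈, h₉, h₁₀,
    h₁₁]
  simp only [← add_div, ← sub_div, div_mul_div_comm, div_pow, ← pow_two]
  gcongr
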